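/- Let $F_n$ be the free group of rank $n$ and $R_n$ the standard rose with $\pi_1(R_n)=F_n$. A marked graph $(G,g)$ is a finite connected graph $G$ with all vertices of valence at least $3$ together with a homotopy equivalence $g\colon R_n\to G$; $(G,g)$ and $(G',g')$ are equivalent if $h\circ g\simeq g'$ for some graph isomorphism $h\colon G\to G'$. Write $(G',g')\le (G,g)$ if $(G',g')$ is equivalent to $(G/\!/F,\,c_F\circ g)$, where $c_F\colon G\to G/\!/F$ collapses each component of a forest $F\subset G$ to a point. Let $L_n$ be the order complex of the poset of equivalence classes of marked graphs without separating edges, and for a marked rose $\rho$ (a marked graph with one vertex) let $st(\rho)$ be its closed simplicial star in $L_n$. Fix a basis of $F_n$ and a list $\mathcal W=(w_1,w_2,\dots)$ of the non-trivial conjugacy classes of $F_n$ up to inversion, without repetition, in order of non-decreasing cyclically reduced word length. The norm of a marked rose $\rho=(R,r)$ is $\|\rho\|=(\ell_R(r(w_1)),\ell_R(r(w_2)),\dots)\in\mathbb Z^{\mathcal W}$, with the lexicographic order, where $\ell_R(\gamma)$ is the length of a shortest edge loop freely homotopic to $\gamma$. Put $L_{<\rho}=\bigcup_{\|\rho'\|<\|\rho\|}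 st(\rho')$, the union over marked roses $\rho'$. A marked graph is called reductive (with respect to $\rho$) if it is a vertex of $st(\rho)\cap L_{<\rho}$. An ideal edge of $\rho$ is a vertex of $st(\rho)$ whose graph has exactly two vertices; the ideal edges of a vertex $x$ of $st(\rho)$ are the ideal edges $\alpha\le x$. Two ideal edges are compatible if both are $\le z$ for some vertex $z$ of $st(\rho)$, and cross otherwise. A reductive marked graph is strictly reductive if all its ideal edges are reductive. A maximally reductive ideal edge is an ideal edge $\mu$ for which there is a marked rose $\rho'\le\mu$ such that $\|\rho\|-\|\rho'\|$ is positive and is the largest value of $\|\rho\|-\|\sigma\|$ over all marked roses $\sigma$ with $\sigma\le\alpha$ for some ideal edge $\alpha$ of $\rho$. Theorem. Let $\rho$ be a marked rose such that $st(\rho)\cap L_{<\rho}$ is non-empty. Then $st(\rho)\cap L_{<\rho}$ is contractible. Moreover: 1. $st(\rho)\cap L_{<\rho}$ deformation retracts to the full subcomplex $Q$ spanned by the strictly reductive marked graphs. 2. A maximally reductive ideal edge exists. For every maximally reductive ideal edge $\mu$, the complex $Q$ deformation retracts to the full subcomplex $Q_\mu$ spanned by the strictly reductive marked graphs none of whose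 ideal edges crosses $\mu$, and $Q_\mu$ deformation retracts to its vertex $\mu$. (All deformation retractions are strong: they fix the subcomplex pointwise throughout.) -/

import Mathlib

namespace OuterSpace

/-! ## Graphs, edge paths and their homotopies -/

/-- A finite graph, possibly with loops and multiple edges. `D` is the set of half-edges
(equivalently, of oriented edges): the half-edge `d` is attached at the vertex `src d`, and
`d, inv d` are the two halves of one edge. -/
structure FinGraph where
  V : Type
  D : Type
  src : D → V
  inv : D → D
  inv_inv : ∀ d, inv (inv d) = d
  inv_ne : ∀ d, inv d ≠ d
  finite_V : Finite V
  finite_D : Finite D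

namespace FinGraph

/-- The terminal vertex of an oriented edge. -/
def tgt (G : FinGraph) (d : G.D) : G.V := G.src (G.inv d)

/-- `l` is an edge path in `G` from the first to the second vertex. -/
def IsWalk (G : FinGraph) : G.V → List G.D → G.V → Prop
  | u, [], v => u = v
  | u, d :: l, v => G.src d = u ∧ G.IsWalk (G.tgt d) l v

/-- The edge path traversed backwards. -/
def rev (G : FinGraph) (l : List G.D) : List G.D := (l.map G.inv).reverse

/-- Removal of one backtrack. -/
inductive Cancel (G : FinGraph) : List G.D → List G.D → Prop
  | mk (l₁ l₂ : List G.D) (d : G.D) : Cancel G (l₁ ++ d :: G.inv d :: l₂) (l₁ ++ l₂)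

/-- Homotopy of edge paths relative to their endpoints. -/
def PathHomotopic (G : FinGraph) : List G.D → List G.D → Prop :=
  Relation.EqvGen G.Cancel

/-- Free homotopy of closed edge paths, `l` based at `u` and `l'` based at `v`. -/
def FreelyHomotopic (G : FinGraph) (u : G.V) (l : List G.D) (v : G.V) (l' : List G.D) : Prop :=
  ∃ p, G.IsWalk u p v ∧ G.PathHomotopic (l ++ p) (p ++ l')

/-- The length of the shortest closed edge path in the free homotopy class of the closed edge
path `l` based at `u`. -/
noncomputable def loopLength (G : FinGraph) (u : G.V) (l : List G.D) : ℕ :=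
  sInf {m | ∃ v l', G.IsWalk v l' v ∧ G.FreelyHomotopic u l v l' ∧ l'.length = m}

/-- The valence of a vertex. -/
noncomputable def valence (G : FinGraph) (v : G.V) : ℕ := Nat.card {d : G.D // G.src d = v}

/-- No edge of `G` is separating: the ends of every edge are joined by an edge path that avoids
that edge. -/
def NoSeparatingEdge (G : FinGraph) : Prop :=
  ∀ d, ∃ l, G.IsWalk (G.src d) l (G.tgt d) ∧ d ∉ l ∧ G.inv d ∉ l

/-- A set of edges is a forest if it contains no non-trivial closed edge path without
backtracking. -/
def IsForest (G : FinGraph) (F : Set G.D) : Prop :=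
  ∀ v l, G.IsWalk v l v → (∀ d ∈ l, d ∈ F) → l.IsChain (fun d e => e ≠ G.inv d) → l = []

/-- The rose with `n` petals; `(i, true)` and `(i, false)` are the two orientations of the
`i`-th petal, so that an edge path is a word in the generators and their inverses. -/
def rose (n : ℕ) : FinGraph where
  V := Unit
  D := Fin n × Bool
  src _ := ()
  inv d := (d.1, !d.2)
  inv_inv d := by simp
  inv_ne d := by
    obtain ⟨i, b⟩ := d
    cases b <;> simp
  finite_V := inferInstance
  finite_D := inferInstance

lemma IsWalk.append {G : FinGraph} {u v w : G.V} {l l' : List G.D}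
    (h : G.IsWalk u l v) (h' : G.IsWalk v l' w) : G.IsWalk u (l ++ l') w := by
  induction l generalizing u with
  | nil => cases h; exact h'
  | cons d l ih => exact ⟨h.1, ih h.2⟩

lemma IsWalk.rev {G : FinGraph} {u v : G.V} {l : List G.D}
    (h : G.IsWalk u l v) : G.IsWalk v (G.rev l) u := by
  induction l generalizing u with
  | nil => cases h; rfl
  | cons d l ih =>
    have := (ih h.2).append (w := u) (l' := [G.inv d]) ⟨rfl, by
      simp [tgt, G.inv_inv, IsWalk, h.1]⟩
    simpa [FinGraph.rev] using this

lemma rev_append (G : FinGraph) (l l' : List G.D) : G.rev (l ++ l') = G.rev l' ++ G.rev l := by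
  simp [rev]

lemma rev_rev (G : FinGraph) (l : List G.D) : G.rev (G.rev l) = l := by
  simp [rev, Function.comp_def, G.inv_inv]

namespace PathHomotopic

variable {G : FinGraph}

lemma refl (l : List G.D) : G.PathHomotopic l l := Relation.EqvGen.refl l

lemma symm {l l' : List G.D} (h : G.PathHomotopic l l') : G.PathHomotopic l' l :=
  Relation.EqvGen.symm _ _ h

lemma trans {l l' l'' : List G.D} (h : G.PathHomotopic l l') (h' : G.PathHomotopic l' l'') :
    G.PathHomotopic l l'' := Relation.EqvGen.trans _ _ _ h h'

lemma append {l₁ l₁' l₂ l₂' : List G.D} (h : G.PathHomotopic l₁ l₁')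
    (h' : G.PathHomotopic l₂ l₂') : G.PathHomotopic (l₁ ++ l₂) (l₁' ++ l₂') := by
  refine trans (l' := l₁' ++ l₂) ?_ ?_
  · induction h with
    | rel x y h =>
      obtain ⟨a, b, d⟩ := h
      simpa [PathHomotopic] using Relation.EqvGen.rel _ _ (Cancel.mk (G := G) a (b ++ l₂) d)
    | refl x => exact refl _
    | symm x y _ ih => exact ih.symm
    | trans x y z _ _ ih ih' => exact ih.trans ih'
  · induction h' with
    | rel x y h =>
      obtain ⟨a, b, d⟩ := h
      simpa [PathHomotopic] using Relation.EqvGen.rel _ _ (Cancel.mk (G := G) (l₁' ++ a) b d)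
    | refl x => exact refl _
    | symm x y _ ih => exact ih.symm
    | trans x y z _ _ ih ih' => exact ih.trans ih'

lemma append_rev (l : List G.D) : G.PathHomotopic (l ++ G.rev l) [] := by
  induction l with
  | nil => exact refl _
  | cons d l ih =>
    have h1 := (refl (G := G) [d]).append (ih.append (refl [G.inv d]))
    have h2 : G.PathHomotopic [d, G.inv d] [] := Relation.EqvGen.rel _ _ (Cancel.mk [] [] d)
    have h3 := h1.trans (by simpa using h2)
    simpa [FinGraph.rev] using h3

lemma rev_append_self (l : List G.D) : G.PathHomotopic (G.rev l ++ l) [] := by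
  have := append_rev (G := G) (G.rev l)
  rwa [rev_rev] at this

end PathHomotopic

end FinGraph

/-! ## Maps of graphs up to homotopy -/

/-- A continuous map of graphs in combinatorial form: vertices go to vertices, edges go to edge
paths. -/
structure PathMap (G G' : FinGraph) where
  onV : G.V → G'.V
  onD : G.D → List G'.D
  walk : ∀ d, G'.IsWalk (onV (G.src d)) (onD d) (onV (G.tgt d))
  inv : ∀ d, onD (G.inv d) = G'.rev (onD d)

namespace PathMap

open FinGraph

variable {G G' G'' G''' : FinGraph}

/-- The image of an edge path. -/
def onPath (f : PathMap G G') (l : List G.D) : List G'.D := l.flatMap f.onD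

lemma onPath_walk (f : PathMap G G') {u v : G.V} {l : List G.D} (h : G.IsWalk u l v) :
    G'.IsWalk (f.onV u) (f.onPath l) (f.onV v) := by
  induction l generalizing u with
  | nil => cases h; rfl
  | cons d l ih =>
    obtain ⟨rfl, h⟩ := h
    simpa [onPath] using (f.walk d).append (ih h)

lemma onPath_append (f : PathMap G G') (l l' : List G.D) :
    f.onPath (l ++ l') = f.onPath l ++ f.onPath l' := by simp [onPath]

lemma onPath_rev (f : PathMap G G') (l : List G.D) :
    f.onPath (G.rev l) = G'.rev (f.onPath l) := by
  induction l with
  | nil => rfl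
  | cons d l ih =>
    have h1 : G.rev (d :: l) = G.rev l ++ [G.inv d] := by simp [FinGraph.rev]
    have h2 : f.onPath (d :: l) = f.onD d ++ f.onPath l := by simp [onPath]
    rw [h1, h2, onPath_append, ih, rev_append]
    simp [onPath, f.inv]

lemma onPath_homotopic (f : PathMap G G') {l l' : List G.D} (h : G.PathHomotopic l l') :
    G'.PathHomotopic (f.onPath l) (f.onPath l') := by
  induction h with
  | rel x y h =>
    obtain ⟨a, b, d⟩ := h
    have := (PathHomotopic.refl (f.onPath a)).append
      ((PathHomotopic.append_rev (f.onD d)).append (PathHomotopic.refl (f.onPath b)))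
    simpa [onPath, f.inv] using this
  | refl x => exact PathHomotopic.refl _
  | symm x y _ ih => exact ih.symm
  | trans x y z _ _ ih ih' => exact ih.trans ih'

/-- The identity map. -/
def id (G : FinGraph) : PathMap G G where
  onV v := v
  onD d := [d]
  walk _ := ⟨rfl, rfl⟩
  inv _ := rfl

/-- The composite `g ∘ f`. -/
def comp (g : PathMap G' G'') (f : PathMap G G') : PathMap G G'' where
  onV v := g.onV (f.onV v)
  onD d := g.onPath (f.onD d)
  walk d := g.onPath_walk (f.walk d)
  inv d := by rw [f.inv, onPath_rev]

/-- Homotopy of maps of graphs: `p v` is the track of the vertex `v`. -/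
def Homotopic (f g : PathMap G G') : Prop :=
  ∃ p : G.V → List G'.D, (∀ v, G'.IsWalk (f.onV v) (p v) (g.onV v)) ∧
    ∀ d, G'.PathHomotopic (f.onD d ++ p (G.tgt d)) (p (G.src d) ++ g.onD d)

/-- Homotopy equivalences. -/
def IsHomotopyEquiv (f : PathMap G G') : Prop :=
  ∃ g : PathMap G' G, (g.comp f).Homotopic (id G) ∧ (f.comp g).Homotopic (id G')

lemma Homotopic.refl (f : PathMap G G') : f.Homotopic f :=
  ⟨fun _ => [], fun _ => rfl, fun d => by simpa using PathHomotopic.refl (f.onD d)⟩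

lemma Homotopic.symm {f g : PathMap G G'} (h : f.Homotopic g) : g.Homotopic f := by
  obtain ⟨p, hp, h⟩ := h
  refine ⟨fun v => G'.rev (p v), fun v => (hp v).rev, fun d => ?_⟩
  have h1 := ((PathHomotopic.refl (G'.rev (p (G.src d)))).append
    ((h d).append (PathHomotopic.refl (G'.rev (p (G.tgt d)))))).symm
  have h2 := (PathHomotopic.rev_append_self (p (G.src d))).append
    (PathHomotopic.refl (g.onD d ++ G'.rev (p (G.tgt d))))
  have h3 := (PathHomotopic.refl (G'.rev (p (G.src d)) ++ f.onD d)).append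
    (PathHomotopic.append_rev (p (G.tgt d)))
  simp only [List.append_assoc, List.nil_append, List.append_nil] at h1 h2 h3
  exact h2.symm.trans (h1.trans h3)

lemma Homotopic.trans {f g k : PathMap G G'} (h : f.Homotopic g) (h' : g.Homotopic k) :
    f.Homotopic k := by
  obtain ⟨p, hp, h⟩ := h
  obtain ⟨q, hq, h'⟩ := h'
  refine ⟨fun v => p v ++ q v, fun v => (hp v).append (hq v), fun d => ?_⟩
  have h1 := (h d).append (PathHomotopic.refl (q (G.tgt d)))
  have h2 := (PathHomotopic.refl (p (G.src d))).append (h' d)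
  simp only [List.append_assoc] at h1 h2 ⊢
  exact h1.trans h2

lemma Homotopic.comp_left {f g : PathMap G G'} (k : PathMap G' G'') (h : f.Homotopic g) :
    (k.comp f).Homotopic (k.comp g) := by
  obtain ⟨p, hp, h⟩ := h
  refine ⟨fun v => k.onPath (p v), fun v => k.onPath_walk (hp v), fun d => ?_⟩
  simpa [comp, onPath_append] using k.onPath_homotopic (h d)

end PathMap

/-- An isomorphism of graphs. -/
structure GraphIso (G G' : FinGraph) where
  onV : G.V ≃ G'.V
  onD : G.D ≃ G'.D
  src : ∀ d, G'.src (onD d) = onV (G.src d)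
  inv : ∀ d, onD (G.inv d) = G'.inv (onD d)

namespace GraphIso

variable {G G' G'' : FinGraph}

/-- An isomorphism as a map of graphs. -/
def toPathMap (h : GraphIso G G') : PathMap G G' where
  onV := h.onV
  onD d := [h.onD d]
  walk d := ⟨h.src d, by simp [FinGraph.IsWalk, FinGraph.tgt, ← h.inv, h.src]⟩
  inv d := by simp [FinGraph.rev, h.inv]

/-- The identity. -/
def refl (G : FinGraph) : GraphIso G G where
  onV := Equiv.refl _
  onD := Equiv.refl _
  src _ := rfl
  inv _ := rfl

/-- The inverse isomorphism. -/
def symm (h : GraphIso G G') : GraphIso G' G where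
  onV := h.onV.symm
  onD := h.onD.symm
  src d := by simp [Equiv.eq_symm_apply, ← h.src]
  inv d := by simp [Equiv.symm_apply_eq, h.inv]

/-- The composite isomorphism. -/
def trans (h : GraphIso G G') (h' : GraphIso G' G'') : GraphIso G G'' where
  onV := h.onV.trans h'.onV
  onD := h.onD.trans h'.onD
  src d := by simp [h.src, h'.src]
  inv d := by simp [h.inv, h'.inv]

end GraphIso

/-- A forest collapse `G → G'`: the edges of a forest of `G` (those sent to `none`) are shrunk,
and `G'` is the quotient, i.e. its edges are the remaining edges of `G` and its vertices are the
components of the forest (isolated vertices included). -/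
structure ForestCollapse (G G' : FinGraph) where
  onV : G.V → G'.V
  onD : G.D → Option G'.D
  inv : ∀ d, onD (G.inv d) = (onD d).map G'.inv
  src : ∀ d d', onD d = some d' → G'.src d' = onV (G.src d)
  forest : G.IsForest {d | onD d = none}
  onV_surjective : Function.Surjective onV
  onV_eq_iff : ∀ u v, onV u = onV v ↔ ∃ l, G.IsWalk u l v ∧ ∀ d ∈ l, onD d = none
  onD_bijective : ∀ d', ∃! d, onD d = some d'

/-- A forest collapse as a map of graphs. -/
def ForestCollapse.toPathMap {G G' : FinGraph} (c : ForestCollapse G G') : PathMap G G' where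
  onV := c.onV
  onD d := (c.onD d).toList
  walk d := by
    cases h : c.onD d with
    | none =>
      exact (c.onV_eq_iff _ _).2 ⟨[d], ⟨rfl, rfl⟩, by simpa using h⟩
    | some d' =>
      refine ⟨c.src d d' h, (c.src (G.inv d) (G'.inv d') ?_)⟩
      simp [c.inv, h]
  inv d := by
    rw [c.inv]
    cases c.onD d <;> rfl

/-! ## Marked graphs and the spine -/

/-- A marked graph: a finite graph with all valences at least three and a homotopy equivalence
from the standard rose, whose fundamental group is the free group of rank `n`. -/
structure MarkedGraph (n : ℕ) where
  G : FinGraph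
  g : PathMap (FinGraph.rose n) G
  isHomotopyEquiv : g.IsHomotopyEquiv
  three_le_valence : ∀ v, 3 ≤ G.valence v

namespace MarkedGraph

variable {n : ℕ}

/-- Equivalence of marked graphs. -/
def Equivalent (a b : MarkedGraph n) : Prop :=
  ∃ h : GraphIso a.G b.G, (h.toPathMap.comp a.g).Homotopic b.g

/-- `b` is obtained from `a` by a forest collapse. -/
def CollapsesTo (a b : MarkedGraph n) : Prop :=
  ∃ c : ForestCollapse a.G b.G, (c.toPathMap.comp a.g).Homotopic b.g

lemma Equivalent.refl (a : MarkedGraph n) : a.Equivalent a := by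
  refine ⟨GraphIso.refl _, ?_⟩
  have : (GraphIso.refl a.G).toPathMap.comp a.g = a.g := by
    obtain ⟨G, ⟨v, e, w, i⟩, _, _⟩ := a
    simp [PathMap.comp, GraphIso.toPathMap, GraphIso.refl, PathMap.onPath]
  rw [this]
  exact PathMap.Homotopic.refl _

lemma Equivalent.symm {a b : MarkedGraph n} (h : a.Equivalent b) : b.Equivalent a := by
  obtain ⟨h, H⟩ := h
  refine ⟨h.symm, ?_⟩
  have H' := H.symm.comp_left h.symm.toPathMap
  have : h.symm.toPathMap.comp (h.toPathMap.comp a.g) = a.g := by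
    obtain ⟨G, ⟨v, e, w, i⟩, _, _⟩ := a
    simp [PathMap.comp, GraphIso.toPathMap, GraphIso.symm, PathMap.onPath, List.flatMap_assoc]
  rwa [this] at H'

lemma Equivalent.trans {a b c : MarkedGraph n} (h : a.Equivalent b) (h' : b.Equivalent c) :
    a.Equivalent c := by
  obtain ⟨h, H⟩ := h
  obtain ⟨h', H'⟩ := h'
  refine ⟨h.trans h', ?_⟩
  have : (h.trans h').toPathMap.comp a.g = h'.toPathMap.comp (h.toPathMap.comp a.g) := by
    simp [PathMap.comp, GraphIso.toPathMap, GraphIso.trans, PathMap.onPath, List.flatMap_assoc]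
  rw [this]
  exact (H.comp_left _).trans H'

instance setoid (n : ℕ) : Setoid (MarkedGraph n) where
  r := Equivalent
  iseqv := ⟨Equivalent.refl, Equivalent.symm, Equivalent.trans⟩

/-- A marked rose: the underlying graph has one vertex. -/
def IsRose (a : MarkedGraph n) : Prop := Nat.card a.G.V = 1

end MarkedGraph

/-- The vertices of the spine `K_n`: marked graphs up to equivalence. -/
abbrev SpineVertex (n : ℕ) := Quotient (MarkedGraph.setoid n)

/-- The vertex of the spine given by a marked graph. -/
abbrev MarkedGraph.cls {n : ℕ} (a : MarkedGraph n) : SpineVertex n :=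
  Quotient.mk (MarkedGraph.setoid n) a

namespace SpineVertex

variable {n : ℕ}

/-- `x ≤ y` if `x` is obtained from `y` by a forest collapse. -/
instance : LE (SpineVertex n) where
  le x y := ∃ a b : MarkedGraph n, a.cls = x ∧ b.cls = y ∧ b.CollapsesTo a

/-- The graph has no separating edges. -/
def Nonseparating (x : SpineVertex n) : Prop :=
  ∃ a : MarkedGraph n, a.cls = x ∧ a.G.NoSeparatingEdge

/-- The graph has exactly two vertices. -/
def IsTwoVertex (x : SpineVertex n) : Prop :=
  ∃ a : MarkedGraph n, a.cls = x ∧ Nat.card a.G.V = 2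

end SpineVertex

/-! ## The norm of a marked rose -/

/-- A list of the non-trivial conjugacy classes of the free group, up to inversion and without
repetition, in order of non-decreasing cyclically reduced word length with respect to some
basis. -/
structure ClassList (n : ℕ) where
  basis : FreeGroupBasis (Fin n) (FreeGroup (Fin n))
  w : ℕ → FreeGroup (Fin n)
  w_ne_one : ∀ i, w i ≠ 1
  existsUnique : ∀ x : FreeGroup (Fin n), x ≠ 1 → ∃! i, IsConj x (w i) ∨ IsConj x (w i)⁻¹
  monotone_length :
    Monotone fun i => sInf {m | ∃ y, IsConj (w i) y ∧ (basis.repr y).norm = m}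

/-- The norm: the sequence of the lengths of the loops that represent the listed conjugacy
classes, in the lexicographically ordered group of integer sequences. -/
noncomputable def MarkedGraph.norm {n : ℕ} (W : ClassList n) (a : MarkedGraph n) :
    Lex (ℕ → ℤ) :=
  toLex fun i => (a.G.loopLength (a.g.onV ()) (a.g.onPath (W.w i).toWord) : ℤ)

/-! ## Simplicial complexes -/

section Simplicial

variable {ι : Type*}

/-- The closed simplicial star of a vertex. -/
def simplicialStar (K : PreAbstractSimplicialComplex ι) (v : ι) : PreAbstractSimplicialComplex ι where
  faces := {s | s ∈ K.faces ∧ ∃ t ∈ K.faces, v ∈ t ∧ s ⊆ t}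
  isRelLowerSet_faces := fun _ ⟨hs, t, ht, hv, hst⟩ =>
    ⟨(K.isRelLowerSet_faces hs).1, fun _ hr hr0 =>
      ⟨(K.isRelLowerSet_faces hs).2 hr hr0, t, ht, hv, subset_trans hr hst⟩⟩

/-- The full subcomplex spanned by the vertices in `S`. -/
def fullSubcomplex (K : PreAbstractSimplicialComplex ι) (S : Set ι) :
    PreAbstractSimplicialComplex ι where
  faces := {s | s ∈ K.faces ∧ ∀ x ∈ s, x ∈ S}
  isRelLowerSet_faces := fun _ ⟨hs, h⟩ =>
    ⟨(K.isRelLowerSet_faces hs).1, fun _ hr hr0 =>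
      ⟨(K.isRelLowerSet_faces hs).2 hr hr0, fun x hx => h x (hr hx)⟩⟩

/-- The points of the geometric realization, in barycentric coordinates. -/
@[ext]
structure Realization (K : PreAbstractSimplicialComplex ι) where
  coord : ι → ℝ
  nonneg : ∀ i, 0 ≤ coord i
  exists_face : ∃ s ∈ K.faces, (∀ i, i ∉ s → coord i = 0) ∧ ∑ i ∈ s, coord i = 1

/-- The inclusion of a closed simplex. -/
noncomputable def Realization.ofFace (K : PreAbstractSimplicialComplex ι) (s : K.faces)
    (x : stdSimplex ℝ s.1) : Realization K where
  coord := Function.extend Subtype.val x.1 0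
  nonneg i := by
    by_cases h : i ∈ s.1
    · have := Subtype.val_injective.extend_apply x.1 (0 : ι → ℝ) (⟨i, h⟩ : s.1)
      rw [this]
      exact x.2.1 _
    · rw [Function.extend_apply' _ _ _ (by rintro ⟨a, rfl⟩; exact h a.2)]
      simp
  exists_face := by
    refine ⟨s.1, s.2, fun i h => ?_, ?_⟩
    · rw [Function.extend_apply' _ _ _ (by rintro ⟨a, rfl⟩; exact h a.2)]
      simp
    · rw [← Finset.sum_coe_sort, ← x.2.2]
      exact Finset.sum_congr rfl fun i _ => Subtype.val_injective.extend_apply x.1 (0 : ι → ℝ) i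

/-- The weak topology: a set is open if its intersection with every closed simplex is open. -/
noncomputable instance (K : PreAbstractSimplicialComplex ι) : TopologicalSpace (Realization K) :=
  ⨆ s : K.faces, TopologicalSpace.coinduced (Realization.ofFace K s) inferInstance

/-- `L` is a subcomplex of `K`, and `|K|` deformation retracts to `|L|`, by a deformation that
fixes `|L|` pointwise. -/
def DeformationRetractsTo (K L : PreAbstractSimplicialComplex ι) : Prop :=
  L ≤ K ∧
    let A : Set (Realization K) := {x | ∃ s ∈ L.faces, ∀ i, i ∉ s → x.coord i = 0}
    ∃ r : C(Realization K, Realization K), (∀ x, r x ∈ A) ∧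
      (ContinuousMap.id (Realization K)).HomotopicRel r A

end Simplicial

/-! ## The reductive part of the star of a rose -/

section Star

variable {n : ℕ}

/-- The complex `L_n`: simplices are chains of forest collapses of marked graphs without
separating edges. -/
def complexL (n : ℕ) : PreAbstractSimplicialComplex (SpineVertex n) where
  faces := {s | s.Nonempty ∧ (∀ x ∈ s, ∀ y ∈ s, x ≤ y ∨ y ≤ x) ∧ ∀ x ∈ s, x.Nonseparating}
  isRelLowerSet_faces := fun _ ⟨h0, hc, hn⟩ =>
    ⟨h0, fun _ hr hr0 =>
      ⟨hr0, fun x hx y hy => hc x (hr hx) y (hr hy), fun x hx => hn x (hr hx)⟩⟩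

/-- The star of a marked graph in `L_n`. -/
def st (ρ : MarkedGraph n) : PreAbstractSimplicialComplex (SpineVertex n) :=
  simplicialStar (complexL n) ρ.cls

/-- The union `L_{<ρ}` of the stars of all marked roses of smaller norm than `ρ`. -/
noncomputable def complexBelow (W : ClassList n) (ρ : MarkedGraph n) :
    PreAbstractSimplicialComplex (SpineVertex n) :=
  ⨆ ρ' : {ρ' : MarkedGraph n // ρ'.IsRose ∧ ρ'.norm W < ρ.norm W}, st ρ'.1

/-- The complex `st(ρ) ∩ L_{<ρ}` of reductive graphs. -/
noncomputable def reductiveComplex (W : ClassList n) (ρ : MarkedGraph n) :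
    PreAbstractSimplicialComplex (SpineVertex n) :=
  st ρ ⊓ complexBelow W ρ

/-- The graph `x` is reductive. -/
def IsReductive (W : ClassList n) (ρ : MarkedGraph n) (x : SpineVertex n) : Prop :=
  {x} ∈ (reductiveComplex W ρ).faces

/-- The ideal edges of `ρ`: the two-vertex graphs in `st(ρ)`. -/
def IsIdealEdge (ρ : MarkedGraph n) (α : SpineVertex n) : Prop :=
  α.IsTwoVertex ∧ {α} ∈ (st ρ).faces

/-- All ideal edges of the ideal tree corresponding to the graph `x` in `st(ρ)` are
reductive. -/
def EdgesReductive (W : ClassList n) (ρ : MarkedGraph n) (x : SpineVertex n) : Prop :=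
  ∀ α, IsIdealEdge ρ α → α ≤ x → IsReductive W ρ α

/-- Two ideal edges are compatible if they lie in a common ideal tree, and cross otherwise. -/
def Compatible (ρ : MarkedGraph n) (α β : SpineVertex n) : Prop :=
  ∃ z, {z} ∈ (st ρ).faces ∧ α ≤ z ∧ β ≤ z

/-- The subcomplex of strictly reductive graphs. -/
noncomputable def strictComplex (W : ClassList n) (ρ : MarkedGraph n) :
    PreAbstractSimplicialComplex (SpineVertex n) :=
  fullSubcomplex (reductiveComplex W ρ) {x | EdgesReductive W ρ x}

/-- The subcomplex of strictly reductive graphs none of whose ideal edges crosses `μ`. -/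
noncomputable def strictComplexAlong (W : ClassList n) (ρ : MarkedGraph n) (μ : SpineVertex n) :
    PreAbstractSimplicialComplex (SpineVertex n) :=
  fullSubcomplex (strictComplex W ρ) {x | ∀ α, IsIdealEdge ρ α → α ≤ x → Compatible ρ α μ}

/-- A maximally reductive ideal edge: it is adjacent to a rose `ρ'` for which the decrease
`‖ρ‖ - ‖ρ'‖` of the norm is positive and as large as possible among all roses adjacent to some
ideal edge of `ρ`. (If `ρ'` is obtained from `μ` by collapsing the edge `m`, then
`‖ρ‖ - ‖ρ'‖ = |m| - |μ|`.) -/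
def IsMaximallyReductive (W : ClassList n) (ρ : MarkedGraph n) (μ : SpineVertex n) : Prop :=
  IsIdealEdge ρ μ ∧ ∃ ρ' : MarkedGraph n, ρ'.IsRose ∧ ρ'.cls ≤ μ ∧
    0 < ρ.norm W - ρ'.norm W ∧
    ∀ (α : SpineVertex n) (σ : MarkedGraph n), IsIdealEdge ρ α → σ.IsRose → σ.cls ≤ α →
      ρ.norm W - σ.norm W ≤ ρ.norm W - ρ'.norm W

end Star

end OuterSpace

/-! The star of the rose `ρ` is described by combinatorics on its set of half-edges. A graph above
`ρ` collapses to `ρ` along a maximal tree, and every tree edge divides the half-edges of `ρ` into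
two sides. Valence at least three makes both sides have at least two elements, the absence of
separating edges makes some petal run between them, and sides of edges of one tree are nested.
Conversely, a complement-closed family of pairwise nested sides (`IsSideSystem`) is realized by the
graph `blowUp`, whose vertices are the consistent choices of one side of every edge. By
`exists_iso_blowUp` every graph in the star arises in this way. By `subset_of_collapsesTo`, which
rests on the rigidity of homotopic collapses to a rose (`onD_eq_of_homotopic`), forest collapses
correspond to inclusions of families. So the star is the order complex of the families of sides,
ordered by inclusion.

Norms become weights of trees. Represent each listed conjugacy class by a cyclically reduced closed
path in a graph above `ρ`. Shrinking a maximal tree shortens the path by the number of its passages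
over the tree, and the image is still cyclically reduced, hence shortest. Among the roses below the
graph a smaller norm therefore means a heavier tree, with weights in a lexicographically ordered
group. A tree that no single exchange improves is heaviest (`IsSpanningTree.weight_le`), so a
smaller rose lies below a family exactly when exchanging one tree edge for one petal already gains.
The weight of a petal counts passages over it; the weight of a side `A` counts turns between `A` and
its complement; the exchange gains when a petal split by `A` outweighs `A`. Let `P` be the set of
sides with such a petal (`reductiveSides`). Then `st(ρ) ∩ L_{<ρ}` is the order complex of the
families meeting `P`, `Q` that of the non-empty families inside `P`, and `Q_μ` that of those among
the latter nested with a side `M` of `μ`.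

All retractions are obtained by removing dominated vertices one at a time (`Dismantles`); each
removal is a strong deformation retraction. A monotone idempotent map of a finite poset that only
decreases, or only increases, elements gives such a sequence (`dismantles_of_le`,
`dismantles_of_ge`). The map `S ↦ S ∩ P` leads to `Q`. The maps `S ≤ S ∪ {M, Mᶜ} ≥ {M, Mᶜ}` contract
`Q_μ` to `μ`.

Between the two, sides crossing `M` have to be eliminated, and this is where maximality enters. If
`A ∈ P` crosses `M`, then `A ∩ M` or `A ∩ Mᶜ` is again in `P` (`exists_corner`): turn counts are
submodular, so two opposite corners together weigh at most as much as `A` and `M`; suitable petals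
split the two corners; one corner gains at most as much as `M`, hence the other gains at least as
much as `A`. For `A` minimal among the crossing sides, this corner `Z` can be added to every family
containing `A`, and afterwards `A` can be deleted. Repeating this removes all crossing sides
(`dismantles_treesAlong`). -/

namespace OuterSpace

/-! ## Deformation retractions of finite clique complexes -/

section Topology

/-- `X` strongly deformation retracts to its subset `Y`. -/
def StrongRetract {E : Type*} [TopologicalSpace E] (X Y : Set E) : Prop :=
  Y ⊆ X ∧ ∃ r : C(X, X), (∀ x, (r x : E) ∈ Y) ∧
    (ContinuousMap.id X).HomotopicRel r {x | (x : E) ∈ Y}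

lemma StrongRetract.refl {E : Type*} [TopologicalSpace E] (X : Set E) : StrongRetract X X :=
  ⟨subset_rfl, ContinuousMap.id X, fun x => x.2, ContinuousMap.HomotopicRel.refl _⟩

lemma StrongRetract.trans {E : Type*} [TopologicalSpace E] {X Y Z : Set E}
    (h : StrongRetract X Y) (h' : StrongRetract Y Z) : StrongRetract X Z := by
  obtain ⟨hYX, r, hr, ⟨F⟩⟩ := h
  obtain ⟨hZY, r', hr', ⟨F'⟩⟩ := h'
  let p : C(X, Y) := ⟨fun x => ⟨r x, hr x⟩, by fun_prop⟩
  let i : C(Y, X) := ⟨fun y => ⟨y, hYX y.2⟩, by fun_prop⟩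
  have hfix : ∀ x : X, (x : E) ∈ Y → r x = x := fun x hx => (F.fst_eq_snd hx).symm
  refine ⟨hZY.trans hYX, i.comp (r'.comp p), fun x => hr' _, ?_⟩
  refine ContinuousMap.HomotopicRel.trans (g := r)
    ⟨{ F.toHomotopy with prop' := fun t x hx => F.prop' t x (hZY hx) }⟩ ?_
  refine ⟨{ toFun := fun q => i (F' (q.1, p q.2))
            continuous_toFun := by fun_prop
            map_zero_left := fun x => by simp [i, p]
            map_one_left := fun x => by simp [i, p]
            prop' := fun t x hx => ?_ }⟩
  have hx' : (x : E) ∈ Z := hx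
  have h1 : r x = x := hfix x (hZY hx')
  have h2 : F' (t, p x) = p x := F'.eq_fst t (x := p x) (by
    change ((r x : X) : E) ∈ Z
    rw [h1]; exact hx')
  change i (F' (t, p x)) = r x
  rw [h2]
  rfl

/-! ### Realizations of finite complexes in barycentric coordinates -/

variable {ι : Type*}

/-- The set of barycentric coordinates of points of a complex. -/
def coordSet (K : PreAbstractSimplicialComplex ι) : Set (ι → ℝ) :=
  {c | (∀ i, 0 ≤ c i) ∧ ∃ s ∈ K.faces, (∀ i, i ∉ s → c i = 0) ∧ ∑ i ∈ s, c i = 1}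

lemma Realization.continuous_coord (K : PreAbstractSimplicialComplex ι) :
    Continuous (Realization.coord : Realization K → ι → ℝ) := by
  refine continuous_iSup_dom.2 fun s => continuous_coinduced_dom.2 ?_
  refine continuous_pi fun i => ?_
  by_cases h : i ∈ s.1
  · have : (fun x : stdSimplex ℝ s.1 => (Realization.ofFace K s x).coord i) =
        fun x => x.1 ⟨i, h⟩ := by
      funext x
      exact Subtype.val_injective.extend_apply x.1 (0 : ι → ℝ) (⟨i, h⟩ : s.1)
    change Continuous (fun x : stdSimplex ℝ s.1 => (Realization.ofFace K s x).coord i)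
    rw [this]
    exact (continuous_apply _).comp continuous_subtype_val
  · have : (fun x : stdSimplex ℝ s.1 => (Realization.ofFace K s x).coord i) = fun _ => 0 := by
      funext x
      exact Function.extend_apply' _ _ _ (by rintro ⟨a, rfl⟩; exact h a.2)
    change Continuous (fun x : stdSimplex ℝ s.1 => (Realization.ofFace K s x).coord i)
    rw [this]
    exact continuous_const

lemma Realization.continuous_ofFace (K : PreAbstractSimplicialComplex ι) (s : K.faces) :
    Continuous (Realization.ofFace K s) :=
  continuous_iff_coinduced_le.2 (le_iSup (fun s : K.faces =>
    TopologicalSpace.coinduced (Realization.ofFace K s) inferInstance) s)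

lemma Realization.exists_ofFace (K : PreAbstractSimplicialComplex ι) (x : Realization K) :
    ∃ s y, Realization.ofFace K s y = x := by
  obtain ⟨s, hs, h0, h1⟩ := x.exists_face
  refine ⟨⟨s, hs⟩, ⟨fun i => x.coord i, fun i => x.nonneg i, ?_⟩, ?_⟩
  · rw [← h1]; exact Finset.sum_coe_sort s x.coord
  · ext i
    by_cases h : i ∈ s
    · exact Subtype.val_injective.extend_apply (fun i : s => x.coord i) (0 : ι → ℝ) ⟨i, h⟩
    · rw [h0 i h]
      exact Function.extend_apply' _ _ _ (by rintro ⟨a, rfl⟩; exact h a.2)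

/-- Compactness turns the continuous bijection onto `coordSet K` into a homeomorphism. The weak
topology can then be forgotten, and homotopies are given by explicit formulas in coordinates. -/
lemma Realization.compactSpace (K : PreAbstractSimplicialComplex ι) (hK : K.faces.Finite) :
    CompactSpace (Realization K) := by
  have := hK.to_subtype
  have h : (⋃ s : K.faces, Set.range (Realization.ofFace K s)) = Set.univ := by
    refine Set.eq_univ_of_forall fun x => ?_
    obtain ⟨s, y, rfl⟩ := Realization.exists_ofFace K x
    exact Set.mem_iUnion.2 ⟨s, y, rfl⟩
  refine ⟨?_⟩
  rw [← h]
  exact isCompact_iUnion fun s => isCompact_range (Realization.continuous_ofFace K s)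

/-- A finite complex is homeomorphic to its set of barycentric coordinates. -/
noncomputable def Realization.homeo (K : PreAbstractSimplicialComplex ι) (hK : K.faces.Finite) :
    Realization K ≃ₜ coordSet K :=
  have := Realization.compactSpace K hK
  let e : Realization K ≃ coordSet K :=
    { toFun := fun x => ⟨x.coord, x.nonneg, x.exists_face⟩
      invFun := fun c => ⟨c.1, c.2.1, c.2.2⟩
      left_inv := fun _ => rfl
      right_inv := fun _ => rfl }
  Continuous.homeoOfEquivCompactToT2 (f := e)
    ((Realization.continuous_coord K).subtype_mk _)

lemma Realization.homeo_apply (K : PreAbstractSimplicialComplex ι) (hK : K.faces.Finite)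
    (x : Realization K) : (Realization.homeo K hK x : ι → ℝ) = x.coord := rfl

lemma Realization.mem_coordSet_iff (K L : PreAbstractSimplicialComplex ι) (x : Realization K) :
    x.coord ∈ coordSet L ↔ ∃ s ∈ L.faces, ∀ i, i ∉ s → x.coord i = 0 := by
  constructor
  · rintro ⟨_, s, hs, h, _⟩
    exact ⟨s, hs, h⟩
  · rintro ⟨s, hs, h⟩
    refine ⟨x.nonneg, s, hs, h, ?_⟩
    classical
    obtain ⟨t, -, h0, h1⟩ := x.exists_face
    rw [← h1]
    calc ∑ i ∈ s, x.coord i = ∑ i ∈ s ∪ t, x.coord i :=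
          Finset.sum_subset Finset.subset_union_left fun i _ hi => h i hi
      _ = ∑ i ∈ t, x.coord i :=
          (Finset.sum_subset Finset.subset_union_right fun i _ hi => h0 i hi).symm

lemma StrongRetract.deformationRetractsTo {K L : PreAbstractSimplicialComplex ι}
    (hK : K.faces.Finite) (hLK : L ≤ K) (h : StrongRetract (coordSet K) (coordSet L)) :
    DeformationRetractsTo K L := by
  obtain ⟨-, r, hr, ⟨F⟩⟩ := h
  let e := Realization.homeo K hK
  refine ⟨hLK, ⟨fun x => e.symm (r (e x)), by fun_prop⟩, fun x => ?_, ⟨?_⟩⟩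
  · refine (Realization.mem_coordSet_iff K L _).1 ?_
    rw [← Realization.homeo_apply K hK]
    change ((e (e.symm (r (e x))) : coordSet K) : ι → ℝ) ∈ coordSet L
    rw [e.apply_symm_apply]
    exact hr _
  · refine { toFun := fun q => e.symm (F (q.1, e q.2))
             continuous_toFun := by fun_prop
             map_zero_left := fun x => by simp
             map_one_left := fun x => by simp
             prop' := fun t x hx => ?_ }
    have hx' : (e x : ι → ℝ) ∈ coordSet L := (Realization.mem_coordSet_iff K L x).2 hx
    have := F.eq_fst t hx'
    change e.symm (F (t, e x)) = x
    rw [this]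
    simp

lemma StrongRetract.contractibleSpace {K : PreAbstractSimplicialComplex ι}
    (hK : K.faces.Finite) {c : ι → ℝ} (h : StrongRetract (coordSet K) {c}) :
    ContractibleSpace (Realization K) := by
  obtain ⟨hc, r, hr, hF⟩ := h
  have h1 : ContractibleSpace (coordSet K) := by
    rw [contractible_iff_id_nullhomotopic]
    have hc' := hc rfl
    refine ⟨⟨c, hc'⟩, ?_⟩
    have : r = ContinuousMap.const _ ⟨c, hc'⟩ := by
      ext1 x
      exact Subtype.ext (hr x)
    rw [← this]
    exact hF.homotopic
  exact (Realization.homeo K hK).contractibleSpace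

/-! ### Removal of dominated vertices from clique complexes -/

/-- The complex of finite cliques in `V` of a relation. -/
def cliqueComplex (adj : ι → ι → Prop) (V : Set ι) : PreAbstractSimplicialComplex ι where
  faces := {s | s.Nonempty ∧ (∀ x ∈ s, ∀ y ∈ s, adj x y) ∧ ∀ x ∈ s, x ∈ V}
  isRelLowerSet_faces := fun _ ⟨h0, hc, hn⟩ =>
    ⟨h0, fun _ hr hr0 =>
      ⟨hr0, fun x hx y hy => hc x (hr hx) y (hr hy), fun x hx => hn x (hr hx)⟩⟩

lemma cliqueComplex_finite (adj : ι → ι → Prop) {V : Set ι} (hV : V.Finite) :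
    (cliqueComplex adj V).faces.Finite := by
  refine (Finset.finite_toSet hV.toFinset.powerset).subset fun s hs => ?_
  simp only [Finset.coe_powerset, Set.mem_preimage, Set.mem_powerset_iff]
  intro x hx
  simpa using hs.2.2 x hx

/-- `V'` is obtained from `V` by successive removal of dominated vertices. -/
inductive Dismantles (adj : ι → ι → Prop) : Set ι → Set ι → Prop
  | refl (V : Set ι) : Dismantles adj V V
  | step {V V' : Set ι} (x x' : ι) (hx : x ∈ V) (hx' : x' ∈ V) (hne : x ≠ x')
      (h : ∀ y ∈ V, adj x y → adj x' y) (hd : Dismantles adj (V \ {x}) V') : Dismantles adj V V'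

lemma Dismantles.trans {adj : ι → ι → Prop} {V V' V'' : Set ι} (h : Dismantles adj V V')
    (h' : Dismantles adj V' V'') : Dismantles adj V V'' := by
  induction h with
  | refl => exact h'
  | step x x' hx hx' hne h _ ih => exact .step x x' hx hx' hne h (ih h')

lemma Dismantles.subset {adj : ι → ι → Prop} {V V' : Set ι} (h : Dismantles adj V V') :
    V' ⊆ V := by
  induction h with
  | refl => exact subset_rfl
  | step x x' hx hx' hne h _ ih => exact ih.trans Set.sdiff_subset

lemma Dismantles.image {κ : Type*} {adj : ι → ι → Prop} {adj' : κ → κ → Prop} (f : ι → κ)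
    {V V' : Set ι} (hf : Set.InjOn f V) (hadj : ∀ x ∈ V, ∀ y ∈ V, adj' (f x) (f y) ↔ adj x y)
    (h : Dismantles adj V V') : Dismantles adj' (f '' V) (f '' V') := by
  induction h with
  | refl => exact .refl _
  | step x x' hx hx' hne h _ ih =>
    refine .step (f x) (f x') ⟨x, hx, rfl⟩ ⟨x', hx', rfl⟩ (hf.ne hx hx' hne) ?_ ?_
    · rintro _ ⟨y, hy, rfl⟩ hxy
      exact (hadj _ hx' _ hy).2 (h y hy ((hadj _ hx _ hy).1 hxy))
    · rw [← Set.image_singleton, ← hf.image_sdiff_subset (Set.singleton_subset_iff.2 hx)]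
      exact ih (hf.mono Set.sdiff_subset) fun x hx y hy => hadj x hx.1 y hy.1

lemma cliqueComplex_mono (adj : ι → ι → Prop) {V V' : Set ι} (h : V' ⊆ V) :
    cliqueComplex adj V' ≤ cliqueComplex adj V :=
  fun _ hs => ⟨hs.1, hs.2.1, fun x hx => h (hs.2.2 x hx)⟩

/-- The mass at `x` moves linearly to `x'`. Domination says that a simplex containing `x` remains a
simplex after `x'` is added, so the motion stays in the complex; points without mass at `x` never
move. -/
lemma strongRetract_of_dominated {adj : ι → ι → Prop} (hrefl : ∀ x, adj x x)
    (hsymm : ∀ x y, adj x y → adj y x) {V : Set ι} {x x' : ι} (hx' : x' ∈ V)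
    (hne : x ≠ x') (h : ∀ y ∈ V, adj x y → adj x' y) :
    StrongRetract (coordSet (cliqueComplex adj V)) (coordSet (cliqueComplex adj (V \ {x}))) := by
  classical
  set X := coordSet (cliqueComplex adj V) with hX
  let f : ℝ → (ι → ℝ) → ι → ℝ := fun t c => c + (t * c x) • (Pi.single x' 1 - Pi.single x 1)
  have hfx : ∀ t c, f t c x = (1 - t) * c x := fun t c => by
    simp [f, hne]; ring
  have hfx' : ∀ t c, f t c x' = c x' + t * c x := fun t c => by
    simp [f, hne.symm]
  have hfi : ∀ t c i, i ≠ x → i ≠ x' → f t c i = c i := fun t c i h1 h2 => by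
    simp [f, h1, h2]
  have hcont : Continuous fun q : ℝ × (ι → ℝ) => f q.1 q.2 := by
    refine continuous_pi fun i => ?_
    simp only [f, Pi.add_apply, Pi.smul_apply, smul_eq_mul]
    fun_prop
  have hmem : ∀ t ∈ Set.Icc (0 : ℝ) 1, ∀ c ∈ X, f t c ∈ X ∧
      (t = 1 → f t c ∈ coordSet (cliqueComplex adj (V \ {x}))) := by
    rintro t ⟨ht0, ht1⟩ c ⟨hc0, s, ⟨hs0, hsc, hsV⟩, hcs, hc1⟩
    have hnn : ∀ i, 0 ≤ f t c i := by
      intro i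
      by_cases h1 : i = x
      · subst h1; rw [hfx]; exact mul_nonneg (by linarith) (hc0 _)
      by_cases h2 : i = x'
      · subst h2; rw [hfx']; exact add_nonneg (hc0 _) (mul_nonneg ht0 (hc0 _))
      rw [hfi t c i h1 h2]; exact hc0 i
    by_cases hxs : x ∈ s
    · have hsum : ∑ i ∈ insert x' s, f t c i = 1 := by
        simp only [f, Pi.add_apply, Pi.smul_apply, smul_eq_mul, Finset.sum_add_distrib]
        have e1 : ∑ i ∈ insert x' s, c i = 1 := by
          rw [← hc1]
          refine (Finset.sum_subset (Finset.subset_insert _ _) fun i _ hi => hcs i hi).symm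
        rw [e1, ← Finset.mul_sum]
        simp only [Pi.sub_apply, Finset.sum_sub_distrib, Pi.single_apply]
        simp [hxs]
      have hface : ∀ i ∈ insert x' s, ∀ j ∈ insert x' s, adj i j := by
        have hx's : ∀ j ∈ s, adj x' j := fun j hj => h j (hsV j hj) (hsc x hxs j hj)
        intro i hi j hj
        rcases Finset.mem_insert.1 hi with hi | hi <;> rcases Finset.mem_insert.1 hj with hj | hj
        · rw [hi, hj]; exact hrefl _
        · rw [hi]; exact hx's j hj
        · rw [hj]; exact hsymm _ _ (hx's i hi)
        · exact hsc i hi j hj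
      have hV : ∀ i ∈ insert x' s, i ∈ V := by
        intro i hi
        rcases Finset.mem_insert.1 hi with rfl | hi
        exacts [hx', hsV i hi]
      have hz : ∀ i, i ∉ insert x' s → f t c i = 0 := by
        intro i hi
        simp only [Finset.mem_insert, not_or] at hi
        rw [hfi t c i (fun e => hi.2 (e ▸ hxs)) hi.1]
        exact hcs i hi.2
      refine ⟨⟨hnn, insert x' s, ⟨⟨x', by simp⟩, hface, hV⟩, hz, hsum⟩, ?_⟩
      rintro rfl
      -- At time one no mass is left at `x`, so `x` can be dropped from the supporting simplex; `x'`
      -- keeps it non-empty.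
      have hx0 : f 1 c x = 0 := by rw [hfx]; ring
      refine ⟨hnn, (insert x' s).erase x, ⟨⟨x', by simp [hne.symm]⟩, ?_, ?_⟩, ?_, ?_⟩
      · intro i hi j hj
        exact hface i (Finset.mem_of_mem_erase hi) j (Finset.mem_of_mem_erase hj)
      · intro i hi
        exact ⟨hV i (Finset.mem_of_mem_erase hi), Finset.ne_of_mem_erase hi⟩
      · intro i hi
        by_cases h1 : i = x
        · rw [h1, hx0]
        · exact hz i fun h => hi (Finset.mem_erase.2 ⟨h1, h⟩)
      · rw [Finset.sum_erase _ hx0, hsum]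
    · have hcx : c x = 0 := hcs x hxs
      have hfc : f t c = c := by simp [f, hcx]
      rw [hfc]
      refine ⟨⟨hc0, s, ⟨hs0, hsc, hsV⟩, hcs, hc1⟩, fun _ =>
        ⟨hc0, s, ⟨hs0, hsc, fun i hi => ⟨hsV i hi, ?_⟩⟩, hcs, hc1⟩⟩
      rintro rfl
      exact hxs hi
  refine ⟨?_, ⟨fun c => ⟨f 1 c, (hmem 1 (by simp) c c.2).1⟩, ?_⟩,
    fun c => (hmem 1 (by simp) c c.2).2 rfl, ⟨?_⟩⟩
  · rintro c ⟨hc0, s, hs, hc⟩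
    exact ⟨hc0, s, cliqueComplex_mono adj Set.sdiff_subset hs, hc⟩
  · exact ((hcont.comp (continuous_const.prodMk continuous_subtype_val)).subtype_mk _)
  · refine { toFun := fun q => ⟨f q.1 q.2, (hmem q.1 q.1.2 q.2 q.2.2).1⟩
             continuous_toFun := ?_
             map_zero_left := fun c => ?_
             map_one_left := fun c => ?_
             prop' := fun t c hc => ?_ }
    · exact (hcont.comp ((continuous_subtype_val.comp continuous_fst).prodMk
        (continuous_subtype_val.comp continuous_snd))).subtype_mk _
    · apply Subtype.ext; simp [f]
    · apply Subtype.ext; simp [f]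
    · apply Subtype.ext
      obtain ⟨-, s, hs, hcs, -⟩ := hc
      have : (c : ι → ℝ) x = 0 := hcs x fun hxs => (hs.2.2 x hxs).2 rfl
      simp [f, this]

lemma Dismantles.strongRetract {adj : ι → ι → Prop} (hrefl : ∀ x, adj x x)
    (hsymm : ∀ x y, adj x y → adj y x) {V V' : Set ι} (h : Dismantles adj V V') :
    StrongRetract (coordSet (cliqueComplex adj V)) (coordSet (cliqueComplex adj V')) := by
  induction h with
  | refl => exact .refl _
  | step x x' hx hx' hne h _ ih =>
    exact (strongRetract_of_dominated hrefl hsymm hx' hne h).trans ih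

lemma Dismantles.deformationRetractsTo {adj : ι → ι → Prop} (hrefl : ∀ x, adj x x)
    (hsymm : ∀ x y, adj x y → adj y x) {V V' : Set ι} (hV : V.Finite)
    (h : Dismantles adj V V') :
    DeformationRetractsTo (cliqueComplex adj V) (cliqueComplex adj V') :=
  (h.strongRetract hrefl hsymm).deformationRetractsTo (cliqueComplex_finite adj hV)
    (cliqueComplex_mono adj h.subset)

lemma Dismantles.contractibleSpace {adj : ι → ι → Prop} (hrefl : ∀ x, adj x x)
    (hsymm : ∀ x y, adj x y → adj y x) {V : Set ι} {μ : ι} (hV : V.Finite)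
    (h : Dismantles adj V {μ}) :
    ContractibleSpace (Realization (cliqueComplex adj V)) := by
  classical
  have hc : coordSet (cliqueComplex adj {μ}) = {Pi.single μ 1} := by
    ext c
    constructor
    · rintro ⟨-, s, ⟨hs0, -, hs⟩, hcs, hc1⟩
      have : s = {μ} := Finset.eq_singleton_iff_nonempty_unique_mem.2 ⟨hs0, hs⟩
      subst this
      funext i
      by_cases hi : i = μ
      · subst hi; simpa using hc1
      · simp [hi, hcs i (by simpa using hi)]
    · rintro rfl
      refine ⟨fun i => ?_, {μ}, ⟨by simp, by simp [hrefl], by simp⟩, fun i hi => ?_, by simp⟩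
      · by_cases hi : i = μ
        · subst hi; simp
        · simp [hi]
      · simp only [Finset.mem_singleton] at hi
        simp [hi]
  exact StrongRetract.contractibleSpace (cliqueComplex_finite adj hV)
    (hc ▸ h.strongRetract hrefl hsymm)

end Topology

/-! ## Dismantling posets -/

section Poset

variable {P : Type*} [PartialOrder P]

/-- Comparability. -/
def Comparable (x y : P) : Prop := x ≤ y ∨ y ≤ x

/-- A minimal non-fixed point `x` is dominated by `f x`: an element above `x` is above `f x`, and an
element strictly below `x` is fixed by `f`, hence below `f x` by monotonicity. Removing such points
one after another leaves the fixed points. -/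
lemma dismantles_of_le {V : Set P} (hV : V.Finite) (f : P → P) (hfV : ∀ x ∈ V, f x ∈ V)
    (hle : ∀ x ∈ V, f x ≤ x) (hmono : ∀ x ∈ V, ∀ y ∈ V, x ≤ y → f x ≤ f y)
    (hff : ∀ x ∈ V, f (f x) = f x) : Dismantles Comparable V {x ∈ V | f x = x} := by
  suffices H : ∀ k, ∀ U ⊆ V, {x ∈ V | f x = x} ⊆ U → (U \ {x ∈ V | f x = x}).ncard = k →
      Dismantles Comparable U {x ∈ V | f x = x} from H _ V subset_rfl (Set.sep_subset _ _) rfl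
  intro k
  induction k with
  | zero =>
    intro U hU hfix hk
    have hfin : (U \ {x ∈ V | f x = x}).Finite := (hV.subset hU).subset Set.sdiff_subset
    rw [Set.ncard_eq_zero hfin, Set.sdiff_eq_empty] at hk
    rw [subset_antisymm hk hfix]
    exact .refl _
  | succ k ih =>
    intro U hU hfix hk
    have hfin : (U \ {x ∈ V | f x = x}).Finite := (hV.subset hU).subset Set.sdiff_subset
    have hne : (U \ {x ∈ V | f x = x}).Nonempty := by
      rw [← Set.ncard_pos hfin]; omega
    obtain ⟨x, hx⟩ := hfin.exists_minimal hne
    have hxU := hx.prop.1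
    have hfx : f x ≠ x := fun h => hx.prop.2 ⟨hU hxU, h⟩
    refine .step x (f x) hxU (hfix ⟨hfV x (hU hxU), hff x (hU hxU)⟩) hfx.symm ?_ ?_
    · rintro y hy (hxy | hyx)
      · exact Or.inl ((hle x (hU hxU)).trans hxy)
      · by_cases hyf : f y = y
        · exact Or.inr (hyf ▸ hmono y (hU hy) x (hU hxU) hyx)
        · exact Or.inl ((hle x (hU hxU)).trans (hx.le_of_le ⟨hy, fun h => hyf h.2⟩ hyx))
    · refine ih _ (Set.sdiff_subset.trans hU) (fun y hy => ⟨hfix hy, ?_⟩) ?_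
      · rintro rfl
        exact hfx hy.2
      · have : (U \ {x}) \ {x ∈ V | f x = x} = (U \ {x ∈ V | f x = x}) \ {x} := by
          ext y; simp only [Set.mem_sdiff]; tauto
        rw [this, Set.ncard_sdiff_singleton_of_mem hx.prop, hk]
        rfl

lemma dismantles_of_ge {V : Set P} (hV : V.Finite) (f : P → P) (hfV : ∀ x ∈ V, f x ∈ V)
    (hle : ∀ x ∈ V, x ≤ f x) (hmono : ∀ x ∈ V, ∀ y ∈ V, x ≤ y → f x ≤ f y)
    (hff : ∀ x ∈ V, f (f x) = f x) : Dismantles Comparable V {x ∈ V | f x = x} := by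
  have h := dismantles_of_le (P := Pᵒᵈ) (V := OrderDual.ofDual ⁻¹' V) hV
    (fun x => OrderDual.toDual (f (OrderDual.ofDual x))) hfV hle
    (fun x hx y hy h => hmono y hy x hx h) hff
  have h' := h.image (adj' := Comparable) (OrderDual.ofDual : Pᵒᵈ → P)
    OrderDual.ofDual.injective.injOn fun _ _ _ _ => or_comm
  convert h' using 1
  · exact (Set.image_preimage_eq _ OrderDual.ofDual.surjective).symm
  · exact (Set.image_preimage_eq _ OrderDual.ofDual.surjective).symm

end Poset

end OuterSpace

namespace OuterSpace

namespace FinGraph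

variable {G : FinGraph}

/-! ## Reduced edge paths -/

/-- An edge path without backtracking. -/
def Reduced (G : FinGraph) (l : List G.D) : Prop := l.IsChain (fun d e => e ≠ G.inv d)

/-- A closed edge path without backtracking, also at its base point. -/
def CycReduced (G : FinGraph) (l : List G.D) : Prop := G.Reduced (l ++ l)

lemma inv_injective : Function.Injective G.inv := fun d e h => by
  rw [← G.inv_inv d, h, G.inv_inv]

lemma src_inv (d : G.D) : G.src (G.inv d) = G.tgt d := rfl

lemma tgt_inv (d : G.D) : G.tgt (G.inv d) = G.src d := by rw [tgt, G.inv_inv]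

lemma isWalk_append_iff {u w : G.V} {l l' : List G.D} :
    G.IsWalk u (l ++ l') w ↔ ∃ v, G.IsWalk u l v ∧ G.IsWalk v l' w := by
  constructor
  · induction l generalizing u with
    | nil => exact fun h => ⟨u, rfl, h⟩
    | cons d l ih =>
      rintro ⟨h, h'⟩
      obtain ⟨v, h1, h2⟩ := ih h'
      exact ⟨v, ⟨h, h1⟩, h2⟩
  · rintro ⟨v, h, h'⟩
    exact h.append h'

lemma isWalk_singleton (d : G.D) : G.IsWalk (G.src d) [d] (G.tgt d) := ⟨rfl, rfl⟩

lemma mem_rev {d : G.D} {l : List G.D} : d ∈ G.rev l ↔ G.inv d ∈ l := by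
  simp only [rev, List.mem_reverse, List.mem_map]
  constructor
  · rintro ⟨e, he, rfl⟩
    rwa [G.inv_inv]
  · exact fun h => ⟨_, h, G.inv_inv d⟩

lemma Reduced.append_left {l l' : List G.D} (h : G.Reduced (l ++ l')) : G.Reduced l :=
  List.IsChain.left_of_append h

lemma Reduced.append_right {l l' : List G.D} (h : G.Reduced (l ++ l')) : G.Reduced l' :=
  List.IsChain.right_of_append h

lemma reduced_cons {d : G.D} {l : List G.D} :
    G.Reduced (d :: l) ↔ (∀ e ∈ l.head?, e ≠ G.inv d) ∧ G.Reduced l := by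
  cases l with
  | nil => simp [Reduced]
  | cons e l => simp [Reduced]

lemma reduced_append {l l' : List G.D} : G.Reduced (l ++ l') ↔
    G.Reduced l ∧ G.Reduced l' ∧ ∀ d ∈ l.getLast?, ∀ e ∈ l'.head?, e ≠ G.inv d :=
  List.isChain_append

lemma CycReduced.reduced {l : List G.D} (h : G.CycReduced l) : G.Reduced l := h.append_left

lemma exists_reduced {u v : G.V} {l : List G.D} (h : G.IsWalk u l v) :
    ∃ l', G.IsWalk u l' v ∧ G.Reduced l' ∧ G.PathHomotopic l l' ∧ ∀ d ∈ l', d ∈ l := by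
  classical
  induction l generalizing u with
  | nil => exact ⟨[], h, List.IsChain.nil, PathHomotopic.refl _, by simp⟩
  | cons d l ih =>
    obtain ⟨l', hw, hr, hh, hm⟩ := ih h.2
    have hh' : G.PathHomotopic (d :: l) (d :: l') := (PathHomotopic.refl [d]).append hh
    by_cases hd : ∃ l'', l' = G.inv d :: l''
    · obtain ⟨l'', rfl⟩ := hd
      refine ⟨l'', ?_, hr.tail, hh'.trans ?_, fun e he => ?_⟩
      · have := hw.2
        rw [tgt_inv, h.1] at this
        exact this
      · exact Relation.EqvGen.rel _ _ (Cancel.mk [] l'' d)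
      · exact List.mem_cons_of_mem _ (hm e (List.mem_cons_of_mem _ he))
    · refine ⟨d :: l', ⟨h.1, hw⟩, reduced_cons.2 ⟨?_, hr⟩, hh', fun e he => ?_⟩
      · rintro e he rfl
        cases l' with
        | nil => simp at he
        | cons a l' =>
          simp only [List.head?_cons, Option.mem_def, Option.some.injEq] at he
          exact hd ⟨l', by rw [he]⟩
      · rcases List.mem_cons.1 he with rfl | he
        · simp
        · exact List.mem_cons_of_mem _ (hm e he)

/-! ### Free homotopy -/

lemma FreelyHomotopic.refl {u : G.V} (l : List G.D) : G.FreelyHomotopic u l u l :=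
  ⟨[], rfl, by simpa using PathHomotopic.refl l⟩

lemma FreelyHomotopic.of_pathHomotopic {u : G.V} {l l' : List G.D} (h : G.PathHomotopic l l') :
    G.FreelyHomotopic u l u l' := ⟨[], rfl, by simpa using h⟩

lemma FreelyHomotopic.trans {u v w : G.V} {l l' l'' : List G.D}
    (h : G.FreelyHomotopic u l v l') (h' : G.FreelyHomotopic v l' w l'') :
    G.FreelyHomotopic u l w l'' := by
  obtain ⟨p, hp, h⟩ := h
  obtain ⟨q, hq, h'⟩ := h'
  refine ⟨p ++ q, hp.append hq, ?_⟩
  have h1 := h.append (PathHomotopic.refl q)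
  have h2 := (PathHomotopic.refl p).append h'
  simp only [List.append_assoc] at h1 h2 ⊢
  exact h1.trans h2

lemma FreelyHomotopic.symm {u v : G.V} {l l' : List G.D}
    (h : G.FreelyHomotopic u l v l') : G.FreelyHomotopic v l' u l := by
  obtain ⟨p, hp, h⟩ := h
  refine ⟨G.rev p, hp.rev, ?_⟩
  have h1 := (PathHomotopic.refl (G.rev p)).append (h.append (PathHomotopic.refl (G.rev p)))
  have h2 := (PathHomotopic.refl (G.rev p ++ l)).append (PathHomotopic.append_rev p)
  have h3 := (PathHomotopic.rev_append_self p).append (PathHomotopic.refl (l' ++ G.rev p))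
  simp only [List.append_assoc, List.nil_append, List.append_nil] at h1 h2 h3
  exact h3.symm.trans (h1.symm.trans h2)

lemma exists_cycReduced {u : G.V} {l : List G.D} (h : G.IsWalk u l u) :
    ∃ v l', G.IsWalk v l' v ∧ G.CycReduced l' ∧ G.FreelyHomotopic u l v l' := by
  suffices H : ∀ k, ∀ u l, G.IsWalk u l u → G.Reduced l → l.length ≤ k →
      ∃ v l', G.IsWalk v l' v ∧ G.CycReduced l' ∧ G.FreelyHomotopic u l v l' by
    obtain ⟨l', hw, hr, hh, -⟩ := exists_reduced h
    obtain ⟨v, l'', h1, h2, h3⟩ := H _ u l' hw hr le_rfl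
    exact ⟨v, l'', h1, h2, (FreelyHomotopic.of_pathHomotopic hh).trans h3⟩
  intro k
  induction k with
  | zero =>
    intro u l hw hr hl
    obtain rfl : l = [] := List.eq_nil_of_length_eq_zero (by omega)
    exact ⟨u, [], hw, hr, FreelyHomotopic.refl _⟩
  | succ k ih =>
    intro u l hw hr hl
    by_cases hc : G.CycReduced l
    · exact ⟨u, l, hw, hc, FreelyHomotopic.refl _⟩
    · simp only [CycReduced, reduced_append, hr, true_and, not_forall, not_not] at hc
      obtain ⟨d, hd, e, he, rfl⟩ := hc
      cases l with
      | nil => simp at hd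
      | cons a l =>
        simp only [List.head?_cons, Option.mem_def, Option.some.injEq] at he
        subst he
        obtain ⟨m, hm⟩ : ∃ m, l = m ++ [d] := by
          have hl' : l ≠ [] := by
            rintro rfl
            simp only [List.getLast?_singleton, Option.mem_def, Option.some.injEq] at hd
            exact G.inv_ne d hd
          refine ⟨l.dropLast, ?_⟩
          have := List.dropLast_append_getLast hl'
          rw [List.getLast?_cons_of_ne_nil hl'] at hd
          rw [List.getLast?_eq_some_getLast hl'] at hd
          simp only [Option.mem_def, Option.some.injEq] at hd
          rw [hd] at this
          exact this.symm
        subst hm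
        obtain ⟨h1, h2⟩ := hw
        obtain ⟨v, h3, h4⟩ := isWalk_append_iff.1 h2
        have hv : v = G.src d := h4.1.symm
        subst hv
        rw [tgt_inv] at h3
        obtain ⟨v, l', ha, hb, hc⟩ := ih (G.src d) m h3
          (Reduced.append_left (reduced_cons.1 hr).2) (by simp at hl; omega)
        refine ⟨v, l', ha, hb, FreelyHomotopic.trans ⟨[G.inv d], ?_, ?_⟩ hc⟩
        · exact ⟨h1, by rw [tgt_inv]; rfl⟩
        · have := Relation.EqvGen.rel _ _ (Cancel.mk (G := G) (G.inv d :: m) [] d)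
          simpa [PathHomotopic] using this

/-! ### Comparison with the free group -/

/-- Writing half-edges as letters and inverse letters sends homotopic paths to equal elements of a
free group and reduced paths to reduced words. Uniqueness of reduced words is thereby imported from
`FreeGroup`. A numbering of the half-edges decides which half of an edge is positive. -/
lemma exists_orientation (G : FinGraph) : ∃ (E : Type) (e : G.D → E × Bool),
    Function.Injective e ∧ ∀ d, e (G.inv d) = ((e d).1, !(e d).2) := by
  classical
  have := G.finite_D
  have := Fintype.ofFinite G.D
  let o : G.D → ℕ := fun d => (Fintype.equivFin G.D d : ℕ)
  have ho : Function.Injective o := Fin.val_injective.comp (Fintype.equivFin G.D).injective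
  have hne : ∀ d, o d ≠ o (G.inv d) := fun d h => G.inv_ne d (ho h).symm
  refine ⟨G.D, fun d => if o d < o (G.inv d) then (d, true) else (G.inv d, false),
    fun d d' h => ?_, fun d => ?_⟩
  · dsimp only at h
    split_ifs at h <;> simp at h
    · exact h
    · exact inv_injective h
  · dsimp only
    rw [G.inv_inv]
    rcases lt_or_gt_of_ne (hne d) with h | h
    · simp [h, not_lt.2 h.le]
    · simp [h, not_lt.2 h.le]

lemma PathHomotopic.mk_map_eq {E : Type} {e : G.D → E × Bool}
    (he : ∀ d, e (G.inv d) = ((e d).1, !(e d).2)) {l l' : List G.D}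
    (h : G.PathHomotopic l l') : FreeGroup.mk (l.map e) = FreeGroup.mk (l'.map e) := by
  induction h with
  | rel x y h =>
    obtain ⟨a, b, d⟩ := h
    refine Quot.sound ?_
    simp only [List.map_append, List.map_cons, he]
    exact FreeGroup.Red.Step.not (x := (e d).1) (b := (e d).2)
  | refl => rfl
  | symm _ _ _ ih => exact ih.symm
  | trans _ _ _ _ _ ih ih' => exact ih.trans ih'

lemma Reduced.norm_mk_map {E : Type} [DecidableEq E] {e : G.D → E × Bool}
    (hi : Function.Injective e)
    (he : ∀ d, e (G.inv d) = ((e d).1, !(e d).2)) {l : List G.D}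
    (h : G.Reduced l) : (FreeGroup.mk (l.map e)).norm = l.length := by
  have : FreeGroup.IsReduced (l.map e) := by
    refine (List.isChain_map e).2 (List.IsChain.imp (fun a b hab => ?_) h)
    intro h1
    by_contra h2
    refine hab (hi ?_)
    rw [he]
    refine Prod.ext h1.symm ?_
    revert h2
    cases (e a).2 <;> cases (e b).2 <;> simp
  rw [FreeGroup.norm, FreeGroup.toWord_mk, this.reduce_eq, List.length_map]

lemma Reduced.eq_nil_of_pathHomotopic {l : List G.D} (h : G.Reduced l)
    (h' : G.PathHomotopic l []) : l = [] := by
  classical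
  obtain ⟨E, e, hi, he⟩ := G.exists_orientation
  have h1 := h.norm_mk_map hi he
  rw [h'.mk_map_eq he, List.map_nil, ← FreeGroup.one_eq_mk, FreeGroup.norm_one] at h1
  exact List.eq_nil_of_length_eq_zero h1.symm

lemma CycReduced.reduced_replicate {l : List G.D} (h : G.CycReduced l) (k : ℕ) :
    G.Reduced (List.replicate k l).flatten := by
  by_cases hl : l = []
  · subst hl
    have : (List.replicate k ([] : List G.D)).flatten = [] := by simp
    rw [this]; exact List.IsChain.nil
  induction k with
  | zero => exact List.IsChain.nil
  | succ k ih =>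
    rw [List.replicate_succ, List.flatten_cons]
    refine reduced_append.2 ⟨h.reduced, ih, fun d hd e he => ?_⟩
    refine (reduced_append.1 h).2.2 d hd e ?_
    cases k with
    | zero => simp at he
    | succ k =>
      rw [List.replicate_succ, List.flatten_cons, List.head?_append_of_ne_nil _ hl] at he
      exact he

/-- A comparison of stable lengths. In the free group `x = q * y * q⁻¹`. Powers of a cyclically
reduced word do not cancel, so `x ^ k` has length exactly `k * l.length`, whereas it is at most `2 *
q.norm + k * l'.length`; let `k` grow. -/
lemma CycReduced.length_le {u v : G.V} {l l' : List G.D} (h : G.CycReduced l)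
    (hh : G.FreelyHomotopic u l v l') : l.length ≤ l'.length := by
  classical
  obtain ⟨E, e, hi, he⟩ := G.exists_orientation
  obtain ⟨p, -, hp⟩ := hh
  have h1 := hp.mk_map_eq he
  simp only [List.map_append, ← FreeGroup.mul_mk] at h1
  set x := FreeGroup.mk (l.map e)
  set y := FreeGroup.mk (l'.map e)
  set q := FreeGroup.mk (p.map e)
  have hx : x = q * y * q⁻¹ := eq_mul_inv_of_mul_eq h1
  have hpow : ∀ k : ℕ, (x ^ k).norm = k * l.length := by
    intro k
    have h2 := (h.reduced_replicate k).norm_mk_map hi he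
    rw [List.map_flatten, List.map_replicate] at h2
    rw [FreeGroup.pow_mk, h2]
    simp
  have hypow : ∀ k : ℕ, (y ^ k).norm ≤ k * l'.length := by
    intro k
    rw [FreeGroup.pow_mk]
    refine FreeGroup.norm_mk_le.trans ?_
    simp
  have hle : ∀ k : ℕ, k * l.length ≤ 2 * q.norm + k * l'.length := by
    intro k
    rw [← hpow, hx, conj_pow]
    have h3 := FreeGroup.norm_mul_le (q * y ^ k) q⁻¹
    have h4 := FreeGroup.norm_mul_le q (y ^ k)
    have h5 := hypow k
    rw [FreeGroup.norm_inv_eq] at h3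
    omega
  by_contra hlt
  push Not at hlt
  -- This power is large enough: an excess of one letter per period already outweighs the constant
  -- `2 * q.norm`.
  have h6 := hle (2 * q.norm + 1)
  have h7 : (2 * q.norm + 1) * (l'.length + 1) ≤ (2 * q.norm + 1) * l.length :=
    Nat.mul_le_mul_left _ hlt
  rw [mul_add] at h7
  omega

lemma CycReduced.loopLength_eq {u v : G.V} {l l' : List G.D} (hw : G.IsWalk v l' v)
    (h : G.CycReduced l') (hh : G.FreelyHomotopic u l v l') : G.loopLength u l = l'.length := by
  refine le_antisymm (Nat.sInf_le ⟨v, l', hw, hh, rfl⟩) ?_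
  refine le_csInf ⟨_, v, l', hw, hh, rfl⟩ ?_
  rintro m ⟨v', l'', -, hh', rfl⟩
  exact h.length_le (hh.symm.trans hh')

/-! ### Forests -/

lemma IsForest.eq_nil {F : Set G.D} (hF : G.IsForest F) {v : G.V} {l : List G.D}
    (hw : G.IsWalk v l v) (hl : ∀ d ∈ l, d ∈ F) (hr : G.Reduced l) : l = [] := hF v l hw hl hr

lemma IsForest.pathHomotopic_nil {F : Set G.D} (hF : G.IsForest F) {v : G.V} {l : List G.D}
    (hw : G.IsWalk v l v) (hl : ∀ d ∈ l, d ∈ F) : G.PathHomotopic l [] := by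
  obtain ⟨l', hw', hr, hh, hm⟩ := exists_reduced hw
  rwa [hF.eq_nil hw' (fun d hd => hl d (hm d hd)) hr] at hh

lemma exists_first_crossing {F : Set G.D} {d : G.D} {p : G.V → Prop} (h1 : ¬ p (G.src d))
    (h2 : ∀ e ∈ F, e ≠ d → e ≠ G.inv d → (p (G.src e) ↔ p (G.tgt e)))
    {u v : G.V} {l : List G.D} (hw : G.IsWalk u l v) (hl : ∀ e ∈ l, e ∈ F) (hu : p u)
    (hv : ¬ p v) : ∃ m l', l = m ++ G.inv d :: l' ∧ G.IsWalk u m (G.tgt d) := by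
  induction l generalizing u with
  | nil => cases hw; exact absurd hu hv
  | cons e l ih =>
    obtain ⟨rfl, hw⟩ := hw
    by_cases he : e = G.inv d
    · subst he
      exact ⟨[], l, rfl, rfl⟩
    · have hed : e ≠ d := by rintro rfl; exact h1 hu
      have := (h2 e (hl e (by simp)) hed he).1 hu
      obtain ⟨m, l', rfl, hm⟩ := ih hw (fun x hx => hl x (List.mem_cons_of_mem _ hx)) this
      exact ⟨e :: m, l', rfl, rfl, hm⟩

/-- The predicate `p d` changes only across the edge `d`. A closed path in `F` that begins with `d`
must therefore return through `G.inv d`; the part before the first return is a shorter reduced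
closed path, hence empty, and the path backtracks. -/
lemma isForest_of_potential {F : Set G.D} (p : G.D → G.V → Prop)
    (h0 : ∀ d ∈ F, p d (G.tgt d)) (h1 : ∀ d ∈ F, ¬ p d (G.src d))
    (h2 : ∀ d ∈ F, ∀ e ∈ F, e ≠ d → e ≠ G.inv d → (p d (G.src e) ↔ p d (G.tgt e))) :
    G.IsForest F := by
  suffices H : ∀ k, ∀ v l, G.IsWalk v l v → (∀ d ∈ l, d ∈ F) → G.Reduced l → l.length ≤ k →
      l = [] from fun v l hw hl hr => H _ v l hw hl hr le_rfl
  intro k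
  induction k with
  | zero => exact fun v l _ _ _ h => List.eq_nil_of_length_eq_zero (by omega)
  | succ k ih =>
    intro v l hw hl hr hk
    cases l with
    | nil => rfl
    | cons d l =>
      obtain ⟨rfl, hw⟩ := hw
      have hd := hl d (by simp)
      obtain ⟨m, l', rfl, hm⟩ := exists_first_crossing (h1 d hd) (h2 d hd) hw
        (fun x hx => hl x (List.mem_cons_of_mem _ hx)) (h0 d hd) (h1 d hd)
      have hm0 := ih _ m hm (fun x hx => hl x (by simp [hx]))
        (Reduced.append_left (reduced_cons.1 hr).2) (by simp at hk; omega)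
      subst hm0
      exact absurd rfl ((reduced_cons.1 hr).1 (G.inv d) (by simp))

end FinGraph

/-! ## Homotopies of maps of graphs -/

namespace PathMap

open FinGraph

variable {G G' G'' : FinGraph}

lemma onPath_comp (k : PathMap G' G'') (f : PathMap G G') (l : List G.D) :
    (k.comp f).onPath l = k.onPath (f.onPath l) := by
  simp [onPath, comp, List.flatMap_assoc]

lemma onPath_id (l : List G.D) : (PathMap.id G).onPath l = l := by
  simp [onPath, PathMap.id]

lemma onPath_cons (f : PathMap G G') (d : G.D) (l : List G.D) :
    f.onPath (d :: l) = f.onD d ++ f.onPath l := by simp [onPath]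

lemma comp_assoc {G''' : FinGraph} (h : PathMap G'' G''') (k : PathMap G' G'')
    (f : PathMap G G') : (h.comp k).comp f = h.comp (k.comp f) := by
  simp [comp, onPath, List.flatMap_assoc]

lemma id_comp (f : PathMap G G') : (PathMap.id G').comp f = f := by
  obtain ⟨a, b, c, d⟩ := f
  simp [comp, onPath, PathMap.id]

lemma comp_id (f : PathMap G G') : f.comp (PathMap.id G) = f := by
  obtain ⟨a, b, c, d⟩ := f
  simp [comp, onPath, PathMap.id]

lemma homotopic_onPath {f g : PathMap G G'} {p : G.V → List G'.D}
    (hp : ∀ d, G'.PathHomotopic (f.onD d ++ p (G.tgt d)) (p (G.src d) ++ g.onD d))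
    {u v : G.V} {l : List G.D} (hw : G.IsWalk u l v) :
    G'.PathHomotopic (f.onPath l ++ p v) (p u ++ g.onPath l) := by
  induction l generalizing u with
  | nil => cases hw; simpa [onPath] using PathHomotopic.refl (p _)
  | cons d l ih =>
    obtain ⟨rfl, hw⟩ := hw
    have h1 := (PathHomotopic.refl (f.onD d)).append (ih hw)
    have h2 := (hp d).append (PathHomotopic.refl (g.onPath l))
    simp only [onPath_cons, List.append_assoc] at h1 h2 ⊢
    exact h1.trans h2

lemma Homotopic.freelyHomotopic {f g : PathMap G G'} (h : f.Homotopic g) {u : G.V}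
    {l : List G.D} (hw : G.IsWalk u l u) :
    G'.FreelyHomotopic (f.onV u) (f.onPath l) (g.onV u) (g.onPath l) := by
  obtain ⟨p, hp, h⟩ := h
  exact ⟨p u, hp u, homotopic_onPath h hw⟩

lemma Homotopic.comp_right {f g : PathMap G' G''} (h : f.Homotopic g) (k : PathMap G G') :
    (f.comp k).Homotopic (g.comp k) := by
  obtain ⟨p, hp, h⟩ := h
  exact ⟨fun v => p (k.onV v), fun v => hp _, fun d => homotopic_onPath h (k.walk d)⟩

lemma freelyHomotopic_onPath (f : PathMap G G') {u v : G.V} {l l' : List G.D}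
    (h : G.FreelyHomotopic u l v l') :
    G'.FreelyHomotopic (f.onV u) (f.onPath l) (f.onV v) (f.onPath l') := by
  obtain ⟨p, hp, h⟩ := h
  refine ⟨f.onPath p, f.onPath_walk hp, ?_⟩
  rw [← onPath_append, ← onPath_append]
  exact f.onPath_homotopic h

lemma IsHomotopyEquiv.comp {f : PathMap G' G''} {g : PathMap G G'} (hf : f.IsHomotopyEquiv)
    (hg : g.IsHomotopyEquiv) : (f.comp g).IsHomotopyEquiv := by
  obtain ⟨f', h1, h2⟩ := hf
  obtain ⟨g', h3, h4⟩ := hg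
  refine ⟨g'.comp f', ?_, ?_⟩
  · have := (h1.comp_right g).comp_left g'
    rw [id_comp] at this
    rw [comp_assoc, ← comp_assoc f']
    rw [comp_assoc] at this
    exact Homotopic.trans (by rw [comp_assoc]; exact this) h3
  · have := (h4.comp_right f').comp_left f
    rw [id_comp] at this
    rw [comp_assoc, ← comp_assoc g]
    exact Homotopic.trans this h2

lemma IsHomotopyEquiv.of_comp_homotopic {f f' : PathMap G' G''} {g : PathMap G G'}
    (hg : g.IsHomotopyEquiv) (h : (f.comp g).Homotopic (f'.comp g)) : f.Homotopic f' := by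
  obtain ⟨g', -, h4⟩ := hg
  have h5 := h.comp_right g'
  rw [comp_assoc, comp_assoc] at h5
  have h6 := h4.comp_left f
  have h7 := h4.comp_left f'
  rw [comp_id] at h6 h7
  exact h6.symm.trans (h5.trans h7)

end PathMap

/-! ## Forest collapses on edge paths -/

namespace ForestCollapse

open FinGraph

variable {G G' : FinGraph} (c : ForestCollapse G G')

/-- The image of an edge path under a forest collapse. -/
def path (l : List G.D) : List G'.D := l.filterMap c.onD

lemma onPath_eq (l : List G.D) : c.toPathMap.onPath l = c.path l := by
  induction l with
  | nil => rfl
  | cons d l ih =>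
    rw [PathMap.onPath_cons, ih]
    cases h : c.onD d with
    | none => simp [path, h, toPathMap]
    | some d' => simp [path, h, toPathMap]

/-- The collapsed edges. -/
def forestSet : Set G.D := {d | c.onD d = none}

lemma isForest : G.IsForest c.forestSet := c.forest

lemma path_append (l l' : List G.D) : c.path (l ++ l') = c.path l ++ c.path l' := by
  simp [path]

lemma path_walk {u v : G.V} {l : List G.D} (h : G.IsWalk u l v) :
    G'.IsWalk (c.onV u) (c.path l) (c.onV v) := by
  rw [← onPath_eq]
  exact c.toPathMap.onPath_walk h

lemma path_eq_nil_iff {l : List G.D} : c.path l = [] ↔ ∀ d ∈ l, d ∈ c.forestSet := by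
  simp [path, forestSet, List.filterMap_eq_nil_iff]

lemma onD_inv_eq_none {d : G.D} : c.onD (G.inv d) = none ↔ c.onD d = none := by
  rw [c.inv]; simp

lemma inv_mem_forestSet {d : G.D} : G.inv d ∈ c.forestSet ↔ d ∈ c.forestSet :=
  c.onD_inv_eq_none

lemma onD_injective {d e : G.D} {d' : G'.D} (h : c.onD d = some d') (h' : c.onD e = some d') :
    d = e := (c.onD_bijective d').unique h h'

/-- The edge of `G` that maps to a given edge. -/
noncomputable def lift (d' : G'.D) : G.D := (c.onD_bijective d').exists.choose

lemma onD_lift (d' : G'.D) : c.onD (c.lift d') = some d' :=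
  (c.onD_bijective d').exists.choose_spec

lemma lift_eq {d : G.D} {d' : G'.D} (h : c.onD d = some d') : c.lift d' = d :=
  c.onD_injective (c.onD_lift d') h

lemma lift_inv (d' : G'.D) : c.lift (G'.inv d') = G.inv (c.lift d') :=
  c.lift_eq (by rw [c.inv, c.onD_lift]; rfl)

lemma mem_forestSet_or (d : G.D) : d ∈ c.forestSet ∨ ∃ d', c.onD d = some d' := by
  cases h : c.onD d with
  | none => exact Or.inl h
  | some d' => exact Or.inr ⟨d', rfl⟩

lemma path_eq_cons {l : List G.D} {e' : G'.D} {r : List G'.D} (h : c.path l = e' :: r) :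
    ∃ t e m, l = t ++ e :: m ∧ (∀ x ∈ t, x ∈ c.forestSet) ∧ c.onD e = some e' ∧
      c.path m = r := by
  induction l with
  | nil => simp [path] at h
  | cons d l ih =>
    rcases c.mem_forestSet_or d with hd | ⟨d', hd⟩
    · have : c.path (d :: l) = c.path l := by
        have hd' : c.onD d = none := hd
        simp [path, hd']
      rw [this] at h
      obtain ⟨t, e, m, rfl, h1, h2, h3⟩ := ih h
      refine ⟨d :: t, e, m, rfl, fun x hx => ?_, h2, h3⟩
      rcases List.mem_cons.1 hx with rfl | hx
      exacts [hd, h1 x hx]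
    · simp only [path, List.filterMap_cons, hd, List.cons.injEq] at h
      exact ⟨[], d, l, rfl, by simp, by rw [hd, h.1], h.2⟩

/-- A backtrack in the image would come from an edge and its inverse with only collapsed edges in
between. These form a reduced closed path in the forest, so there are none, and the original path
backtracks. -/
lemma path_reduced {u v : G.V} {l : List G.D} (hw : G.IsWalk u l v) (hr : G.Reduced l) :
    G'.Reduced (c.path l) := by
  induction l generalizing u with
  | nil => exact List.IsChain.nil
  | cons d l ih =>
    have hr' := reduced_cons.1 hr
    have h := ih hw.2 hr'.2
    rcases c.mem_forestSet_or d with hd | ⟨d', hd⟩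
    · have : c.path (d :: l) = c.path l := by
        have hd' : c.onD d = none := hd
        simp [path, hd']
      rwa [this]
    · have : c.path (d :: l) = d' :: c.path l := by simp [path, hd]
      rw [this]
      refine reduced_cons.2 ⟨fun e' he' => ?_, h⟩
      rintro rfl
      obtain ⟨r, hr2⟩ : ∃ r, c.path l = G'.inv d' :: r := by
        cases hp : c.path l with
        | nil => simp [hp] at he'
        | cons a r =>
          simp only [hp, List.head?_cons, Option.mem_def, Option.some.injEq] at he'
          exact ⟨r, by rw [he']⟩
      obtain ⟨t, e, m, rfl, ht, he, -⟩ := c.path_eq_cons hr2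
      have hed : e = G.inv d := c.onD_injective he (by rw [c.inv, hd]; rfl)
      subst hed
      obtain ⟨w, hw1, hw2⟩ := isWalk_append_iff.1 hw.2
      have : w = G.tgt d := hw2.1.symm
      subst this
      have := c.isForest.eq_nil hw1 ht (Reduced.append_left hr'.2)
      subst this
      exact hr'.1 (G.inv d) (by simp) rfl

lemma path_cycReduced {u : G.V} {l : List G.D} (hw : G.IsWalk u l u) (hr : G.CycReduced l) :
    G'.CycReduced (c.path l) := by
  have := c.path_reduced (hw.append hw) hr
  rwa [path_append] at this

lemma eq_nil_of_path_eq_nil {u : G.V} {l : List G.D} (hw : G.IsWalk u l u) (hr : G.Reduced l)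
    (h : c.path l = []) : l = [] :=
  c.isForest.eq_nil hw (c.path_eq_nil_iff.1 h) hr

end ForestCollapse

end OuterSpace

namespace OuterSpace

namespace FinGraph

variable {G : FinGraph}

/-! ## Maximal trees -/

/-- A set of edges that forms a maximal tree. -/
structure IsSpanningTree (G : FinGraph) (F : Set G.D) : Prop where
  inv_mem : ∀ {d}, d ∈ F → G.inv d ∈ F
  isForest : G.IsForest F
  connected : ∀ u v, ∃ l, G.IsWalk u l v ∧ ∀ d ∈ l, d ∈ F

/-- The vertices that can be reached in `F` from the end of `f` without crossing `f`. -/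
def branch (F : Set G.D) (f : G.D) : Set G.V :=
  {v | ∃ l, G.IsWalk (G.tgt f) l v ∧ ∀ d ∈ l, d ∈ F ∧ d ≠ f ∧ d ≠ G.inv f}

lemma exists_src_eq_of_valence {v : G.V} (h : 3 ≤ G.valence v) (a b : G.D) :
    ∃ d, G.src d = v ∧ d ≠ a ∧ d ≠ b := by
  classical
  by_contra! hc
  have := G.finite_D
  have h1 : {d : G.D | G.src d = v} ⊆ {a, b} := by
    intro d hd
    by_cases h : d = a
    · simp [h]
    · simp [hc d hd h]
  have h2 : G.valence v = {d : G.D | G.src d = v}.ncard := rfl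
  have h3 := Set.ncard_le_ncard h1 (Set.toFinite _)
  have h4 := Set.ncard_insert_le a {b}
  rw [Set.ncard_singleton] at h4
  omega

lemma tgt_mem_branch (F : Set G.D) (f : G.D) : G.tgt f ∈ branch F f := ⟨[], rfl, by simp⟩

namespace IsSpanningTree

variable {F : Set G.D} (hF : G.IsSpanningTree F)

include hF

lemma exists_reduced (u v : G.V) :
    ∃ l, G.IsWalk u l v ∧ (∀ d ∈ l, d ∈ F) ∧ G.Reduced l := by
  obtain ⟨l, hw, hl⟩ := hF.connected u v
  obtain ⟨l', hw', hr, -, hm⟩ := FinGraph.exists_reduced hw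
  exact ⟨l', hw', fun d hd => hl d (hm d hd), hr⟩

lemma inv_mem_iff {d : G.D} : G.inv d ∈ F ↔ d ∈ F :=
  ⟨fun h => by simpa [G.inv_inv] using hF.inv_mem h, hF.inv_mem⟩

lemma src_notMem_branch {f : G.D} (hf : f ∈ F) : G.src f ∉ branch F f := by
  rintro ⟨l, hw, hl⟩
  obtain ⟨l', hw', hr, -, hm⟩ := FinGraph.exists_reduced hw
  have := hF.isForest.eq_nil (v := G.src f) (l := f :: l') ⟨rfl, hw'⟩ (fun d hd => ?_) ?_
  · simp at this
  · rcases List.mem_cons.1 hd with rfl | hd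
    exacts [hf, (hl d (hm d hd)).1]
  · refine reduced_cons.2 ⟨fun e he => ?_, hr⟩
    exact (hl e (hm e (List.mem_of_mem_head? he))).2.2

omit hF in
lemma branch_step {f e : G.D} (he : e ∈ F) (h1 : e ≠ f) (h2 : e ≠ G.inv f)
    (h : G.src e ∈ branch F f) : G.tgt e ∈ branch F f := by
  obtain ⟨l, hw, hl⟩ := h
  refine ⟨l ++ [e], hw.append (isWalk_singleton e), fun d hd => ?_⟩
  rcases List.mem_append.1 hd with hd | hd
  · exact hl d hd
  · rw [List.mem_singleton.1 hd]
    exact ⟨he, h1, h2⟩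

lemma src_mem_branch_iff {f e : G.D} (he : e ∈ F) (h1 : e ≠ f) (h2 : e ≠ G.inv f) :
    G.src e ∈ branch F f ↔ G.tgt e ∈ branch F f := by
  refine ⟨branch_step he h1 h2, fun h => ?_⟩
  have := branch_step (f := f) (hF.inv_mem he) (fun h => h2 (by rw [← h, G.inv_inv]))
    (fun h => h1 (inv_injective h)) h
  rwa [tgt_inv] at this

lemma branch_inv {f : G.D} (hf : f ∈ F) : branch F (G.inv f) = (branch F f)ᶜ := by
  ext v
  constructor
  · rintro ⟨l, hw, hl⟩ hv
    rw [tgt_inv] at hw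
    refine hF.src_notMem_branch hf ?_
    obtain ⟨l', hw', hl'⟩ := hv
    refine ⟨l' ++ G.rev l, hw'.append hw.rev, fun d hd => ?_⟩
    rcases List.mem_append.1 hd with hd | hd
    · exact hl' d hd
    · obtain ⟨h1, h2, h3⟩ := hl _ (mem_rev.1 hd)
      refine ⟨hF.inv_mem_iff.1 h1, fun h => h2 (by rw [h]), fun h => h3 (by rw [h])⟩
  · intro hv
    obtain ⟨l, hw, hl⟩ := hF.connected (G.tgt f) v
    suffices H : ∀ u, G.IsWalk u l v → (u ∈ branch F f ∨ u ∈ branch F (G.inv f)) →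
        v ∈ branch F f ∨ v ∈ branch F (G.inv f) from
      (H _ hw (Or.inl (tgt_mem_branch F f))).resolve_left hv
    clear hw
    induction l with
    | nil => rintro u rfl h; exact h
    | cons d l ih =>
      rintro u ⟨rfl, hw⟩ h
      refine ih (fun d hd => hl d (List.mem_cons_of_mem _ hd)) _ hw ?_
      have hd := hl d (by simp)
      by_cases h1 : d = f
      · subst h1; exact Or.inl (tgt_mem_branch F d)
      by_cases h2 : d = G.inv f
      · subst h2; exact Or.inr (tgt_mem_branch F _)
      rcases h with h | h
      · exact Or.inl (branch_step hd h1 h2 h)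
      · exact Or.inr (branch_step hd h2 (by rwa [G.inv_inv]) h)

lemma mem_branch_inv {f : G.D} (hf : f ∈ F) {v : G.V} :
    v ∈ branch F (G.inv f) ↔ v ∉ branch F f := by
  rw [hF.branch_inv hf]; rfl

/-- A path inside the branch of `e` never uses `f`, as neither end of `f` lies there; so it cannot
leave the branch of `f`. -/
lemma branch_subset {e f : G.D} (h0 : G.tgt e ∈ branch F f)
    (h1 : G.src f ∉ branch F e) (h2 : G.tgt f ∉ branch F e) : branch F e ⊆ branch F f := by
  rintro v ⟨l, hw, hl⟩
  suffices H : ∀ u, G.IsWalk u l v → u ∈ branch F e → u ∈ branch F f → v ∈ branch F f from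
    H _ hw (tgt_mem_branch F e) h0
  clear hw
  induction l with
  | nil => rintro u rfl - h; exact h
  | cons d l ih =>
    rintro u ⟨rfl, hw⟩ hue huf
    obtain ⟨hd, hd1, hd2⟩ := hl d (by simp)
    refine ih (fun d hd => hl d (List.mem_cons_of_mem _ hd)) _ hw (branch_step hd hd1 hd2 hue) ?_
    refine (hF.src_mem_branch_iff hd ?_ ?_).1 huf
    · rintro rfl; exact h1 hue
    · rintro rfl; exact h2 hue

lemma branch_subset_of_tgt_eq {e f : G.D} (he : e ∈ F) (hf : f ∈ F) (h : G.src e = G.tgt f)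
    (hne : e ≠ G.inv f) : branch F e ⊆ branch F f := by
  have hef : e ≠ f := by
    rintro rfl
    exact hF.src_notMem_branch he (h ▸ tgt_mem_branch F e)
  have h2 : G.tgt f ∉ branch F e := h ▸ hF.src_notMem_branch he
  refine hF.branch_subset ?_ ?_ h2
  · exact branch_step he hef hne (h ▸ tgt_mem_branch F f)
  · rwa [hF.src_mem_branch_iff hf hef.symm]
    intro h'
    exact hne (by rw [h', G.inv_inv])

lemma branch_disjoint {e f : G.D} (he : e ∈ F) (hf : f ∈ F) (h : G.src e = G.src f)
    (hne : e ≠ f) {v : G.V} (hv : v ∈ branch F e) : v ∉ branch F f := by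
  have := hF.branch_subset_of_tgt_eq he (hF.inv_mem hf) (by rw [tgt_inv, h])
    (by rwa [G.inv_inv]) hv
  rwa [hF.mem_branch_inv hf] at this

lemma mem_branch_of_reduced {f : G.D} {l : List G.D} {v : G.V}
    (hl : ∀ d ∈ f :: l, d ∈ F) (hr : G.Reduced (f :: l)) (hw : G.IsWalk (G.tgt f) l v) :
    v ∈ branch F f := by
  induction l generalizing f with
  | nil => cases hw; exact tgt_mem_branch F f
  | cons e l ih =>
    obtain ⟨h, hw⟩ := hw
    have hr' := reduced_cons.1 hr
    exact hF.branch_subset_of_tgt_eq (hl e (by simp)) (hl f (by simp)) h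
      (hr'.1 e (by simp)) (ih (fun d hd => hl d (List.mem_cons_of_mem _ hd)) hr'.2 hw)

lemma exists_separating {u v : G.V} (h : u ≠ v) :
    ∃ f ∈ F, G.src f = u ∧ v ∈ branch F f := by
  obtain ⟨l, hw, hl, hr⟩ := hF.exists_reduced u v
  cases l with
  | nil => exact absurd hw h
  | cons f l => exact ⟨f, hl f (by simp), hw.1, hF.mem_branch_of_reduced hl hr hw.2⟩

/-- Unless `e` and `f` are the same edge, `f` lies wholly on one side of `e`. After reversing `e` it
lies outside the branch of `e`, and that branch is on a single side of `f`. -/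
lemma branch_nested {e f : G.D} (he : e ∈ F) (hf : f ∈ F) :
    branch F e ⊆ branch F f ∨ branch F e ⊆ (branch F f)ᶜ ∨
      (branch F e)ᶜ ⊆ branch F f ∨ (branch F e)ᶜ ⊆ (branch F f)ᶜ := by
  by_cases h1 : e = f
  · subst h1; exact Or.inl subset_rfl
  by_cases h2 : e = G.inv f
  · subst h2
    rw [hF.branch_inv hf]
    exact Or.inr (Or.inl subset_rfl)
  have h3 : f ≠ G.inv e := fun h => h2 (by rw [h, G.inv_inv])
  have key : ∀ e ∈ F, e ≠ f → e ≠ G.inv f → G.src f ∉ branch F e →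
      branch F e ⊆ branch F f ∨ branch F e ⊆ (branch F f)ᶜ := by
    intro e he h1 h2 hs
    have h3 : f ≠ G.inv e := fun h => h2 (by rw [h, G.inv_inv])
    have ht : G.tgt f ∉ branch F e := by rwa [← hF.src_mem_branch_iff hf (Ne.symm h1) h3]
    by_cases h : G.tgt e ∈ branch F f
    · exact Or.inl (hF.branch_subset h hs ht)
    · refine Or.inr ?_
      rw [← hF.branch_inv hf]
      refine hF.branch_subset ((hF.mem_branch_inv hf).2 h) ht ?_
      rwa [tgt_inv]
  by_cases hs : G.src f ∈ branch F e
  · have := key (G.inv e) (hF.inv_mem he) (fun h => h3 h.symm)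
      (fun h => h1 (inv_injective h)) (by rwa [hF.mem_branch_inv he, not_not])
    rw [hF.branch_inv he] at this
    exact Or.inr (Or.inr this)
  · rcases key e he h1 h2 hs with h | h
    exacts [Or.inl h, Or.inr (Or.inl h)]

end IsSpanningTree

/-- A graph with one vertex. -/
def IsOneVertex (R : FinGraph) : Prop := ∀ u v : R.V, u = v

end FinGraph

open FinGraph

/-! ## Ideal sides -/

/-- A side of an ideal edge: a set of half-edges of the rose. -/
structure IsIdealSide (R : FinGraph) (A : Set R.D) : Prop where
  nontrivial : A.Nontrivial
  nontrivial_compl : Aᶜ.Nontrivial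
  splits : ∃ h ∈ A, R.inv h ∉ A

lemma IsIdealSide.compl {R : FinGraph} {A : Set R.D} (h : IsIdealSide R A) :
    IsIdealSide R Aᶜ := by
  obtain ⟨h1, h2, x, hx, hx'⟩ := h
  exact ⟨h2, by rwa [compl_compl], R.inv x, hx', by simpa [R.inv_inv] using hx⟩

lemma IsIdealSide.ne_compl {R : FinGraph} {A : Set R.D} (h : IsIdealSide R A) : A ≠ Aᶜ := by
  obtain ⟨x, hx⟩ := h.nontrivial.nonempty
  intro he
  exact (he ▸ hx : x ∈ Aᶜ) hx

/-- The two bipartitions given by `A` and `B` do not cross. -/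
def Nested {H : Type*} (A B : Set H) : Prop := A ⊆ B ∨ A ⊆ Bᶜ ∨ Aᶜ ⊆ B ∨ Aᶜ ⊆ Bᶜ

/-- The sides of the ideal edges of an ideal tree. -/
structure IsSideSystem (R : FinGraph) (S : Set (Set R.D)) : Prop where
  ideal : ∀ A ∈ S, IsIdealSide R A
  compl_mem : ∀ A ∈ S, Aᶜ ∈ S
  nested : ∀ A ∈ S, ∀ B ∈ S, Nested A B

namespace ForestCollapse

variable {G R : FinGraph} (c : ForestCollapse G R)

lemma isSpanningTree (hR : R.IsOneVertex) : G.IsSpanningTree c.forestSet where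
  inv_mem h := c.inv_mem_forestSet.2 h
  isForest := c.isForest
  connected u v := (c.onV_eq_iff u v).1 (hR _ _)

/-- The half-edges of the rose on the far side of the edge `f` of the maximal tree. -/
def side (f : G.D) : Set R.D := {h | G.src (c.lift h) ∈ branch c.forestSet f}

lemma mem_side {f d : G.D} {h : R.D} (hd : c.onD d = some h) :
    h ∈ c.side f ↔ G.src d ∈ branch c.forestSet f := by
  rw [← c.lift_eq hd]; rfl

/-- All sides of the edges of the maximal tree. -/
def sides : Set (Set R.D) := c.side '' c.forestSet

variable (hR : R.IsOneVertex)

include hR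

lemma side_inv {f : G.D} (hf : f ∈ c.forestSet) : c.side (G.inv f) = (c.side f)ᶜ := by
  ext h
  exact (c.isSpanningTree hR).mem_branch_inv hf

/-- Induction on the size of the branch. Besides `G.inv f`, two half-edges leave the end of `f`. If
one is a tree edge, its branch is smaller and contained in that of `f`; otherwise both are petals
and give two elements of the side. -/
lemma side_nontrivial (hv : ∀ v, 3 ≤ G.valence v) {f : G.D} (hf : f ∈ c.forestSet) :
    (c.side f).Nontrivial := by
  have hT := c.isSpanningTree hR
  have := G.finite_V
  induction hk : (branch c.forestSet f).ncard using Nat.strong_induction_on generalizing f with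
  | _ k ih =>
  have key : ∀ d ∈ c.forestSet, G.src d = G.tgt f → d ≠ G.inv f → (c.side f).Nontrivial := by
    intro d hd hs hne
    have h1 := hT.branch_subset_of_tgt_eq hd hf hs hne
    refine (ih _ ?_ hd rfl).mono fun h hh => h1 hh
    rw [← hk]
    refine Set.ncard_lt_ncard ⟨h1, fun h => ?_⟩ (Set.toFinite _)
    exact hT.src_notMem_branch hd (h (hs ▸ tgt_mem_branch _ f))
  obtain ⟨d, hd, hd1, -⟩ := exists_src_eq_of_valence (hv (G.tgt f)) (G.inv f) (G.inv f)
  obtain ⟨e, he, he1, he2⟩ := exists_src_eq_of_valence (hv (G.tgt f)) (G.inv f) d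
  rcases c.mem_forestSet_or d with h | ⟨d', hd'⟩
  · exact key d h hd hd1
  rcases c.mem_forestSet_or e with h | ⟨e', he'⟩
  · exact key e h he he1
  refine ⟨d', ?_, e', ?_, ?_⟩
  · rw [c.mem_side hd', hd]
    exact tgt_mem_branch _ f
  · rw [c.mem_side he', he]
    exact tgt_mem_branch _ f
  · rintro rfl
    exact he2 (c.onD_injective he' hd')

/-- If the branch of `e` lies properly in that of `f`, valence three at the start of `e` provides a
third direction, leading neither into `e` nor back to `f`. Whatever petal is met there belongs to
the side of `f` but not to that of `e`. -/
lemma side_injective (hv : ∀ v, 3 ≤ G.valence v) {e f : G.D} (he : e ∈ c.forestSet)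
    (hf : f ∈ c.forestSet) (h : c.side e = c.side f) : e = f := by
  have hT := c.isSpanningTree hR
  have key : ∀ e ∈ c.forestSet, ∀ f ∈ c.forestSet, c.side e = c.side f →
      branch c.forestSet e ⊆ branch c.forestSet f → e = f := by
    intro e he f hf h hsub
    by_contra hne
    have hne' : e ≠ G.inv f := by
      rintro rfl
      rw [hT.branch_inv hf] at hsub
      have h1 : G.src f ∈ (branch c.forestSet f)ᶜ := hT.src_notMem_branch hf
      exact h1 (hsub h1)
    have hsf : G.src e ∈ branch c.forestSet f :=
      (hT.src_mem_branch_iff he hne hne').2 (hsub (tgt_mem_branch _ e))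
    have hsfe : G.src f ∉ branch c.forestSet e := fun h =>
      hT.src_notMem_branch hf (hsub h)
    -- Branches at a common vertex are disjoint, so of two further half-edges at most one leads
    -- towards the start of `f`.
    obtain ⟨x, hx, hxe, hxp⟩ : ∃ x, G.src x = G.src e ∧ x ≠ e ∧
        ¬ (x ∈ c.forestSet ∧ G.src f ∈ branch c.forestSet x) := by
      obtain ⟨x, hx, hxe, -⟩ := exists_src_eq_of_valence (hv (G.src e)) e e
      by_cases hxp : x ∈ c.forestSet ∧ G.src f ∈ branch c.forestSet x
      · obtain ⟨y, hy, hye, hyx⟩ := exists_src_eq_of_valence (hv (G.src e)) e x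
        refine ⟨y, hy, hye, fun hyp => ?_⟩
        exact hT.branch_disjoint hyp.1 hxp.1 (hy.trans hx.symm) hyx hyp.2 hxp.2
      · exact ⟨x, hx, hxe, hxp⟩
    rcases c.mem_forestSet_or x with hxF | ⟨x', hx'⟩
    · have hxs : G.src f ∉ branch c.forestSet x := fun h => hxp ⟨hxF, h⟩
      have hxf : x ≠ f := by
        rintro rfl
        exact hT.src_notMem_branch hf (hx ▸ hsf)
      have hxf' : x ≠ G.inv f := by
        rintro rfl
        apply hxs
        have := tgt_mem_branch c.forestSet (G.inv f)
        rwa [tgt_inv] at this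
      have hsub' : branch c.forestSet x ⊆ branch c.forestSet f := by
        refine hT.branch_subset ?_ hxs ?_
        · exact IsSpanningTree.branch_step hxF hxf hxf' (hx ▸ hsf)
        · rwa [← hT.src_mem_branch_iff hf hxf.symm]
          intro h'
          exact hxf' (by rw [h', G.inv_inv])
      obtain ⟨p, hp⟩ := (c.side_nontrivial hR hv hxF).nonempty
      have hp1 : p ∈ c.side f := hsub' hp
      rw [← h] at hp1
      exact hT.branch_disjoint hxF he hx hxe hp hp1
    · have h1 : x' ∈ c.side f := by rwa [c.mem_side hx', hx]
      rw [← h, c.mem_side hx', hx] at h1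
      exact hT.src_notMem_branch he h1
  obtain ⟨p, hp⟩ := (c.side_nontrivial hR hv hf).nonempty
  obtain ⟨q, hq⟩ := (c.side_nontrivial hR hv (hT.inv_mem hf)).nonempty
  rw [c.side_inv hR hf] at hq
  rcases hT.branch_nested he hf with h1 | h1 | h1 | h1
  · exact key e he f hf h h1
  · exact absurd hp (h1 (h ▸ hp : p ∈ c.side e))
  · exact absurd (h1 (show G.src (c.lift q) ∈ _ from fun h' => hq (h ▸ h' : q ∈ c.side f))) hq
  · exact (key f hf e he h.symm (Set.compl_subset_compl.1 h1)).symm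

/-- A path joining the ends of `f` without using `f` has to enter the branch of `f`; no other tree
edge does so, hence the step is made along a petal. -/
lemma exists_splits (hs : G.NoSeparatingEdge) {f : G.D} (hf : f ∈ c.forestSet) :
    ∃ h ∈ c.side f, R.inv h ∉ c.side f := by
  have hT := c.isSpanningTree hR
  obtain ⟨l, hw, hl, hl'⟩ := hs f
  suffices H : ∀ u, G.IsWalk u l (G.tgt f) → u ∉ branch c.forestSet f →
      ∃ h ∈ c.side f, R.inv h ∉ c.side f from H _ hw (hT.src_notMem_branch hf)
  clear hw
  induction l with
  | nil => rintro u rfl h; exact absurd (tgt_mem_branch _ f) h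
  | cons d l ih =>
    rintro u ⟨rfl, hw⟩ hu
    simp only [List.mem_cons, not_or] at hl hl'
    by_cases ht : G.tgt d ∈ branch c.forestSet f
    · rcases c.mem_forestSet_or d with hd | ⟨d', hd⟩
      · rw [← hT.src_mem_branch_iff hd (Ne.symm hl.1) (Ne.symm hl'.1)] at ht
        exact absurd ht hu
      · refine ⟨R.inv d', ?_, ?_⟩
        · rwa [c.mem_side (d := G.inv d) (by rw [c.inv, hd]; rfl)]
        · rwa [R.inv_inv, c.mem_side hd]
    · exact ih hl.2 hl'.2 _ hw ht

lemma isSideSystem_sides (hv : ∀ v, 3 ≤ G.valence v) (hs : G.NoSeparatingEdge) :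
    IsSideSystem R c.sides where
  ideal := by
    rintro _ ⟨f, hf, rfl⟩
    refine ⟨c.side_nontrivial hR hv hf, ?_, c.exists_splits hR hs hf⟩
    rw [← c.side_inv hR hf]
    exact c.side_nontrivial hR hv (c.inv_mem_forestSet.2 hf)
  compl_mem := by
    rintro _ ⟨f, hf, rfl⟩
    exact ⟨G.inv f, c.inv_mem_forestSet.2 hf, c.side_inv hR hf⟩
  nested := by
    rintro _ ⟨e, he, rfl⟩ _ ⟨f, hf, rfl⟩
    rcases (c.isSpanningTree hR).branch_nested he hf with h | h | h | h
    · exact Or.inl fun x hx => h hx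
    · exact Or.inr (Or.inl fun x hx => h hx)
    · exact Or.inr (Or.inr (Or.inl fun x hx => h hx))
    · exact Or.inr (Or.inr (Or.inr fun x hx => h hx))

end ForestCollapse

end OuterSpace

namespace OuterSpace

open FinGraph

/-! ## The graph of an ideal tree -/

section BlowUp

variable {R : FinGraph} {S : Set (Set R.D)}

/-- The sides that contain the starting point of a half-edge. -/
def sideStart (S : Set (Set R.D)) : R.D ⊕ S → Set (Set R.D)
  | Sum.inl h => {T | T ∈ S ∧ h ∈ T}
  | Sum.inr U => {T | T ∈ S ∧ (U.1 ⊂ T ∨ U.1ᶜ ⊆ T)}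

lemma IsSideSystem.nonempty (hS : IsSideSystem R S) {T : Set R.D} (hT : T ∈ S) : T.Nonempty :=
  (hS.ideal T hT).nontrivial.nonempty

lemma IsSideSystem.not_compl_subset (hS : IsSideSystem R S) {T : Set R.D} (hT : T ∈ S) :
    ¬ Tᶜ ⊆ T := fun h => by
  obtain ⟨x, hx⟩ := hS.nonempty (hS.compl_mem T hT)
  exact hx (h hx)

lemma compl_mem_sideStart_iff (hS : IsSideSystem R S) (d : R.D ⊕ S) {T : Set R.D} (hT : T ∈ S) :
    Tᶜ ∈ sideStart S d ↔ T ∉ sideStart S d := by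
  rcases d with d | U
  · simp [sideStart, hT, hS.compl_mem T hT]
  · simp only [sideStart, Set.mem_ofPred_eq, hT, hS.compl_mem T hT, true_and]
    obtain ⟨U, hU⟩ := U
    obtain ⟨x, hx⟩ := hS.nonempty hU
    obtain ⟨y, hy⟩ := hS.nonempty (hS.compl_mem U hU)
    have hn := hS.nested U hU T hT
    simp only
    constructor
    · rintro (h | h) (h' | h')
      · exact h.1 hx (h'.1 hx)
      · exact h.2 (Set.compl_subset_comm.1 h')
      · exact h'.2 (Set.compl_subset_compl.1 h)
      · exact h hy (h' hy)
    · intro h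
      simp only [not_or] at h
      rcases hn with hn | hn | hn | hn
      · right
        have : U = T := by
          by_contra hne
          exact h.1 (Set.ssubset_iff_subset_ne.2 ⟨hn, hne⟩)
        rw [this]
      · by_cases hne : U = Tᶜ
        · exact absurd (by rw [hne, compl_compl]) h.2
        · exact Or.inl (Set.ssubset_iff_subset_ne.2 ⟨hn, hne⟩)
      · exact absurd hn h.2
      · exact Or.inr hn

/-- A consistent choice of one side of every ideal edge of an ideal tree. -/
structure IsConsistent (S : Set (Set R.D)) (v : Set (Set R.D)) : Prop where
  subset : v ⊆ S
  compl_mem_iff : ∀ T ∈ S, Tᶜ ∈ v ↔ T ∉ v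
  up : ∀ T ∈ v, ∀ U ∈ S, T ⊆ U → U ∈ v

lemma isConsistent_sideStart (hS : IsSideSystem R S) (d : R.D ⊕ S) :
    IsConsistent S (sideStart S d) where
  subset T h := by rcases d with d | U <;> exact h.1
  compl_mem_iff _ := compl_mem_sideStart_iff hS d
  up T hT U hU h := by
    rcases d with d | W
    · exact ⟨hU, h hT.2⟩
    · refine ⟨hU, ?_⟩
      rcases hT.2 with h' | h'
      · exact Or.inl (h'.trans_subset h)
      · exact Or.inr (h'.trans h)

/-- The graph of an ideal tree: the petals of the rose together with one edge for every ideal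
edge of the tree. -/
def blowUp (hS : IsSideSystem R S) : FinGraph where
  V := {v : Set (Set R.D) // IsConsistent S v}
  D := R.D ⊕ S
  src d := ⟨sideStart S d, isConsistent_sideStart hS d⟩
  inv := Sum.map R.inv fun U => ⟨U.1ᶜ, hS.compl_mem _ U.2⟩
  inv_inv d := by
    rcases d with h | U
    · simp [R.inv_inv]
    · simp
  inv_ne d := by
    rcases d with h | U
    · simpa using R.inv_ne h
    · simp only [Sum.map_inr, ne_eq, Sum.inr.injEq]
      intro h
      exact (hS.ideal _ U.2).ne_compl (congrArg Subtype.val h).symm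
  finite_V := by
    have := R.finite_D
    infer_instance
  finite_D := by
    have := R.finite_D
    infer_instance

variable (hS : IsSideSystem R S)

include hS

lemma mem_of_mem_vertex {v : (blowUp hS).V} {T : Set R.D} (h : T ∈ v.1) : T ∈ S := v.2.subset h

lemma compl_mem_vertex_iff (v : (blowUp hS).V) {T : Set R.D} (hT : T ∈ S) :
    Tᶜ ∈ v.1 ↔ T ∉ v.1 := v.2.compl_mem_iff T hT

lemma vertex_up (v : (blowUp hS).V) {T U : Set R.D} (hT : T ∈ v.1) (hU : U ∈ S)
    (h : T ⊆ U) : U ∈ v.1 := v.2.up T hT U hU h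

lemma exists_mem_diff {v w : (blowUp hS).V} (h : v ≠ w) : (w.1 \ v.1).Nonempty := by
  by_contra hc
  rw [Set.not_nonempty_iff_eq_empty, Set.sdiff_eq_empty] at hc
  refine h (Subtype.ext (subset_antisymm (fun T hT => ?_) hc))
  by_contra hTw
  have hTS := mem_of_mem_vertex hS hT
  exact (compl_mem_vertex_iff hS v hTS).1 (hc ((compl_mem_vertex_iff hS w hTS).2 hTw)) hT

/-- The sides in `w` but not in `v` are those of the edges on the way from `v` to `w`, pointing
towards `w`. The edge nearest to `v` has the largest far side, so a maximal such side belongs to an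
edge starting at `v`. -/
lemma eq_src_of_maximal {v w : (blowUp hS).V} {T : Set R.D}
    (hT : Maximal (fun T => T ∈ w.1 \ v.1) T) (hTS : T ∈ S) :
    v = (blowUp hS).src (Sum.inr ⟨T, hTS⟩) := by
  have hTw := hT.prop.1
  have hTv := hT.prop.2
  have hmax : ∀ U ∈ S, T ⊆ U → U ∉ v.1 → U = T := fun U hU h hv =>
    subset_antisymm (hT.le_of_ge ⟨vertex_up hS w hTw hU h, hv⟩ h) h
  refine Subtype.ext (Set.ext fun U => ⟨fun hU => ?_, fun hU => ?_⟩)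
  · have hUS := mem_of_mem_vertex hS hU
    refine ⟨hUS, ?_⟩
    have hUT : U ≠ T := by rintro rfl; exact hTv hU
    rcases hS.nested T hTS U hUS with h | h | h | h
    · exact Or.inl (Set.ssubset_iff_subset_ne.2 ⟨h, hUT.symm⟩)
    · have h1 : Uᶜ ∉ v.1 := fun h1 => (compl_mem_vertex_iff hS v hUS).1 h1 hU
      have h2 := hmax _ (hS.compl_mem U hUS) h h1
      right
      change Tᶜ ⊆ U
      rw [← h2, compl_compl]
    · exact Or.inr h
    · exact absurd (vertex_up hS v hU hTS (Set.compl_subset_compl.1 h)) hTv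
  · obtain ⟨hUS, h | h⟩ := hU
    · by_contra hUv
      exact h.ne (hmax U hUS h.1 hUv).symm
    · exact vertex_up hS v ((compl_mem_vertex_iff hS v hTS).2 hTv) hUS h

lemma exists_src_eq {v w : (blowUp hS).V} (h : v ≠ w) :
    ∃ U : S, (blowUp hS).src (Sum.inr U) = v ∧ U.1 ∈ w.1 \ v.1 := by
  have := R.finite_D
  obtain ⟨T, hT⟩ := (Set.toFinite (w.1 \ v.1)).exists_maximal (exists_mem_diff hS h)
  exact ⟨⟨T, mem_of_mem_vertex hS hT.prop.1⟩, (eq_src_of_maximal hS hT _).symm, hT.prop⟩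

lemma mem_src_inr_iff {T : Set R.D} {U : S} :
    T ∈ ((blowUp hS).src (Sum.inr U)).1 ↔ T ∈ S ∧ (U.1 ⊂ T ∨ U.1ᶜ ⊆ T) := Iff.rfl

lemma mem_tgt_inr_iff {T : Set R.D} {U : S} :
    T ∈ ((blowUp hS).tgt (Sum.inr U)).1 ↔ T ∈ S ∧ (U.1ᶜ ⊂ T ∨ U.1 ⊆ T) := by
  change T ∈ S ∧ (U.1ᶜ ⊂ T ∨ U.1ᶜᶜ ⊆ T) ↔ _
  rw [compl_compl]

lemma notMem_src_inr (U : S) : U.1 ∉ ((blowUp hS).src (Sum.inr U)).1 := by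
  rintro ⟨-, h | h⟩
  · exact h.ne rfl
  · exact hS.not_compl_subset U.2 h

lemma mem_tgt_inr (U : S) : U.1 ∈ ((blowUp hS).tgt (Sum.inr U)).1 :=
  (mem_tgt_inr_iff hS).2 ⟨U.2, Or.inr subset_rfl⟩

lemma mem_src_iff_mem_tgt {T : Set R.D} {U : S} (h1 : U.1 ≠ T) (h2 : U.1ᶜ ≠ T) :
    T ∈ ((blowUp hS).src (Sum.inr U)).1 ↔ T ∈ ((blowUp hS).tgt (Sum.inr U)).1 := by
  rw [mem_src_inr_iff, mem_tgt_inr_iff, Set.ssubset_iff_subset_ne, Set.ssubset_iff_subset_ne]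
  tauto

/-- Induction on the number of sides separating `v` from `w`: the step along the edge of
`exists_src_eq` removes its own side from `w.1 \ v.1` and adds none. -/
lemma exists_tree_walk (v w : (blowUp hS).V) :
    ∃ l, (blowUp hS).IsWalk v l w ∧ ∀ d ∈ l, ∃ U : S, d = Sum.inr U ∧ U.1 ∈ w.1 \ v.1 := by
  have := R.finite_D
  induction hk : (w.1 \ v.1).ncard using Nat.strong_induction_on generalizing v with
  | _ k ih =>
  by_cases hvw : v = w
  · exact ⟨[], hvw, by simp⟩
  obtain ⟨U, rfl, hU⟩ := exists_src_eq hS hvw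
  have hsub : w.1 \ ((blowUp hS).tgt (Sum.inr U)).1 ⊆
      w.1 \ ((blowUp hS).src (Sum.inr U)).1 := by
    rintro T ⟨hTw, hT⟩
    refine ⟨hTw, fun h => hT ?_⟩
    rw [← mem_src_iff_mem_tgt hS]
    · exact h
    · rintro rfl; exact notMem_src_inr hS U h
    · rintro rfl; exact (compl_mem_vertex_iff hS w U.2).1 hTw hU.1
  obtain ⟨l, hl, hl'⟩ := ih _ (by
    rw [← hk]
    refine Set.ncard_lt_ncard ⟨hsub, fun h => ?_⟩ (Set.toFinite _)
    exact (h hU).2 (mem_tgt_inr hS U)) _ rfl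
  refine ⟨Sum.inr U :: l, ⟨rfl, hl⟩, fun d hd => ?_⟩
  rcases List.mem_cons.1 hd with rfl | hd
  · exact ⟨U, rfl, hU⟩
  · obtain ⟨U', rfl, hU'⟩ := hl' d hd
    exact ⟨U', rfl, hsub hU'⟩

/-- The potential of the edge `U` is membership of `U` in the vertex; it changes only across `U`
itself. -/
lemma isForest_range_inr : (blowUp hS).IsForest (Set.range Sum.inr) := by
  refine isForest_of_potential (fun d v => ∃ U : S, d = Sum.inr U ∧ U.1 ∈ v.1) ?_ ?_ ?_
  · rintro _ ⟨U, rfl⟩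
    exact ⟨U, rfl, mem_tgt_inr hS U⟩
  · rintro _ ⟨U, rfl⟩ ⟨U', h, h'⟩
    cases Sum.inr_injective h
    exact notMem_src_inr hS U h'
  · rintro _ ⟨U, rfl⟩ _ ⟨T, rfl⟩ h1 h2
    have key := mem_src_iff_mem_tgt hS (T := U.1) (U := T)
      (fun h => h1 (congrArg Sum.inr (Subtype.ext h)))
      (fun h => h2 (congrArg Sum.inr (Subtype.ext (by simp [← h]))))
    constructor
    · rintro ⟨U', h, h'⟩
      cases Sum.inr_injective h
      exact ⟨U, rfl, key.1 h'⟩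
    · rintro ⟨U', h, h'⟩
      cases Sum.inr_injective h
      exact ⟨U, rfl, key.2 h'⟩

omit hS in
lemma _root_.OuterSpace.FinGraph.IsForest.mono {G : FinGraph} {F F' : Set G.D}
    (h : G.IsForest F) (hF : F' ⊆ F) : G.IsForest F' :=
  fun v l hw hl => h v l hw fun d hd => hF (hl d hd)

/-- The collapse of the graph of an ideal tree to the rose. -/
def blowUpCollapse (hR : R.IsOneVertex) (h0 : R.D) : ForestCollapse (blowUp hS) R where
  onV _ := R.src h0
  onD := Sum.elim some fun _ => none
  inv d := by rcases d with d | d <;> rfl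
  src _ _ _ := hR _ _
  forest := (isForest_range_inr hS).mono (by
    rintro (d | d) h
    · cases h
    · exact ⟨d, rfl⟩)
  onV_surjective s := ⟨(blowUp hS).src (Sum.inl h0), hR _ _⟩
  onV_eq_iff u v := by
    refine ⟨fun _ => ?_, fun _ => rfl⟩
    obtain ⟨l, hl, hl'⟩ := exists_tree_walk hS u v
    refine ⟨l, hl, fun d hd => ?_⟩
    obtain ⟨U, rfl, -⟩ := hl' d hd
    rfl
  onD_bijective h := ⟨Sum.inl h, rfl, by
    rintro (d | d) hd
    · exact congrArg Sum.inl (Option.some_injective _ hd)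
    · cases hd⟩

omit hS in
/-- The vertex of the smaller tree under a vertex of the bigger tree. -/
lemma IsConsistent.inter {S' v : Set (Set R.D)} (hS : IsSideSystem R S) (h : S ⊆ S')
    (hv : IsConsistent S' v) : IsConsistent S (v ∩ S) where
  subset := Set.inter_subset_right
  compl_mem_iff T hT := by
    simp [hS.compl_mem T hT, hT, hv.compl_mem_iff T (h hT)]
  up T hT U hU hTU := ⟨hv.up T hT.1 U (h hU) hTU, hU⟩

omit hS in
lemma exists_src_eq_vertex (hS : IsSideSystem R S) (h0 : R.D) (v : (blowUp hS).V) :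
    ∃ d, (blowUp hS).src d = v := by
  by_cases h : (blowUp hS).src (Sum.inl h0) = v
  · exact ⟨_, h⟩
  · obtain ⟨U, hU, -⟩ := exists_src_eq hS (Ne.symm h)
    exact ⟨_, hU⟩

open Classical in
/-- The collapse between the graphs of two ideal trees, one contained in the other. -/
noncomputable def blowUpCollapseOfSubset {S' : Set (Set R.D)} (hS' : IsSideSystem R S')
    (h : S ⊆ S') (h0 : R.D) : ForestCollapse (blowUp hS') (blowUp hS) where
  onV v := ⟨v.1 ∩ S, v.2.inter hS h⟩
  onD := Sum.elim (fun x => some (Sum.inl x))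
    fun U => if hU : U.1 ∈ S then some (Sum.inr ⟨U.1, hU⟩) else none
  inv d := by
    rcases d with d | U
    · rfl
    · by_cases hU : U.1 ∈ S
      · simp [blowUp, hU, hS.compl_mem _ hU]
      · have : U.1ᶜ ∉ S := fun h => hU (by simpa using hS.compl_mem _ h)
        simp [blowUp, hU, this]
  src d d' hd := by
    rcases d with d | U
    · cases hd
      refine Subtype.ext (Set.ext fun T => ?_)
      exact ⟨fun hT => ⟨⟨h hT.1, hT.2⟩, hT.1⟩, fun hT => ⟨hT.2, hT.1.2⟩⟩
    · by_cases hU : U.1 ∈ S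
      · simp only [Sum.elim_inr, hU, dite_true] at hd
        obtain rfl := Option.some.inj hd
        refine Subtype.ext (Set.ext fun T => ?_)
        exact ⟨fun hT => ⟨⟨h hT.1, hT.2⟩, hT.1⟩, fun hT => ⟨hT.2, hT.1.2⟩⟩
      · simp [hU] at hd
  forest := (isForest_range_inr hS').mono (by
    rintro (d | d) h
    · cases h
    · exact ⟨d, rfl⟩)
  onV_surjective v := by
    obtain ⟨d, rfl⟩ := exists_src_eq_vertex hS h0 v
    rcases d with d | U
    · refine ⟨(blowUp hS').src (Sum.inl d), Subtype.ext (Set.ext fun T => ?_)⟩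
      exact ⟨fun hT => ⟨hT.2, hT.1.2⟩, fun hT => ⟨⟨h hT.1, hT.2⟩, hT.1⟩⟩
    · refine ⟨(blowUp hS').src (Sum.inr ⟨U.1, h U.2⟩), Subtype.ext (Set.ext fun T => ?_)⟩
      exact ⟨fun hT => ⟨hT.2, hT.1.2⟩, fun hT => ⟨⟨h hT.1, hT.2⟩, hT.1⟩⟩
  onV_eq_iff u v := by
    constructor
    · intro huv
      obtain ⟨l, hl, hl'⟩ := exists_tree_walk hS' u v
      refine ⟨l, hl, fun d hd => ?_⟩
      obtain ⟨U, rfl, hU⟩ := hl' d hd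
      have hUS : U.1 ∉ S := fun hUS => hU.2 (by
        have h1 : u.1 ∩ S = v.1 ∩ S := congrArg Subtype.val huv
        have h2 : U.1 ∈ u.1 ∩ S := h1 ▸ ⟨hU.1, hUS⟩
        exact h2.1)
      simp [hUS]
    · rintro ⟨l, hw, hl⟩
      induction l generalizing u with
      | nil => cases hw; rfl
      | cons d l ih =>
        obtain ⟨rfl, hw⟩ := hw
        rw [← ih _ hw fun d hd => hl d (List.mem_cons_of_mem _ hd)]
        have hd := hl d (by simp)
        rcases d with d | U
        · cases hd
        · have hU : U.1 ∉ S := fun hU => by simp [hU] at hd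
          have hU' : U.1ᶜ ∉ S := fun h => hU (by simpa using hS.compl_mem _ h)
          refine Subtype.ext (Set.ext fun T => and_congr_left fun hT => ?_)
          exact mem_src_iff_mem_tgt hS' (by rintro rfl; exact hU hT)
            (by rintro rfl; exact hU' hT)
  onD_bijective d := by
    rcases d with d | U
    · refine ⟨Sum.inl d, rfl, ?_⟩
      rintro (e | V) he
      · exact congrArg Sum.inl (Sum.inl_injective (Option.some.inj he))
      · by_cases hV : V.1 ∈ S
        · simp only [Sum.elim_inr, hV, dite_true] at he
          cases Option.some.inj he
        · simp [hV] at he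
    · refine ⟨Sum.inr ⟨U.1, h U.2⟩, by simp, ?_⟩
      rintro (e | V) he
      · cases Option.some.inj he
      · by_cases hV : V.1 ∈ S
        · simp only [Sum.elim_inr, hV, dite_true] at he
          cases Sum.inr_injective (Option.some.inj he)
          rfl
        · simp [hV] at he

/-! ### Valences and absence of separating edges in the graph of an ideal tree -/

lemma exists_block (v : (blowUp hS).V) (x : R.D) : (blowUp hS).src (Sum.inl x) = v ∨
    ∃ U : S, (blowUp hS).src (Sum.inr U) = v ∧ x ∈ U.1 := by
  by_cases h : (blowUp hS).src (Sum.inl x) = v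
  · exact Or.inl h
  · obtain ⟨U, h1, h2⟩ := exists_src_eq hS (Ne.symm h)
    exact Or.inr ⟨U, h1, h2.1.2⟩

lemma disjoint_of_src_eq {T U : S} (h : (blowUp hS).src (Sum.inr T) = (blowUp hS).src (Sum.inr U))
    (hne : T ≠ U) : U.1 ⊆ T.1ᶜ := by
  have h1 : U.1 ∉ ((blowUp hS).src (Sum.inr T)).1 := h ▸ notMem_src_inr hS U
  rw [← compl_mem_vertex_iff hS _ U.2] at h1
  rcases h1.2 with h2 | h2
  · exact Set.subset_compl_comm.1 h2.1
  · have := Set.compl_subset_compl.1 h2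
    have h3 : T.1 ∉ ((blowUp hS).src (Sum.inr U)).1 := h ▸ notMem_src_inr hS T
    refine absurd ?_ h3
    exact ⟨T.2, Or.inl (Set.ssubset_iff_subset_ne.2 ⟨this, fun h => hne (Subtype.ext h.symm)⟩)⟩

/-- The half-edges of the rose are divided among the half-edges at `v`: a petal end takes itself, a
tree edge takes its far side, and different tree edges take disjoint sides. If a tree edge `T`
leaves `v`, the complement of `T` has at least two elements and no single tree edge at `v` takes all
of it, so two more half-edges leave `v`. If no tree edge leaves `v`, all petal ends are there. -/
lemma three_le_valence_blowUp (hv : ∀ v, 3 ≤ R.valence v) (h0 : R.D) (v : (blowUp hS).V) :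
    3 ≤ (blowUp hS).valence v := by
  have := (blowUp hS).finite_D
  suffices H : 2 < {d : (blowUp hS).D | (blowUp hS).src d = v}.ncard from H
  rw [Set.two_lt_ncard_iff (Set.toFinite _)]
  by_cases hT : ∃ T : S, (blowUp hS).src (Sum.inr T) = v
  · obtain ⟨T, rfl⟩ := hT
    obtain ⟨x, hx, y, hy, hxy⟩ := (hS.ideal _ T.2).nontrivial_compl
    have hcase : ∀ x ∈ T.1ᶜ, (blowUp hS).src (Sum.inl x) = (blowUp hS).src (Sum.inr T) ∨
        ∃ U : S, (blowUp hS).src (Sum.inr U) = (blowUp hS).src (Sum.inr T) ∧ x ∈ U.1 ∧ U ≠ T := by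
      intro x hx
      rcases exists_block hS ((blowUp hS).src (Sum.inr T)) x with h | ⟨U, h, hxU⟩
      · exact Or.inl h
      · exact Or.inr ⟨U, h, hxU, by rintro rfl; exact hx hxU⟩
    rcases hcase x hx with h1 | ⟨U, h1, hxU, hUT⟩
    · rcases hcase y hy with h2 | ⟨U, h2, hyU, hUT⟩
      · exact ⟨Sum.inr T, Sum.inl x, Sum.inl y, rfl, h1, h2, Sum.inr_ne_inl, Sum.inr_ne_inl,
          fun h => hxy (Sum.inl_injective h)⟩
      · exact ⟨Sum.inr T, Sum.inl x, Sum.inr U, rfl, h1, h2, Sum.inr_ne_inl,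
          fun h => hUT (Sum.inr_injective h).symm, Sum.inl_ne_inr⟩
    · have hsub : U.1 ⊆ T.1ᶜ := disjoint_of_src_eq hS h1.symm hUT.symm
      obtain ⟨z, hz, hzU⟩ : ∃ z ∈ T.1ᶜ, z ∉ U.1 := by
        by_contra! hc
        have : T.1ᶜ ⊆ U.1 := hc
        have h3 : U.1 ∈ ((blowUp hS).src (Sum.inr T)).1 := ⟨U.2, Or.inr this⟩
        rw [← h1] at h3
        exact notMem_src_inr hS U h3
      rcases hcase z hz with h2 | ⟨W, h2, hzW, hWT⟩
      · exact ⟨Sum.inr T, Sum.inr U, Sum.inl z, rfl, h1, h2,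
          fun h => hUT (Sum.inr_injective h).symm, Sum.inr_ne_inl, Sum.inr_ne_inl⟩
      · exact ⟨Sum.inr T, Sum.inr U, Sum.inr W, rfl, h1, h2,
          fun h => hUT (Sum.inr_injective h).symm, fun h => hWT (Sum.inr_injective h).symm,
          fun h => hzU (Sum.inr_injective h ▸ hzW)⟩
  · have hall : ∀ x, (blowUp hS).src (Sum.inl x) = v := fun x =>
      (exists_block hS v x).resolve_right fun ⟨U, hU, _⟩ => hT ⟨U, hU⟩
    obtain ⟨y, -, hy, -⟩ := exists_src_eq_of_valence (hv (R.src h0)) h0 h0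
    obtain ⟨z, -, hz, hz'⟩ := exists_src_eq_of_valence (hv (R.src h0)) h0 y
    exact ⟨Sum.inl h0, Sum.inl y, Sum.inl z, hall _, hall _, hall _,
      fun h => hy (Sum.inl_injective h).symm, fun h => hz (Sum.inl_injective h).symm,
      fun h => hz' (Sum.inl_injective h).symm⟩

/-- A petal is bypassed in the tree. A tree edge `T` is bypassed by a petal with one end on each
side of `T`, reached and left by tree paths that stay on their side. -/
lemma noSeparatingEdge_blowUp : (blowUp hS).NoSeparatingEdge := by
  rintro (x | T)
  · obtain ⟨l, hl, hl'⟩ := exists_tree_walk hS ((blowUp hS).src (Sum.inl x))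
      ((blowUp hS).tgt (Sum.inl x))
    refine ⟨l, hl, fun h => ?_, fun h => ?_⟩
    · obtain ⟨U, hU, -⟩ := hl' _ h
      cases hU
    · obtain ⟨U, hU, -⟩ := hl' _ h
      cases hU
  · obtain ⟨x, hx, hx'⟩ := (hS.ideal _ T.2).splits
    obtain ⟨l, hl, hl'⟩ := exists_tree_walk hS ((blowUp hS).src (Sum.inr T))
      ((blowUp hS).src (Sum.inl (R.inv x)))
    obtain ⟨m, hm, hm'⟩ := exists_tree_walk hS ((blowUp hS).src (Sum.inl x))
      ((blowUp hS).tgt (Sum.inr T))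
    have h1 : T.1 ∉ ((blowUp hS).src (Sum.inl (R.inv x))).1 := fun h => hx' h.2
    have h2 : T.1 ∉ ((blowUp hS).src (Sum.inr T)).1 := notMem_src_inr hS T
    have h3 : T.1 ∈ ((blowUp hS).src (Sum.inl x)).1 := ⟨T.2, hx⟩
    have h4 := mem_tgt_inr hS T
    have key : ∀ {v w : (blowUp hS).V} {l : List (blowUp hS).D},
        (∀ d ∈ l, ∃ U : S, d = Sum.inr U ∧ U.1 ∈ w.1 \ v.1) → (T.1 ∈ v.1 ↔ T.1 ∈ w.1) →
        Sum.inr T ∉ l ∧ (blowUp hS).inv (Sum.inr T) ∉ l := by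
      intro v w l hl hvw
      refine ⟨fun h => ?_, fun h => ?_⟩
      · obtain ⟨U, hU, hU'⟩ := hl _ h
        cases Sum.inr_injective hU
        exact hU'.2 (hvw.2 hU'.1)
      · obtain ⟨U, hU, hU'⟩ := hl _ h
        cases Sum.inr_injective hU
        have h5 := (compl_mem_vertex_iff hS w T.2).1 hU'.1
        exact hU'.2 ((compl_mem_vertex_iff hS v T.2).2 (fun h => h5 (hvw.1 h)))
    obtain ⟨hl1, hl2⟩ := key hl' (by simp only [h1, h2])
    obtain ⟨hm1, hm2⟩ := key hm' (by simp only [h3, h4])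
    let d : (blowUp hS).D := Sum.inl (R.inv x)
    refine ⟨l ++ d :: m, hl.append (v := (blowUp hS).src d) ⟨rfl, ?_⟩, ?_, ?_⟩
    · have : (blowUp hS).tgt d = (blowUp hS).src (Sum.inl x) :=
        congrArg (fun y => (blowUp hS).src (Sum.inl y)) (R.inv_inv x)
      rwa [this]
    · intro h
      rcases List.mem_append.1 h with h | h
      · exact hl1 h
      · rcases List.mem_cons.1 h with h | h
        · exact Sum.inr_ne_inl h
        · exact hm1 h
    · intro h
      rcases List.mem_append.1 h with h | h
      · exact hl2 h
      · rcases List.mem_cons.1 h with h | h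
        · exact Sum.inr_ne_inl h
        · exact hm2 h

end BlowUp

end OuterSpace

namespace OuterSpace

open FinGraph

/-! ## Forest collapses are homotopy equivalences -/

section Equivalences

variable {G G' G'' : FinGraph}

lemma PathMap.IsHomotopyEquiv.left_cancel {f : PathMap G' G''} {g g' : PathMap G G'}
    (hf : f.IsHomotopyEquiv) (h : (f.comp g).Homotopic (f.comp g')) : g.Homotopic g' := by
  obtain ⟨f', h1, -⟩ := hf
  have h2 := h.comp_left f'
  rw [← comp_assoc, ← comp_assoc] at h2
  have h3 := h1.comp_right g
  have h4 := h1.comp_right g'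
  rw [id_comp] at h3 h4
  exact h3.symm.trans (h2.trans h4)

/-- Choose a base vertex in every component of the forest and send an edge to its lift, joined to
the base vertices by forest paths `t`. These paths are the tracks of the homotopy to the identity of
`G`; over collapsed edges it closes up because closed paths in a forest are null-homotopic. -/
lemma ForestCollapse.exists_homotopyInverse (c : ForestCollapse G G') :
    ∃ s : PathMap G' G, (s.comp c.toPathMap).Homotopic (PathMap.id G) ∧
      (c.toPathMap.comp s).Homotopic (PathMap.id G') := by
  classical
  let b : G'.V → G.V := Function.surjInv c.onV_surjective
  have hb : ∀ r, c.onV (b r) = r := Function.surjInv_eq c.onV_surjective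
  have ht : ∀ v, ∃ l, G.IsWalk (b (c.onV v)) l v ∧ ∀ d ∈ l, c.onD d = none := fun v =>
    (c.onV_eq_iff _ _).1 (hb _)
  choose t ht1 ht2 using ht
  have hsrc : ∀ d', G'.src d' = c.onV (G.src (c.lift d')) := fun d' =>
    c.src _ _ (c.onD_lift d')
  have htgt : ∀ d', G'.tgt d' = c.onV (G.tgt (c.lift d')) := fun d' => by
    rw [FinGraph.tgt, hsrc, c.lift_inv]; rfl
  let s : PathMap G' G :=
    { onV := b
      onD := fun d' => t (G.src (c.lift d')) ++ (c.lift d' :: G.rev (t (G.tgt (c.lift d'))))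
      walk := fun d' => by
        rw [hsrc, htgt]
        exact (ht1 _).append ⟨rfl, (ht1 _).rev⟩
      inv := fun d' => by
        rw [c.lift_inv, src_inv, tgt_inv]
        simp [FinGraph.rev, Function.comp_def, G.inv_inv] }
  have hnil : ∀ v, c.path (t v) = [] := fun v => c.path_eq_nil_iff.2 (ht2 v)
  have hnil' : ∀ v, c.path (G.rev (t v)) = [] := fun v =>
    c.path_eq_nil_iff.2 fun d hd => c.inv_mem_forestSet.1 (ht2 v _ (mem_rev.1 hd))
  refine ⟨s, ⟨t, ht1, fun d => ?_⟩, ⟨fun _ => [], fun r => hb r, fun d' => ?_⟩⟩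
  · change G.PathHomotopic (s.onPath (c.onD d).toList ++ t (G.tgt d)) (t (G.src d) ++ [d])
    rcases c.mem_forestSet_or d with hd | ⟨d', hd⟩
    · have hd' : c.onD d = none := hd
      rw [hd']
      change G.PathHomotopic (t (G.tgt d)) (t (G.src d) ++ [d])
      have hV : c.onV (G.src d) = c.onV (G.tgt d) :=
        (c.onV_eq_iff _ _).2 ⟨[d], isWalk_singleton d, by simpa using hd'⟩
      have h1 := ht1 (G.tgt d)
      rw [← hV] at h1
      have h2 := c.isForest.pathHomotopic_nil
        (((ht1 (G.src d)).append (isWalk_singleton d)).append h1.rev) (fun e he => ?_)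
      · have h3 := h2.append (PathHomotopic.refl (t (G.tgt d)))
        have h4 := (PathHomotopic.refl (t (G.src d) ++ [d])).append
          (PathHomotopic.rev_append_self (t (G.tgt d)))
        simp only [List.append_assoc, List.nil_append, List.append_nil] at h3 h4
        exact h3.symm.trans h4
      · rcases List.mem_append.1 he with he | he
        · rcases List.mem_append.1 he with he | he
          · exact ht2 _ _ he
          · rw [List.mem_singleton.1 he]; exact hd
        · exact c.inv_mem_forestSet.1 (ht2 _ _ (mem_rev.1 he))
    · rw [hd]
      have hl := c.lift_eq hd
      have : s.onPath (some d').toList = t (G.src d) ++ (d :: G.rev (t (G.tgt d))) := by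
        simp [PathMap.onPath, s, hl]
      rw [this]
      have h4 := (PathHomotopic.refl (t (G.src d) ++ [d])).append
          (PathHomotopic.rev_append_self (t (G.tgt d)))
      simpa using h4
  · change G'.PathHomotopic (c.toPathMap.onPath (s.onD d') ++ []) ([] ++ [d'])
    have : c.path (s.onD d') = [d'] := by
      change c.path (t (G.src (c.lift d')) ++ ([c.lift d'] ++ G.rev (t (G.tgt (c.lift d'))))) = _
      rw [c.path_append, c.path_append, hnil, hnil']
      simp [ForestCollapse.path, c.onD_lift]
    rw [c.onPath_eq, this]
    exact PathHomotopic.refl _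

lemma ForestCollapse.isHomotopyEquiv (c : ForestCollapse G G') :
    c.toPathMap.IsHomotopyEquiv := c.exists_homotopyInverse

/-! ## Composition of forest collapses -/

/-- An isomorphism as a forest collapse. -/
def GraphIso.toForestCollapse (h : GraphIso G G') : ForestCollapse G G' where
  onV := h.onV
  onD d := some (h.onD d)
  inv d := by simp [h.inv]
  src d d' hd := by cases hd; exact h.src d
  forest v l hw hl hr := by
    cases l with
    | nil => rfl
    | cons d l => exact absurd (hl d (by simp)) (by simp)
  onV_surjective := h.onV.surjective
  onV_eq_iff u v := by
    constructor
    · intro huv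
      exact ⟨[], h.onV.injective huv, by simp⟩
    · rintro ⟨l, hw, hl⟩
      cases l with
      | nil => cases hw; rfl
      | cons d l => exact absurd (hl d (by simp)) (by simp)
  onD_bijective d' := ⟨h.onD.symm d', by simp, fun d hd => by
    rw [← Option.some_injective _ hd]; simp⟩

lemma GraphIso.toForestCollapse_toPathMap (h : GraphIso G G') :
    h.toForestCollapse.toPathMap = h.toPathMap := rfl

lemma ForestCollapse.lift_walk (c : ForestCollapse G G') {p : G'.D → Prop} {u v : G.V}
    {l' : List G'.D} (hw : G'.IsWalk (c.onV u) l' (c.onV v)) (hl : ∀ d ∈ l', p d) :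
    ∃ l, G.IsWalk u l v ∧ ∀ d ∈ l, ∀ d', c.onD d = some d' → p d' := by
  induction l' generalizing u with
  | nil =>
    obtain ⟨l, hl, hl'⟩ := (c.onV_eq_iff u v).1 hw
    exact ⟨l, hl, fun d hd d' h => by rw [hl' d hd] at h; cases h⟩
  | cons d' l' ih =>
    obtain ⟨hs, hw⟩ := hw
    have h1 := c.onD_lift d'
    rw [c.src _ _ h1] at hs
    obtain ⟨l1, h2, h3⟩ := (c.onV_eq_iff _ _).1 hs.symm
    have h4 : G'.tgt d' = c.onV (G.tgt (c.lift d')) := by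
      have := c.src (G.inv (c.lift d')) (G'.inv d') (by rw [c.inv, h1]; rfl)
      exact this
    rw [h4] at hw
    obtain ⟨l2, h5, h6⟩ := ih hw fun d hd => hl d (List.mem_cons_of_mem _ hd)
    refine ⟨l1 ++ (c.lift d' :: l2), h2.append ⟨rfl, h5⟩, fun d hd e he => ?_⟩
    rcases List.mem_append.1 hd with hd | hd
    · rw [h3 d hd] at he; cases he
    · rcases List.mem_cons.1 hd with rfl | hd
      · rw [h1] at he
        cases he
        exact hl _ (by simp)
      · exact h6 d hd e he

/-- The composite of two forest collapses. -/
def ForestCollapse.comp (c' : ForestCollapse G' G'') (c : ForestCollapse G G') :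
    ForestCollapse G G'' where
  onV v := c'.onV (c.onV v)
  onD d := (c.onD d).bind c'.onD
  inv d := by
    rw [c.inv]
    cases c.onD d with
    | none => rfl
    | some d' => exact c'.inv d'
  src d d'' hd := by
    obtain ⟨d', h1, h2⟩ := Option.bind_eq_some_iff.1 hd
    rw [c'.src _ _ h2, c.src _ _ h1]
  forest v l hw hl hr := by
    refine c.eq_nil_of_path_eq_nil hw hr ?_
    refine c'.isForest.eq_nil (c.path_walk hw) (fun d' hd' => ?_) (c.path_reduced hw hr)
    obtain ⟨d, hd, hdd'⟩ := List.mem_filterMap.1 hd'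
    have h := hl d hd
    simp only [Set.mem_ofPred_eq, hdd', Option.bind_some] at h
    exact h
  onV_surjective := c'.onV_surjective.comp c.onV_surjective
  onV_eq_iff u v := by
    constructor
    · intro h
      obtain ⟨l', hw, hl'⟩ := (c'.onV_eq_iff _ _).1 h
      obtain ⟨l, hl, hl2⟩ := c.lift_walk hw hl'
      refine ⟨l, hl, fun d hd => ?_⟩
      cases h : c.onD d with
      | none => rfl
      | some d' => exact hl2 d hd d' h
    · rintro ⟨l, hw, hl⟩
      refine (c'.onV_eq_iff _ _).2 ⟨c.path l, c.path_walk hw, fun d' hd' => ?_⟩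
      obtain ⟨d, hd, hdd'⟩ := List.mem_filterMap.1 hd'
      have := hl d hd
      simpa [hdd'] using this
  onD_bijective d'' := by
    refine ⟨c.lift (c'.lift d''), by simp [c.onD_lift, c'.onD_lift], fun d hd => ?_⟩
    obtain ⟨d', h1, h2⟩ := Option.bind_eq_some_iff.1 hd
    rw [c'.lift_eq h2, c.lift_eq h1]

lemma ForestCollapse.comp_toPathMap (c' : ForestCollapse G' G'') (c : ForestCollapse G G') :
    (c'.comp c).toPathMap = c'.toPathMap.comp c.toPathMap := by
  simp only [toPathMap, PathMap.comp, ForestCollapse.comp, PathMap.mk.injEq, true_and]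
  funext d
  cases c.onD d with
  | none => rfl
  | some d' => simp [PathMap.onPath]

lemma ForestCollapse.eq_of_eq {c c' : ForestCollapse G G'} (h : c.onV = c'.onV)
    (h' : c.onD = c'.onD) : c = c' := by
  cases c; cases c'
  cases h; cases h'
  rfl

/-- Markings can be compared after a further collapse, as collapses are homotopy equivalences. For
graphs of ideal trees the comparison takes place in the rose. -/
lemma ForestCollapse.homotopic_of_comp {H : FinGraph} {c : ForestCollapse G' G''}
    {q : ForestCollapse G G'} {c' : ForestCollapse G G''} (h : c.comp q = c') {g : PathMap H G}
    {g' : PathMap H G'} (hh : (c'.toPathMap.comp g).Homotopic (c.toPathMap.comp g')) :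
    (q.toPathMap.comp g).Homotopic g' := by
  refine c.isHomotopyEquiv.left_cancel ?_
  rwa [← PathMap.comp_assoc, ← ForestCollapse.comp_toPathMap, h]

end Equivalences

/-! ### The order on the spine, and the marking on the graph of an ideal tree -/

namespace MarkedGraph

variable {n : ℕ}

lemma CollapsesTo.trans {a b c : MarkedGraph n} (h : a.CollapsesTo b) (h' : b.CollapsesTo c) :
    a.CollapsesTo c := by
  obtain ⟨q, hq⟩ := h
  obtain ⟨q', hq'⟩ := h'
  refine ⟨q'.comp q, ?_⟩
  rw [ForestCollapse.comp_toPathMap, PathMap.comp_assoc]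
  exact (hq.comp_left _).trans hq'

lemma Equivalent.collapsesTo {a b : MarkedGraph n} (h : a.Equivalent b) : a.CollapsesTo b := by
  obtain ⟨h, hh⟩ := h
  exact ⟨h.toForestCollapse, hh⟩

lemma cls_eq_iff {a b : MarkedGraph n} : a.cls = b.cls ↔ a.Equivalent b := Quotient.eq

lemma cls_le_iff {a b : MarkedGraph n} : a.cls ≤ b.cls ↔ b.CollapsesTo a := by
  constructor
  · rintro ⟨a', b', ha, hb, h⟩
    exact ((cls_eq_iff.1 hb).symm.collapsesTo.trans h).trans (cls_eq_iff.1 ha).collapsesTo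
  · exact fun h => ⟨a, b, rfl, rfl, h⟩

end MarkedGraph

namespace SpineVertex

variable {n : ℕ}

lemma le_refl' (x : SpineVertex n) : x ≤ x := by
  obtain ⟨a, rfl⟩ := Quotient.exists_rep x
  exact MarkedGraph.cls_le_iff.2 (MarkedGraph.Equivalent.refl a).collapsesTo

lemma le_trans' {x y z : SpineVertex n} (h : x ≤ y) (h' : y ≤ z) : x ≤ z := by
  obtain ⟨a, rfl⟩ := Quotient.exists_rep x
  obtain ⟨b, rfl⟩ := Quotient.exists_rep y
  obtain ⟨c, rfl⟩ := Quotient.exists_rep z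
  exact MarkedGraph.cls_le_iff.2
    ((MarkedGraph.cls_le_iff.1 h').trans (MarkedGraph.cls_le_iff.1 h))

end SpineVertex

namespace MarkedGraph

variable {n : ℕ}

lemma IsRose.isOneVertex {ρ : MarkedGraph n} (hρ : ρ.IsRose) : ρ.G.IsOneVertex := by
  intro u v
  have := (Nat.card_eq_one_iff_unique.1 hρ).1
  exact Subsingleton.elim u v

lemma exists_halfEdge (ρ : MarkedGraph n) : Nonempty ρ.G.D := by
  have h := ρ.three_le_valence (ρ.g.onV ())
  obtain ⟨d⟩ : Nonempty {d : ρ.G.D // ρ.G.src d = ρ.g.onV ()} := by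
    by_contra hc
    rw [not_nonempty_iff] at hc
    rw [FinGraph.valence, Nat.card_of_isEmpty] at h
    omega
  exact ⟨d.1⟩

/-- A half-edge of a marked graph. -/
noncomputable def halfEdge (ρ : MarkedGraph n) : ρ.G.D := ρ.exists_halfEdge.some

/-- The collapse of an ideal tree of a marked rose. -/
noncomputable def ideal (ρ : MarkedGraph n) (hρ : ρ.IsRose) {S : Set (Set ρ.G.D)}
    (hS : IsSideSystem ρ.G S) : ForestCollapse (blowUp hS) ρ.G :=
  blowUpCollapse hS hρ.isOneVertex ρ.halfEdge

/-- The marked graph of an ideal tree of a marked rose. -/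
noncomputable def blowUp (ρ : MarkedGraph n) (hρ : ρ.IsRose) {S : Set (Set ρ.G.D)}
    (hS : IsSideSystem ρ.G S) : MarkedGraph n where
  G := OuterSpace.blowUp hS
  g := (ρ.ideal hρ hS).exists_homotopyInverse.choose.comp ρ.g
  isHomotopyEquiv := PathMap.IsHomotopyEquiv.comp
    ⟨_, (ρ.ideal hρ hS).exists_homotopyInverse.choose_spec.symm⟩ ρ.isHomotopyEquiv
  three_le_valence := three_le_valence_blowUp hS ρ.three_le_valence ρ.halfEdge

lemma ideal_comp_blowUp (ρ : MarkedGraph n) (hρ : ρ.IsRose) {S : Set (Set ρ.G.D)}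
    (hS : IsSideSystem ρ.G S) :
    ((ρ.ideal hρ hS).toPathMap.comp (ρ.blowUp hρ hS).g).Homotopic ρ.g := by
  have h := (ρ.ideal hρ hS).exists_homotopyInverse.choose_spec.2.comp_right ρ.g
  rw [PathMap.id_comp, PathMap.comp_assoc] at h
  exact h

lemma blowUp_collapsesTo (ρ : MarkedGraph n) (hρ : ρ.IsRose) {S : Set (Set ρ.G.D)}
    (hS : IsSideSystem ρ.G S) : (ρ.blowUp hρ hS).CollapsesTo ρ :=
  ⟨_, ρ.ideal_comp_blowUp hρ hS⟩

lemma blowUp_collapsesTo_blowUp (ρ : MarkedGraph n) (hρ : ρ.IsRose) {S S' : Set (Set ρ.G.D)}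
    (hS : IsSideSystem ρ.G S) (hS' : IsSideSystem ρ.G S') (h : S ⊆ S') :
    (ρ.blowUp hρ hS').CollapsesTo (ρ.blowUp hρ hS) := by
  refine ⟨blowUpCollapseOfSubset hS hS' h ρ.halfEdge, ?_⟩
  have : (ρ.ideal hρ hS).comp (blowUpCollapseOfSubset hS hS' h ρ.halfEdge) = ρ.ideal hρ hS' := by
    refine ForestCollapse.eq_of_eq rfl (funext fun d => ?_)
    rcases d with d | U
    · rfl
    · by_cases hU : U.1 ∈ S <;>
        simp [ForestCollapse.comp, ideal, blowUpCollapse, blowUpCollapseOfSubset, hU] <;> rfl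
  refine ForestCollapse.homotopic_of_comp this ?_
  exact (ρ.ideal_comp_blowUp hρ hS').trans (ρ.ideal_comp_blowUp hρ hS).symm

end MarkedGraph

/-! ## Every graph over a rose is given by an ideal tree -/

section Recognition

variable {G R : FinGraph} (c : ForestCollapse G R) (hR : R.IsOneVertex)
  (hv : ∀ v, 3 ≤ G.valence v) (hs : G.NoSeparatingEdge)

/-- The sides that contain a given vertex. -/
def sidesAt (v : G.V) : Set (Set R.D) :=
  {T | ∃ f ∈ c.forestSet, c.side f = T ∧ v ∈ branch c.forestSet f}

include hR hv

lemma side_mem_sidesAt_iff {v : G.V} {f : G.D} (hf : f ∈ c.forestSet) :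
    c.side f ∈ sidesAt c v ↔ v ∈ branch c.forestSet f := by
  constructor
  · rintro ⟨e, he, h, h'⟩
    rwa [c.side_injective hR hv he hf h] at h'
  · exact fun h => ⟨f, hf, rfl, h⟩

lemma isConsistent_sidesAt (v : G.V) : IsConsistent c.sides (sidesAt c v) where
  subset := by rintro _ ⟨f, hf, rfl, -⟩; exact ⟨f, hf, rfl⟩
  compl_mem_iff := by
    rintro _ ⟨f, hf, rfl⟩
    rw [← c.side_inv hR hf, side_mem_sidesAt_iff c hR hv (c.inv_mem_forestSet.2 hf),
      side_mem_sidesAt_iff c hR hv hf, (c.isSpanningTree hR).mem_branch_inv hf]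
  up := by
    rintro _ ⟨e, he, rfl, hve⟩ _ ⟨f, hf, rfl⟩ hef
    rw [side_mem_sidesAt_iff c hR hv hf]
    have hT := c.isSpanningTree hR
    obtain ⟨p, hp⟩ := (c.side_nontrivial hR hv he).nonempty
    obtain ⟨q, hq⟩ := (c.side_nontrivial hR hv (hT.inv_mem hf)).nonempty
    rw [c.side_inv hR hf] at hq
    rcases hT.branch_nested he hf with h | h | h | h
    · exact h hve
    · exact absurd (hef hp) (h hp)
    · by_contra hvf
      exact hq (h fun h' => hq (hef h'))
    · have : c.side f ⊆ c.side e := fun x hx => by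
        by_contra hxe
        exact h hxe hx
      rwa [← c.side_injective hR hv he hf (subset_antisymm hef this)]

omit hR hv in
lemma sidesAt_src_lift (h : R.D) : sidesAt c (G.src (c.lift h)) = {T | T ∈ c.sides ∧ h ∈ T} := by
  ext T
  constructor
  · rintro ⟨f, hf, rfl, h'⟩
    exact ⟨⟨f, hf, rfl⟩, h'⟩
  · rintro ⟨⟨f, hf, rfl⟩, h'⟩
    exact ⟨f, hf, rfl, h'⟩

/-- This matches `sideStart` on tree edges. Passing from the end of `e` to its start changes the
side of no edge but `e`, so every side properly containing that of `e` also contains the start. -/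
lemma sidesAt_src {e : G.D} (he : e ∈ c.forestSet) : sidesAt c (G.src e) =
    {T | T ∈ c.sides ∧ (c.side e ⊂ T ∨ (c.side e)ᶜ ⊆ T)} := by
  have hT := c.isSpanningTree hR
  have hcons := isConsistent_sidesAt c hR hv (G.src e)
  have hes : c.side e ∉ sidesAt c (G.src e) := by
    rw [side_mem_sidesAt_iff c hR hv he]
    exact hT.src_notMem_branch he
  have hes' : (c.side e)ᶜ ∈ sidesAt c (G.src e) :=
    (hcons.compl_mem_iff _ ⟨e, he, rfl⟩).2 hes
  have key : ∀ f ∈ c.forestSet, f ≠ e → f ≠ G.inv e → c.side e ⊆ c.side f →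
      c.side f ∈ sidesAt c (G.src e) := by
    intro f hf h1 h2 h
    have := (isConsistent_sidesAt c hR hv (G.tgt e)).up (c.side e)
      ((side_mem_sidesAt_iff c hR hv he).2 (tgt_mem_branch _ e)) _ ⟨f, hf, rfl⟩ h
    rw [side_mem_sidesAt_iff c hR hv hf] at this ⊢
    exact (hT.src_mem_branch_iff he h1.symm (fun h => h2 (by rw [h, G.inv_inv]))).2 this
  have key' : ∀ f ∈ c.forestSet, c.side e ⊂ c.side f → c.side f ∈ sidesAt c (G.src e) := by
    intro f hf h
    refine key f hf (by rintro rfl; exact h.ne rfl) ?_ h.1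
    rintro rfl
    rw [c.side_inv hR he] at h
    obtain ⟨p, hp⟩ := (c.side_nontrivial hR hv he).nonempty
    exact h.1 hp hp
  ext T
  constructor
  · intro hT'
    have hTS := hcons.subset hT'
    refine ⟨hTS, ?_⟩
    obtain ⟨f, hf, rfl⟩ := hTS
    by_contra hc
    simp only [not_or] at hc
    have hne : f ≠ e := by rintro rfl; exact hes hT'
    have hne' : f ≠ G.inv e := by
      rintro rfl
      rw [c.side_inv hR he] at hc
      exact hc.2 subset_rfl
    have hss : c.side e ≠ c.side f := fun h => hne (c.side_injective hR hv hf he h.symm)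
    have hn : Nested (c.side e) (c.side f) := by
      rcases hT.branch_nested he hf with h | h | h | h
      · exact Or.inl fun x hx => h hx
      · exact Or.inr (Or.inl fun x hx => h hx)
      · exact Or.inr (Or.inr (Or.inl fun x hx => h hx))
      · exact Or.inr (Or.inr (Or.inr fun x hx => h hx))
    rw [side_mem_sidesAt_iff c hR hv hf] at hT'
    have hfi := hT.inv_mem hf
    rcases hn with h | h | h | h
    · exact hc.1 (Set.ssubset_iff_subset_ne.2 ⟨h, hss⟩)
    · rw [← c.side_inv hR hf] at h
      have := key _ hfi (fun h => hne' (by rw [← h, G.inv_inv]))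
        (fun h => hne (inv_injective h)) h
      rw [side_mem_sidesAt_iff c hR hv hfi, hT.mem_branch_inv hf] at this
      exact this hT'
    · exact hc.2 h
    · rw [← c.side_inv hR hf] at h
      have := hcons.up _ hes' _ ⟨_, hfi, rfl⟩ h
      rw [side_mem_sidesAt_iff c hR hv hfi, hT.mem_branch_inv hf] at this
      exact this hT'
  · rintro ⟨⟨f, hf, rfl⟩, h | h⟩
    · exact key' f hf h
    · exact hcons.up _ hes' _ ⟨f, hf, rfl⟩ h

/-- A vertex of `G` goes to the set of sides containing it. This is injective because distinct
vertices are separated by a tree edge, and surjective because every vertex of `blowUp` is the start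
of some half-edge, and starts correspond. On half-edges, petals are lifted, and a side determines
its tree edge by `side_injective`. -/
lemma exists_iso_blowUp (h0 : R.D) (hS : IsSideSystem R c.sides) :
    ∃ h : GraphIso (blowUp hS) G, c.comp h.toForestCollapse = blowUpCollapse hS hR h0 := by
  classical
  have hT := c.isSpanningTree hR
  let k : R.D ⊕ c.sides → G.D := Sum.elim c.lift fun U => U.2.choose
  have hkl : ∀ x, k (Sum.inl x) = c.lift x := fun _ => rfl
  have hk1 : ∀ U, k (Sum.inr U) ∈ c.forestSet := fun U => U.2.choose_spec.1
  have hk2 : ∀ U, c.side (k (Sum.inr U)) = U.1 := fun U => U.2.choose_spec.2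
  have hk3 : ∀ x, c.onD (k (Sum.inl x)) = some x := fun x => c.onD_lift x
  have hk4 : ∀ U, c.onD (k (Sum.inr U)) = none := fun U => hk1 U
  have hkbij : Function.Bijective k := by
    constructor
    · rintro (x | U) (y | W) h
      · have := hk3 x
        rw [h, hk3 y] at this
        rw [Option.some_injective _ this]
      · have := hk3 x
        rw [h, hk4 W] at this
        cases this
      · have := hk3 y
        rw [← h, hk4 U] at this
        cases this
      · have := hk2 U
        rw [h, hk2 W] at this
        rw [Subtype.ext this]
    · intro d
      rcases c.mem_forestSet_or d with hd | ⟨x, hd⟩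
      · refine ⟨Sum.inr ⟨c.side d, d, hd, rfl⟩, ?_⟩
        exact c.side_injective hR hv (hk1 _) hd (hk2 _)
      · exact ⟨Sum.inl x, c.lift_eq hd⟩
  have hloc : ∀ d, sidesAt c (G.src (k d)) = sideStart c.sides d := by
    rintro (x | U)
    · exact sidesAt_src_lift c x
    · have := sidesAt_src c hR hv (hk1 U)
      rw [hk2] at this
      exact this
  let m : G.V → (blowUp hS).V := fun v => ⟨sidesAt c v, isConsistent_sidesAt c hR hv v⟩
  have hmbij : Function.Bijective m := by
    constructor
    · intro u v h
      by_contra hne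
      obtain ⟨f, hf, hu, hvf⟩ := hT.exists_separating hne
      have h1 : c.side f ∈ sidesAt c v := (side_mem_sidesAt_iff c hR hv hf).2 hvf
      rw [← show sidesAt c u = sidesAt c v from congrArg Subtype.val h,
        side_mem_sidesAt_iff c hR hv hf, ← hu] at h1
      exact hT.src_notMem_branch hf h1
    · intro v
      obtain ⟨d, rfl⟩ := exists_src_eq_vertex hS h0 v
      exact ⟨G.src (k d), Subtype.ext (hloc d)⟩
  refine ⟨⟨(Equiv.ofBijective m hmbij).symm, Equiv.ofBijective k hkbij, fun d => ?_, ?_⟩, ?_⟩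
  · rw [Equiv.eq_symm_apply]
    exact Subtype.ext (hloc d)
  · rintro (x | U)
    · exact c.lift_inv x
    · refine c.side_injective hR hv (hk1 _) (hT.inv_mem (hk1 U)) ?_
      have h1 : c.side (G.inv (k (Sum.inr U))) = U.1ᶜ := by rw [c.side_inv hR (hk1 U), hk2]
      exact (hk2 _).trans h1.symm
  · refine ForestCollapse.eq_of_eq (funext fun v => hR _ _) (funext fun d => ?_)
    rcases d with x | U
    · exact hk3 x
    · exact hk4 U

end Recognition

lemma MarkedGraph.equivalent_blowUp {n : ℕ} {a ρ : MarkedGraph n} (hρ : ρ.IsRose)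
    (c : ForestCollapse a.G ρ.G) (hc : (c.toPathMap.comp a.g).Homotopic ρ.g)
    (hS : IsSideSystem ρ.G c.sides) : (ρ.blowUp hρ hS).Equivalent a := by
  obtain ⟨h, hh⟩ := exists_iso_blowUp c hρ.isOneVertex a.three_le_valence ρ.halfEdge hS
  refine ⟨h, ForestCollapse.homotopic_of_comp hh ?_⟩
  exact (ρ.ideal_comp_blowUp hρ hS).trans hc.symm

end OuterSpace

namespace OuterSpace

open FinGraph

/-! ## Homotopic collapses to a rose agree -/

namespace FinGraph

variable {G : FinGraph}

lemma Reduced.eq_of_pathHomotopic {l l' : List G.D} (h : G.Reduced l) (h' : G.Reduced l')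
    (hh : G.PathHomotopic l l') : l = l' := by
  classical
  obtain ⟨E, e, hi, he⟩ := G.exists_orientation
  have key : ∀ {l : List G.D}, G.Reduced l → FreeGroup.IsReduced (l.map e) := by
    intro l h
    refine (List.isChain_map e).2 (List.IsChain.imp (fun a b hab => ?_) h)
    intro h1
    by_contra h2
    refine hab (hi ?_)
    rw [he]
    refine Prod.ext h1.symm ?_
    revert h2
    cases (e a).2 <;> cases (e b).2 <;> simp
  have := FreeGroup.reduce.sound (hh.mk_map_eq he)
  rw [(key h).reduce_eq, (key h').reduce_eq] at this
  exact List.map_injective_iff.2 hi this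

open Classical in
/-- The number of times that `l` runs over `h`, counted with sign. -/
noncomputable def signedCount (h : G.D) (l : List G.D) : ℤ :=
  (l.map fun d => (if d = h then 1 else 0) - (if d = G.inv h then 1 else 0)).sum

lemma signedCount_append (h : G.D) (l l' : List G.D) :
    signedCount h (l ++ l') = signedCount h l + signedCount h l' := by
  simp [signedCount]

open Classical in
lemma PathHomotopic.signedCount_eq (h : G.D) {l l' : List G.D} (hh : G.PathHomotopic l l') :
    signedCount h l = signedCount h l' := by
  induction hh with
  | rel x y hxy =>
    obtain ⟨a, b, d⟩ := hxy
    have h1 : G.inv d = h ↔ d = G.inv h :=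
      ⟨fun h => by rw [← h, G.inv_inv], fun h => by rw [h, G.inv_inv]⟩
    have h2 : G.inv d = G.inv h ↔ d = h := inv_injective.eq_iff
    have h3 : signedCount h [d, G.inv d] = 0 := by
      simp only [signedCount, List.map_cons, List.map_nil, List.sum_cons, List.sum_nil]
      rw [if_congr h1 rfl rfl, if_congr h2 rfl rfl]
      ring
    rw [show a ++ d :: G.inv d :: b = a ++ ([d, G.inv d] ++ b) by simp, signedCount_append,
      signedCount_append, signedCount_append, h3, zero_add]
  | refl => rfl
  | symm _ _ _ ih => exact ih.symm
  | trans _ _ _ _ _ ih ih' => exact ih.trans ih'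

/-- The signed count of `h` is additive and invariant under homotopy, so conjugation does not change
it. -/
lemma FreelyHomotopic.eq_of_singleton {u v : G.V} {h h' : G.D}
    (hh : G.FreelyHomotopic u [h] v [h']) : h = h' := by
  obtain ⟨p, -, hp⟩ := hh
  have h1 := hp.signedCount_eq h
  rw [signedCount_append, signedCount_append, add_comm] at h1
  have h2 := add_left_cancel h1
  by_contra hne
  have h3 : h ≠ G.inv h := (G.inv_ne h).symm
  simp only [signedCount, List.map_cons, List.map_nil, List.sum_cons, List.sum_nil, if_true, h3,
    if_false, Ne.symm hne] at h2
  split_ifs at h2 <;> simp at h2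

lemma reduced_singleton (d : G.D) : G.Reduced [d] := List.IsChain.singleton d

end FinGraph

namespace ForestCollapse

variable {G R : FinGraph} (c : ForestCollapse G R)

lemma path_cons {d : G.D} {h : R.D} (hd : c.onD d = some h) (l : List G.D) :
    c.path (d :: l) = h :: c.path l := by
  simp [path, hd]

lemma path_cons_of_mem {d : G.D} (hd : d ∈ c.forestSet) (l : List G.D) :
    c.path (d :: l) = c.path l := by
  have hd' : c.onD d = none := hd
  simp [path, hd']

/-- Both images are cyclically reduced and freely homotopic, hence equally long. Through this
equality the homotopy constrains which edges are collapsed. -/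
lemma length_path_eq {c c' : ForestCollapse G R} (h : c.toPathMap.Homotopic c'.toPathMap)
    {u : G.V} {l : List G.D} (hw : G.IsWalk u l u) (hl : G.CycReduced l) :
    (c.path l).length = (c'.path l).length := by
  have h1 := h.freelyHomotopic hw
  rw [onPath_eq, onPath_eq] at h1
  exact le_antisymm ((c.path_cycReduced hw hl).length_le h1)
    ((c'.path_cycReduced hw hl).length_le h1.symm)

lemma path_pathHomotopic {l l' : List G.D} (h : G.PathHomotopic l l') :
    R.PathHomotopic (c.path l) (c.path l') := by
  rw [← onPath_eq, ← onPath_eq]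
  exact c.toPathMap.onPath_homotopic h

/-- Vertices that can be joined in the forest without crossing `f`. -/
def JoinedAvoiding (f : G.D) (u v : G.V) : Prop :=
  ∃ l, G.IsWalk u l v ∧ ∀ d ∈ l, d ∈ c.forestSet ∧ d ≠ f ∧ d ≠ G.inv f

variable {c}

lemma joinedAvoiding_of_mem {f : G.D} {u v : G.V} (hu : u ∈ branch c.forestSet f)
    (hv : v ∈ branch c.forestSet f) : c.JoinedAvoiding f u v := by
  obtain ⟨l, hw, hl⟩ := hu
  obtain ⟨m, hm, hm'⟩ := hv
  refine ⟨G.rev l ++ m, hw.rev.append hm, fun d hd => ?_⟩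
  rcases List.mem_append.1 hd with hd | hd
  · obtain ⟨h1, h2, h3⟩ := hl _ (mem_rev.1 hd)
    exact ⟨c.inv_mem_forestSet.1 h1, fun h => h3 (by rw [h]), fun h => h2 (by
      rw [h, G.inv_inv])⟩
  · exact hm' d hd

lemma JoinedAvoiding.of_inv {f : G.D} {u v : G.V} (h : c.JoinedAvoiding (G.inv f) u v) :
    c.JoinedAvoiding f u v := by
  obtain ⟨l, hw, hl⟩ := h
  refine ⟨l, hw, fun d hd => ?_⟩
  obtain ⟨h1, h2, h3⟩ := hl d hd
  exact ⟨h1, by rwa [G.inv_inv] at h3, h2⟩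

lemma exists_reduced_avoiding {f : G.D} (hf : f ∈ c.forestSet) {u v : G.V} {h : R.D}
    (hu : c.JoinedAvoiding f u (G.src (c.lift h))) (hv : c.JoinedAvoiding f (G.tgt (c.lift h)) v) :
    ∃ l, G.IsWalk u l v ∧ G.Reduced l ∧ f ∉ l ∧ G.inv f ∉ l ∧ c.path l = [h] := by
  obtain ⟨l, hl, hl'⟩ := hu
  obtain ⟨m, hm, hm'⟩ := hv
  obtain ⟨k, hk, hr, hh, hsub⟩ := FinGraph.exists_reduced
    (hl.append (show G.IsWalk (G.src (c.lift h)) (c.lift h :: m) v from ⟨rfl, hm⟩))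
  have havoid : ∀ d ∈ k, d ≠ f ∧ d ≠ G.inv f := by
    intro d hd
    rcases List.mem_append.1 (hsub d hd) with hd | hd
    · exact (hl' d hd).2
    · rcases List.mem_cons.1 hd with rfl | hd
      · constructor
        · intro h1
          rw [forestSet, Set.mem_ofPred_eq, ← h1, c.onD_lift] at hf
          cases hf
        · intro h1
          rw [← c.inv_mem_forestSet, forestSet, Set.mem_ofPred_eq, ← h1, c.onD_lift] at hf
          cases hf
      · exact (hm' d hd).2
  refine ⟨k, hk, hr, fun h => (havoid _ h).1 rfl, fun h => (havoid _ h).2 rfl, ?_⟩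
  refine (c.path_reduced hk hr).eq_of_pathHomotopic (reduced_singleton h) ?_
  have := c.path_pathHomotopic hh
  rw [c.path_append, c.path_cons (c.onD_lift h), c.path_eq_nil_iff.2 fun d hd => (hl' d hd).1,
    c.path_eq_nil_iff.2 fun d hd => (hm' d hd).1] at this
  exact this.symm

variable {c' : ForestCollapse G R}

/-- Close up `f` by a path `l` that returns over the petal `h` and otherwise through the tree,
avoiding `f`. Under `c` the loop has length one, and under `c'` the edge `f` alone accounts for this
length, so `c'` collapses all of `l`. -/
lemma exists_walk_of_crossing (hR : R.IsOneVertex) (hcc : c.toPathMap.Homotopic c'.toPathMap)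
    {f : G.D} (hf : f ∈ c.forestSet) (hf' : f ∉ c'.forestSet) {h : R.D} (hh : h ∈ c.side f)
    (hh' : R.inv h ∉ c.side f) :
    ∃ l, G.IsWalk (G.tgt f) l (G.src f) ∧ (∀ d ∈ l, d ∈ c'.forestSet) ∧ c.path l = [h] := by
  have hT := c.isSpanningTree hR
  obtain ⟨y, hy⟩ := (c'.mem_forestSet_or f).resolve_left hf'
  obtain ⟨l, hw, hr, hfl, hfl', hp⟩ := exists_reduced_avoiding hf (u := G.tgt f) (v := G.src f)
    (joinedAvoiding_of_mem (tgt_mem_branch _ f) hh) (JoinedAvoiding.of_inv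
      (joinedAvoiding_of_mem ((hT.mem_branch_inv hf).2 fun h1 => hh' (by
        rw [c.mem_side (c.onD_lift (R.inv h)), c.lift_inv]; exact h1))
        (by rw [← tgt_inv]; exact tgt_mem_branch _ _)))
  · refine ⟨l, hw, ?_, hp⟩
    have hcyc : G.CycReduced (f :: l) := by
      refine reduced_append.2 ⟨reduced_cons.2 ⟨fun e he => ?_, hr⟩,
        reduced_cons.2 ⟨fun e he => ?_, hr⟩, fun d hd e he => ?_⟩
      · rintro rfl; exact hfl' (List.mem_of_mem_head? he)
      · rintro rfl; exact hfl' (List.mem_of_mem_head? he)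
      · simp only [List.head?_cons, Option.mem_def, Option.some.injEq] at he
        subst he
        rintro h1
        have hd' := List.mem_of_mem_getLast? hd
        have hl : l ≠ [] := by rintro rfl; simp [path] at hp
        rw [List.getLast?_cons_of_ne_nil hl] at hd
        refine hfl' ?_
        rw [h1, G.inv_inv]
        exact List.mem_of_mem_getLast? hd
    have := length_path_eq hcc (u := G.src f) (l := f :: l) ⟨rfl, hw⟩ hcyc
    rw [c.path_cons_of_mem hf, hp, c'.path_cons hy] at this
    simp only [List.length_cons, List.length_nil] at this
    exact c'.path_eq_nil_iff.1 (List.eq_nil_of_length_eq_zero (by omega))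

/-- The return paths over `h` and `h'` lie in the forest of `c'` and have the same ends, so together
they form a null-homotopic loop. Its image under `c` is `h` followed by the inverse of `h'`, which
is null-homotopic only if `h = h'`. -/
lemma not_two_crossing (hR : R.IsOneVertex) (hcc : c.toPathMap.Homotopic c'.toPathMap)
    {f : G.D} (hf : f ∈ c.forestSet) (hf' : f ∉ c'.forestSet) {h h' : R.D} (hne : h ≠ h')
    (h1 : h ∈ c.side f) (h2 : R.inv h ∉ c.side f) (h3 : h' ∈ c.side f)
    (h4 : R.inv h' ∉ c.side f) : False := by
  obtain ⟨l, hw, hl, hp⟩ := exists_walk_of_crossing hR hcc hf hf' h1 h2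
  obtain ⟨l', hw', hl', hp'⟩ := exists_walk_of_crossing hR hcc hf hf' h3 h4
  have h5 := c'.isForest.pathHomotopic_nil (hw.append hw'.rev) fun d hd => by
    rcases List.mem_append.1 hd with hd | hd
    · exact hl d hd
    · exact c'.inv_mem_forestSet.1 (hl' _ (mem_rev.1 hd))
  have h6 := c.path_pathHomotopic h5
  have h7 : c.path (G.rev l') = [R.inv h'] := by
    rw [← c.onPath_eq, PathMap.onPath_rev, c.onPath_eq, hp']; rfl
  rw [c.path_append, hp, h7] at h6
  have h8 : R.Reduced ([h] ++ [R.inv h']) :=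
    reduced_cons.2 ⟨by simpa using fun h => hne (inv_injective h).symm, reduced_singleton _⟩
  simpa using h8.eq_nil_of_pathHomotopic h6

/-- With loops `l` and `m` at the two ends of `f`, the path `f`, `l`, `G.inv f`, `m` is cyclically
reduced. Its image has length two under `c`, but at least four under `c'`, which keeps `f` and
cannot collapse a non-empty reduced loop. -/
lemma not_two_loops (hR : R.IsOneVertex) (hcc : c.toPathMap.Homotopic c'.toPathMap)
    {f : G.D} (hf : f ∈ c.forestSet) (hf' : f ∉ c'.forestSet) {h h' : R.D}
    (h1 : h ∈ c.side f) (h2 : R.inv h ∈ c.side f) (h3 : h' ∉ c.side f)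
    (h4 : R.inv h' ∉ c.side f) : False := by
  have hT := c.isSpanningTree hR
  obtain ⟨y, hy⟩ := (c'.mem_forestSet_or f).resolve_left hf'
  have hsf : G.src f ∈ branch c.forestSet (G.inv f) := by
    rw [← tgt_inv]; exact tgt_mem_branch _ _
  rw [c.mem_side (d := G.inv (c.lift h)) (by rw [c.inv, c.onD_lift]; rfl)] at h2
  rw [c.mem_side (d := G.inv (c.lift h')) (by rw [c.inv, c.onD_lift]; rfl),
    ← hT.mem_branch_inv hf] at h4
  rw [c.mem_side (c.onD_lift h'), ← hT.mem_branch_inv hf] at h3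
  obtain ⟨l, hw, hr, hfl, hfl', hp⟩ := exists_reduced_avoiding hf (u := G.tgt f) (v := G.tgt f)
    (joinedAvoiding_of_mem (tgt_mem_branch _ f) h1)
    (joinedAvoiding_of_mem h2 (tgt_mem_branch _ f))
  obtain ⟨m, hm, hmr, hfm, hfm', hpm⟩ := exists_reduced_avoiding hf (u := G.src f)
    (v := G.src f) (joinedAvoiding_of_mem hsf h3).of_inv (joinedAvoiding_of_mem h4 hsf).of_inv
  have hl0 : l ≠ [] := by rintro rfl; simp [path] at hp
  have hm0 : m ≠ [] := by rintro rfl; simp [path] at hpm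
  have hrl : G.Reduced (f :: l) :=
    reduced_cons.2 ⟨by rintro e he rfl; exact hfl' (List.mem_of_mem_head? he), hr⟩
  have hrm : G.Reduced (G.inv f :: m) := reduced_cons.2 ⟨by
    rintro e he rfl; rw [G.inv_inv] at he; exact hfm (List.mem_of_mem_head? he), hmr⟩
  have hlast : ∀ {k : List G.D} {a e : G.D}, k ≠ [] → G.inv e ∉ k →
      ∀ d ∈ (a :: k).getLast?, e ≠ G.inv d := by
    rintro k a e hk he d hd rfl
    rw [List.getLast?_cons_of_ne_nil hk] at hd
    rw [G.inv_inv] at he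
    exact he (List.mem_of_mem_getLast? hd)
  have hrlm : G.Reduced ((f :: l) ++ (G.inv f :: m)) := reduced_append.2 ⟨hrl, hrm, by
    intro d hd e he
    simp only [List.head?_cons, Option.mem_def, Option.some.injEq] at he
    subst he
    exact hlast hl0 (by rwa [G.inv_inv]) d hd⟩
  have hcyc : G.CycReduced ((f :: l) ++ (G.inv f :: m)) := reduced_append.2 ⟨hrlm, hrlm, by
    intro d hd e he
    rw [List.getLast?_append_of_ne_nil _ (by simp)] at hd
    simp only [List.cons_append, List.head?_cons, Option.mem_def, Option.some.injEq] at he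
    subst he
    exact hlast hm0 hfm' d hd⟩
  have hwalk : G.IsWalk (G.src f) ((f :: l) ++ (G.inv f :: m)) (G.src f) :=
    IsWalk.append (v := G.tgt f) ⟨rfl, hw⟩ ⟨rfl, by rwa [tgt_inv]⟩
  have := length_path_eq hcc hwalk hcyc
  rw [c.path_append, c'.path_append, c.path_cons_of_mem hf,
    c.path_cons_of_mem (c.inv_mem_forestSet.2 hf), hp, hpm, c'.path_cons hy,
    c'.path_cons (h := R.inv y) (by rw [c'.inv, hy]; rfl)] at this
  have h5 : c'.path l ≠ [] := fun h => hl0 (c'.eq_nil_of_path_eq_nil hw hr h)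
  have h6 : c'.path m ≠ [] := fun h => hm0 (c'.eq_nil_of_path_eq_nil hm hmr h)
  have h7 := List.length_pos_of_ne_nil h5
  have h8 := List.length_pos_of_ne_nil h6
  simp only [List.length_append, List.length_cons, List.length_nil] at this
  omega

/-- A side of `f` contains two half-edges. By `not_two_crossing` they cannot both belong to petals
crossing `f`, so each side of `f` contains a whole petal, which `not_two_loops` excludes. -/
lemma forestSet_subset (hR : R.IsOneVertex) (hv : ∀ v, 3 ≤ G.valence v)
    (hcc : c.toPathMap.Homotopic c'.toPathMap) : c.forestSet ⊆ c'.forestSet := by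
  intro f hf
  by_contra hf'
  have key : ∀ f ∈ c.forestSet, f ∉ c'.forestSet →
      ∃ h ∈ c.side f, R.inv h ∈ c.side f := by
    intro f hf hf'
    obtain ⟨h, hh, h', hh', hne⟩ := c.side_nontrivial hR hv hf
    by_contra! hc
    exact not_two_crossing hR hcc hf hf' hne hh (hc h hh) hh' (hc h' hh')
  obtain ⟨h, h1, h2⟩ := key f hf hf'
  obtain ⟨h', h3, h4⟩ := key (G.inv f) (c.inv_mem_forestSet.2 hf)
    (fun h => hf' (c'.inv_mem_forestSet.1 h))
  rw [c.side_inv hR hf] at h3 h4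
  exact not_two_loops hR hcc hf hf' h1 h2 h3 h4

/-- Once the forests agree, close up an uncollapsed edge through the common tree; its two images are
freely homotopic single letters, hence equal. -/
lemma onD_eq_of_homotopic (hR : R.IsOneVertex) (hv : ∀ v, 3 ≤ G.valence v)
    (hcc : c.toPathMap.Homotopic c'.toPathMap) : c.onD = c'.onD := by
  have hF : c.forestSet = c'.forestSet :=
    subset_antisymm (forestSet_subset hR hv hcc) (forestSet_subset hR hv hcc.symm)
  funext d
  rcases c.mem_forestSet_or d with hd | ⟨h, hd⟩
  · have hd' : d ∈ c'.forestSet := hF ▸ hd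
    exact Eq.trans hd hd'.symm
  · have hd' : d ∉ c'.forestSet := by
      rw [← hF]; intro h'
      have : c.onD d = none := h'
      rw [hd] at this; cases this
    obtain ⟨h', hh'⟩ := (c'.mem_forestSet_or d).resolve_left hd'
    obtain ⟨l, hw, hl⟩ := (c.isSpanningTree hR).connected (G.tgt d) (G.src d)
    have h1 := hcc.freelyHomotopic (u := G.src d) (l := d :: l) ⟨rfl, hw⟩
    rw [onPath_eq, onPath_eq, c.path_cons hd, c'.path_cons hh', c.path_eq_nil_iff.2 hl,
      c'.path_eq_nil_iff.2 (hF ▸ hl)] at h1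
    rw [hd, hh', h1.eq_of_singleton]

end ForestCollapse

/-! ## The order on ideal trees -/

namespace MarkedGraph

variable {n : ℕ} {ρ : MarkedGraph n} (hρ : ρ.IsRose)

include hρ

/-- The collapse `q`, followed by the collapse to `ρ`, is homotopic to the direct collapse and so
agrees with it on half-edges. Hence `q` fixes every petal, and the tree edge of `T ∈ S` lifts to the
tree edge of some `U ∈ S'`. Both edges divide the petal ends in the same way, so `T = U`. -/
lemma subset_of_collapsesTo {S S' : Set (Set ρ.G.D)} (hS : IsSideSystem ρ.G S)
    (hS' : IsSideSystem ρ.G S') (h : (ρ.blowUp hρ hS').CollapsesTo (ρ.blowUp hρ hS)) :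
    S ⊆ S' := by
  obtain ⟨q', hq'⟩ := h
  let q : ForestCollapse (OuterSpace.blowUp hS') (OuterSpace.blowUp hS) := q'
  have hcc : ((ρ.ideal hρ hS).comp q).toPathMap.Homotopic (ρ.ideal hρ hS').toPathMap := by
    refine PathMap.IsHomotopyEquiv.of_comp_homotopic (ρ.blowUp hρ hS').isHomotopyEquiv ?_
    rw [ForestCollapse.comp_toPathMap]
    refine PathMap.Homotopic.trans ?_ (ρ.ideal_comp_blowUp hρ hS').symm
    refine PathMap.Homotopic.trans ?_ (ρ.ideal_comp_blowUp hρ hS)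
    exact (congrArg (fun k => PathMap.Homotopic k _) (PathMap.comp_assoc _ _ _)).mpr
      (PathMap.Homotopic.comp_left (ρ.ideal hρ hS).toPathMap hq')
  have honD := ForestCollapse.onD_eq_of_homotopic hρ.isOneVertex
    (ρ.blowUp hρ hS').three_le_valence hcc
  have hinl : ∀ h : ρ.G.D, q.onD (Sum.inl h) = some (Sum.inl h) := by
    intro h
    have h1 : (q.onD (Sum.inl h)).bind (ρ.ideal hρ hS).onD = some h := congrFun honD (Sum.inl h)
    obtain ⟨x, hx, hx'⟩ := Option.bind_eq_some_iff.1 h1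
    rw [hx]
    rcases x with x | U
    · exact congrArg (fun y => some (Sum.inl y)) (Option.some_injective _ hx')
    · cases hx'
  intro T hT
  have h1 := q.onD_lift (Sum.inr ⟨T, hT⟩)
  obtain ⟨U, hU⟩ : ∃ U : S', q.lift (Sum.inr ⟨T, hT⟩) = Sum.inr U := by
    rcases h2 : q.lift (Sum.inr ⟨T, hT⟩) with x | U
    · rw [h2] at h1
      have := (hinl x).symm.trans h1
      cases Option.some_injective _ this
    · exact ⟨U, rfl⟩
  rw [hU] at h1
  have hsrc : q.onV ((OuterSpace.blowUp hS').src (Sum.inr U)) =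
      (OuterSpace.blowUp hS).src (Sum.inr ⟨T, hT⟩) := (q.src _ _ h1).symm
  have htgt : q.onV ((OuterSpace.blowUp hS').tgt (Sum.inr U)) =
      (OuterSpace.blowUp hS).tgt (Sum.inr ⟨T, hT⟩) := by
    refine (q.src ((OuterSpace.blowUp hS').inv (Sum.inr U))
      ((OuterSpace.blowUp hS).inv (Sum.inr ⟨T, hT⟩)) ?_).symm
    exact (q.inv _).trans (congrArg (Option.map _) h1)
  -- Membership of `T` in the image vertex can change only across the edge that `q` sends to the
  -- edge of `T`, namely that of `U`.
  have hstep : ∀ W : S', W ≠ U → W.1 ≠ U.1ᶜ →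
      (T ∈ (q.onV ((OuterSpace.blowUp hS').src (Sum.inr W))).1 ↔
        T ∈ (q.onV ((OuterSpace.blowUp hS').tgt (Sum.inr W))).1) := by
    intro W hW hW'
    rcases h2 : q.onD (Sum.inr W) with _ | d
    · have : q.onV ((OuterSpace.blowUp hS').src (Sum.inr W)) =
          q.onV ((OuterSpace.blowUp hS').tgt (Sum.inr W)) :=
        (q.onV_eq_iff _ _).2 ⟨[Sum.inr W], isWalk_singleton _,
          fun d hd => (congrArg q.onD (List.mem_singleton.1 hd)).trans h2⟩
      rw [this]
    · have h3 := q.src _ _ h2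
      have h3' := q.src ((OuterSpace.blowUp hS').inv (Sum.inr W)) ((OuterSpace.blowUp hS).inv d)
        ((q.inv _).trans (congrArg (Option.map _) h2))
      rcases d with x | V
      · cases Sum.inr_ne_inl (q.onD_injective h2 (hinl x))
      · change (OuterSpace.blowUp hS).tgt (Sum.inr V) =
          q.onV ((OuterSpace.blowUp hS').tgt (Sum.inr W)) at h3'
        rw [← h3, ← h3']
        refine mem_src_iff_mem_tgt hS ?_ ?_
        · intro h4
          obtain rfl : V = ⟨T, hT⟩ := Subtype.ext h4
          exact hW (Sum.inr_injective (q.onD_injective h2 h1))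
        · intro h4
          have h5 : q.onD ((OuterSpace.blowUp hS').inv (Sum.inr U)) = some (Sum.inr V) := by
            refine ((q.inv _).trans (congrArg (Option.map _) h1)).trans
              (congrArg (fun y => some (Sum.inr y)) (Subtype.ext ?_))
            change Tᶜ = V.1
            rw [← h4, compl_compl]
          have h6 := Sum.inr_injective (q.onD_injective h2 h5)
          exact hW' (congrArg Subtype.val h6)
  have hwalk : ∀ (l : List (OuterSpace.blowUp hS').D) (v w : (OuterSpace.blowUp hS').V),
      (OuterSpace.blowUp hS').IsWalk v l w →
      (∀ d ∈ l, ∃ W : S', d = Sum.inr W ∧ W ≠ U ∧ W.1 ≠ U.1ᶜ) →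
      (T ∈ (q.onV v).1 ↔ T ∈ (q.onV w).1) := by
    intro l
    induction l with
    | nil => rintro v w rfl -; rfl
    | cons d l ih =>
      rintro v w ⟨rfl, hw⟩ hl
      obtain ⟨W, rfl, h2, h3⟩ := hl d (by simp)
      rw [hstep W h2 h3]
      exact ih _ _ hw fun d hd => hl d (List.mem_cons_of_mem _ hd)
  have hq : ∀ x, T ∈ (q.onV ((OuterSpace.blowUp hS').src (Sum.inl x))).1 ↔ x ∈ T := by
    intro x
    rw [← q.src _ _ (hinl x)]
    exact and_iff_right hT
  -- If `v` and the start of the petal end `x` are on the same side of `U`, the tree path joining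
  -- them does not cross `U`. Applied to the two ends of `U`, this compares `T` with `U` on every
  -- `x`.
  have hwalk' : ∀ (v : (OuterSpace.blowUp hS').V) (x : ρ.G.D), (U.1 ∈ v.1 ↔ x ∈ U.1) →
      (T ∈ (q.onV v).1 ↔ x ∈ T) := by
    intro v x hvx
    obtain ⟨l, hw, hl⟩ := exists_tree_walk hS' v ((OuterSpace.blowUp hS').src (Sum.inl x))
    rw [← hq]
    refine hwalk l _ _ hw fun d hd => ?_
    obtain ⟨W, rfl, hW⟩ := hl d hd
    have hx : x ∈ W.1 := hW.1.2
    refine ⟨W, rfl, ?_, ?_⟩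
    · rintro rfl
      exact hW.2 (hvx.2 hx)
    · intro h2
      rw [h2] at hx hW
      exact hx (hvx.1 (by_contra fun h3 => hW.2 ((compl_mem_vertex_iff hS' v U.2).2 h3)))
  have : T = U.1 := by
    ext x
    by_cases hx : x ∈ U.1
    · have := hwalk' ((OuterSpace.blowUp hS').tgt (Sum.inr U)) x (by simp [mem_tgt_inr, hx])
      rw [htgt] at this
      simp only [hx, iff_true]
      exact this.1 (mem_tgt_inr hS ⟨T, hT⟩)
    · have := hwalk' ((OuterSpace.blowUp hS').src (Sum.inr U)) x (by
        simp only [hx, iff_false]; exact notMem_src_inr hS' U)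
      rw [hsrc] at this
      simp only [hx, iff_false]
      exact fun h => notMem_src_inr hS ⟨T, hT⟩ (this.2 h)
  rw [this]
  exact U.2

end MarkedGraph

end OuterSpace

namespace OuterSpace

open FinGraph

/-! ## Exchanging edges of spanning trees -/

namespace FinGraph

variable {G : FinGraph}

lemma isForest_of_cut {F : Set G.D} (k : G.D → G.V → Prop)
    (h1 : ∀ d ∈ F, ¬ (k d (G.src d) ↔ k d (G.tgt d)))
    (h2 : ∀ d ∈ F, ∀ e ∈ F, e ≠ d → e ≠ G.inv d → (k d (G.src e) ↔ k d (G.tgt e))) :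
    G.IsForest F := by
  refine isForest_of_potential (fun d v => k d v ↔ k d (G.tgt d)) (fun d _ => Iff.rfl) h1 ?_
  intro d hd e he hed hed'
  rw [h2 d hd e he hed hed']

/-- Half-edges whose ends lie on different sides of the tree edge `f`. -/
def Separates (F : Set G.D) (f e : G.D) : Prop :=
  ¬ (G.src e ∈ branch F f ↔ G.tgt e ∈ branch F f)

lemma separates_inv {F : Set G.D} {f e : G.D} : Separates F f (G.inv e) ↔ Separates F f e := by
  rw [Separates, Separates, src_inv, tgt_inv]
  exact not_congr Iff.comm

lemma mem_branch_iff_of_isWalk {F : Set G.D} {f : G.D} {u v : G.V} {l : List G.D}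
    (hw : G.IsWalk u l v) (hl : ∀ d ∈ l, ¬ Separates F f d) :
    u ∈ branch F f ↔ v ∈ branch F f := by
  induction l generalizing u with
  | nil => cases hw; rfl
  | cons d l ih =>
    obtain ⟨rfl, hw⟩ := hw
    have h1 := hl d (by simp)
    rw [Separates, not_not] at h1
    rw [h1]
    exact ih hw fun d hd => hl d (List.mem_cons_of_mem _ hd)

/-- Replacing the edge `e` of a tree by `f`. -/
def exchange (F : Set G.D) (e f : G.D) : Set G.D :=
  {d | d ∈ F ∧ d ≠ e ∧ d ≠ G.inv e ∨ d = f ∨ d = G.inv f}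

namespace IsSpanningTree

variable {F : Set G.D} (hF : G.IsSpanningTree F)

include hF

lemma eq_or_eq_of_separates {f e : G.D} (he : e ∈ F) (h : Separates F f e) :
    e = f ∨ e = G.inv f := by
  by_contra! hc
  exact h (hF.src_mem_branch_iff he hc.1 hc.2)

lemma separates_self {f : G.D} (hf : f ∈ F) : Separates F f f := fun h =>
  hF.src_notMem_branch hf (h.2 (tgt_mem_branch F f))

lemma connected_avoiding {e : G.D} (he : e ∈ F) {u v : G.V}
    (h : u ∈ branch F e ↔ v ∈ branch F e) :
    ∃ l, G.IsWalk u l v ∧ ∀ d ∈ l, d ∈ F ∧ d ≠ e ∧ d ≠ G.inv e := by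
  have key : ∀ e ∈ F, u ∈ branch F e → v ∈ branch F e →
      ∃ l, G.IsWalk u l v ∧ ∀ d ∈ l, d ∈ F ∧ d ≠ e ∧ d ≠ G.inv e := by
    rintro e - ⟨l, hw, hl⟩ ⟨m, hm, hm'⟩
    refine ⟨G.rev l ++ m, hw.rev.append hm, fun d hd => ?_⟩
    rcases List.mem_append.1 hd with hd | hd
    · obtain ⟨h1, h2, h3⟩ := hl _ (mem_rev.1 hd)
      exact ⟨hF.inv_mem_iff.1 h1, fun h => h3 (by rw [h]), fun h => h2 (by rw [h, G.inv_inv])⟩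
    · exact hm' d hd
  by_cases hu : u ∈ branch F e
  · exact key e he hu (h.1 hu)
  · obtain ⟨l, hw, hl⟩ := key (G.inv e) (hF.inv_mem he) ((hF.mem_branch_inv he).2 hu)
      ((hF.mem_branch_inv he).2 fun hv => hu (h.2 hv))
    refine ⟨l, hw, fun d hd => ?_⟩
    obtain ⟨h1, h2, h3⟩ := hl d hd
    exact ⟨h1, by rwa [G.inv_inv] at h3, h2⟩

lemma exchange {e f : G.D} (he : e ∈ F) (hf : Separates F e f) :
    G.IsSpanningTree (exchange F e f) where
  inv_mem := by
    rintro d (⟨h1, h2, h3⟩ | rfl | rfl)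
    · exact Or.inl ⟨hF.inv_mem h1, fun h => h3 (by rw [← h, G.inv_inv]),
        fun h => h2 (inv_injective h)⟩
    · exact Or.inr (Or.inr rfl)
    · exact Or.inr (Or.inl (G.inv_inv _))
  isForest := by
    -- The new tree edge `f` gets the cut of `e`. Any other edge `d` keeps its own cut, changed by
    -- symmetric difference with the cut of `e` when `f` crosses it; after this correction `f` no
    -- longer does.
    refine isForest_of_cut (fun d v => ((d = f ∨ d = G.inv f) ∧ v ∈ branch F e) ∨
      (¬ (d = f ∨ d = G.inv f) ∧
        ¬ (v ∈ branch F d ↔ (Separates F d f ∧ v ∈ branch F e)))) ?_ ?_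
    · intro d hd
      by_cases hdf : d = f ∨ d = G.inv f
      · have : Separates F e d := by
          rcases hdf with rfl | rfl
          · exact hf
          · exact separates_inv.2 hf
        simp only [hdf, true_and, not_true, false_and, or_false]
        exact this
      · obtain ⟨h1, h2, h3⟩ := hd.resolve_right hdf
        have h4 := hF.separates_self h1
        have h5 := hF.src_mem_branch_iff (f := e) h1 h2 h3
        rw [Separates] at h4
        simp only [hdf, false_and, not_false_iff, true_and, false_or]
        tauto
    · intro d hd d' hd' hne hne'
      by_cases hdf : d = f ∨ d = G.inv f
      · have h1 : d' ∈ F ∧ d' ≠ e ∧ d' ≠ G.inv e := by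
          refine hd'.resolve_right fun h => ?_
          rcases hdf with rfl | rfl <;> rcases h with rfl | rfl
          · exact hne rfl
          · exact hne' rfl
          · exact hne' (G.inv_inv _).symm
          · exact hne rfl
        simp only [hdf, true_and, not_true, false_and, or_false]
        exact hF.src_mem_branch_iff h1.1 h1.2.1 h1.2.2
      · simp only [hdf, false_and, not_false_iff, true_and, false_or]
        obtain ⟨h1, h2, h3⟩ := hd.resolve_right hdf
        by_cases hdf' : d' = f ∨ d' = G.inv f
        · have h4 : Separates F d d' ↔ Separates F d f := by
            rcases hdf' with rfl | rfl
            · rfl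
            · exact separates_inv
          have h5 : Separates F e d' := by
            rcases hdf' with rfl | rfl
            · exact hf
            · exact separates_inv.2 hf
          rw [← h4]
          rw [Separates] at h5 ⊢
          tauto
        · obtain ⟨h4, h5, h6⟩ := hd'.resolve_right hdf'
          rw [hF.src_mem_branch_iff h4 hne hne', hF.src_mem_branch_iff (f := e) h4 h5 h6]
  connected u v := by
    by_cases h : u ∈ branch F e ↔ v ∈ branch F e
    · obtain ⟨l, hw, hl⟩ := hF.connected_avoiding he h
      exact ⟨l, hw, fun d hd => Or.inl (hl d hd)⟩
    -- If `u` and `v` are on different sides of `e`, the path crosses between them along `f`,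
    -- oriented to start on the side of `u`.
    · have key : ∀ g, (g = f ∨ g = G.inv f) → (u ∈ branch F e ↔ G.src g ∈ branch F e) →
          (G.tgt g ∈ branch F e ↔ v ∈ branch F e) →
          ∃ l, G.IsWalk u l v ∧ ∀ d ∈ l, d ∈ FinGraph.exchange F e f := by
        intro g hg h1 h2
        obtain ⟨l, hw, hl⟩ := hF.connected_avoiding he h1
        obtain ⟨m, hm, hm'⟩ := hF.connected_avoiding he h2
        refine ⟨l ++ g :: m, hw.append ⟨rfl, hm⟩, fun d hd => ?_⟩
        rcases List.mem_append.1 hd with hd | hd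
        · exact Or.inl (hl d hd)
        · rcases List.mem_cons.1 hd with rfl | hd
          · exact Or.inr hg
          · exact Or.inl (hm' d hd)
      rw [Separates] at hf
      by_cases h1 : u ∈ branch F e ↔ G.src f ∈ branch F e
      · exact key f (Or.inl rfl) h1 (by tauto)
      · exact key (G.inv f) (Or.inr rfl) (by rw [src_inv]; tauto) (by rw [tgt_inv]; tauto)

/-- The edges of a reduced path in a tree separate its ends. -/
lemma separates_of_reduced {u v : G.V} {l : List G.D} (hw : G.IsWalk u l v)
    (hl : ∀ d ∈ l, d ∈ F) (hr : G.Reduced l) {f : G.D} (hf : f ∈ l) :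
    ¬ (u ∈ branch F f ↔ v ∈ branch F f) := by
  obtain ⟨a, b, rfl⟩ := List.append_of_mem hf
  obtain ⟨w, ha, hb⟩ := isWalk_append_iff.1 hw
  obtain ⟨rfl, hb⟩ := hb
  have hv : v ∈ branch F f := hF.mem_branch_of_reduced
    (fun d hd => hl d (List.mem_append_right _ hd)) hr.append_right hb
  have hf' : f ∈ F := hl f (by simp)
  have hu : u ∈ branch F (G.inv f) := by
    refine hF.mem_branch_of_reduced (l := G.rev a) ?_ ?_ (by rw [tgt_inv]; exact ha.rev)
    · intro d hd
      rcases List.mem_cons.1 hd with rfl | hd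
      · exact hF.inv_mem hf'
      · exact hF.inv_mem_iff.1 (hl _ (List.mem_append_left _ (mem_rev.1 hd)))
    · have h1 : G.Reduced (a ++ [f]) := by
        have : a ++ f :: b = (a ++ [f]) ++ b := by simp
        rw [this] at hr
        exact hr.append_left
      have h2 : G.inv f :: G.rev a = G.rev (a ++ [f]) := by simp [rev]
      rw [h2]
      refine List.isChain_reverse.2 ((List.isChain_map _).2 (h1.imp fun x y hxy h => hxy ?_))
      rw [h, G.inv_inv]
  rw [hF.mem_branch_inv hf'] at hu
  exact fun h => hu (h.2 hv)

end IsSpanningTree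

/-! ### Weights of spanning trees: local optimality implies global optimality -/

section Weight

variable {M : Type*} [AddCommGroup M]

/-- The total weight of a set of half-edges. -/
noncomputable def weight (N : G.D → M) (F : Set G.D) : M := ∑ᶠ d ∈ F, N d

lemma weight_exchange {N : G.D → M} (hN : ∀ d, N (G.inv d) = N d) {F : Set G.D} {e f : G.D}
    (he : e ∈ F) (he' : G.inv e ∈ F) (hf : f ∉ F) (hf' : G.inv f ∉ F) :
    weight N (exchange F e f) + 2 • N e = weight N F + 2 • N f := by
  have := G.finite_D
  have h1 : ∀ d, weight N {d, G.inv d} = 2 • N d := by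
    intro d
    rw [weight, finsum_mem_pair (G.inv_ne d).symm, hN, two_nsmul]
  have h2 : exchange F e f = (F \ {e, G.inv e}) ∪ {f, G.inv f} := by
    ext d
    simp only [exchange, Set.mem_ofPred_eq, Set.mem_union, Set.mem_sdiff, Set.mem_insert_iff,
        Set.mem_singleton_iff, not_or]
  have h3 : weight N (exchange F e f) = weight N (F \ {e, G.inv e}) + 2 • N f := by
    rw [h2, ← h1 f]
    refine finsum_mem_union ?_ (Set.toFinite _) (Set.toFinite _)
    rw [Set.disjoint_right]
    rintro d (rfl | rfl) h
    · exact hf h.1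
    · exact hf' h.1
  have h4 : weight N (F \ {e, G.inv e}) + weight N {e, G.inv e} = weight N F := by
    rw [add_comm]
    refine finsum_mem_add_sdiff (fun d hd => ?_) (Set.toFinite _)
    rcases hd with rfl | rfl
    · exact he
    · exact he'
  rw [h1] at h4
  rw [h3, ← h4]
  abel

variable [LinearOrder M] [IsOrderedAddMonoid M]

/-- Basis exchange. An edge `e` of `F'` outside `F` is replaced by an edge `f` of `F` whose cut `e`
crosses; by local optimality of `F` the weight does not drop, and `F'` comes closer to `F`. -/
lemma IsSpanningTree.weight_le {N : G.D → M} (hN : ∀ d, N (G.inv d) = N d) (h0 : ∀ d, 0 ≤ N d)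
    {F : Set G.D} (hF : G.IsSpanningTree F)
    (hopt : ∀ f ∈ F, ∀ e, Separates F f e → N e ≤ N f) {F' : Set G.D}
    (hF' : G.IsSpanningTree F') : weight N F' ≤ weight N F := by
  have := G.finite_D
  induction hk : (F' \ F).ncard using Nat.strong_induction_on generalizing F' with
  | _ k ih =>
    by_cases hsub : F' ⊆ F
    · have : weight N F' + weight N (F \ F') = weight N F :=
        finsum_mem_add_sdiff hsub (Set.toFinite _)
      rw [← this]
      exact le_add_of_nonneg_right (
        finsum_mem_induction (fun x => 0 ≤ x) le_rfl (fun _ _ => add_nonneg) fun d _ => h0 d)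
    · obtain ⟨e, he, heF⟩ := Set.not_subset.1 hsub
      obtain ⟨l, hw, hl, hr⟩ := hF.exists_reduced (G.src e) (G.tgt e)
      -- The path in `F` between the ends of `e` must cross the cut of `e` in `F'`. Its edge `f`
      -- that does so is exchangeable in both trees.
      obtain ⟨f, hfl, hf⟩ : ∃ f ∈ l, Separates F' e f := by
        by_contra! hc
        exact hF'.separates_self he (mem_branch_iff_of_isWalk hw hc)
      have hfF : f ∈ F := hl f hfl
      have hfF' : f ∉ F' := fun h => by
        rcases hF'.eq_or_eq_of_separates h hf with rfl | rfl
        · exact heF hfF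
        · exact heF (hF.inv_mem_iff.1 hfF)
      have hef : N e ≤ N f := hopt f hfF e (hF.separates_of_reduced hw hl hr hfl)
      have h1 := weight_exchange hN he (hF'.inv_mem he) hfF'
        (fun h => hfF' (hF'.inv_mem_iff.1 h))
      have h2 : weight N F' ≤ weight N (FinGraph.exchange F' e f) := by
        have h3 : 2 • N e ≤ 2 • N f := nsmul_le_nsmul_right hef 2
        have h4 := add_le_add_right h3 (weight N F')
        rw [← h1] at h4
        exact le_of_add_le_add_right h4
      refine h2.trans (ih _ ?_ (hF'.exchange he hf) rfl)
      rw [← hk]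
      refine Set.ncard_lt_ncard ⟨?_, fun h => ?_⟩ (Set.toFinite _)
      · rintro d ⟨⟨h3, -, -⟩ | rfl | rfl, h4⟩
        · exact ⟨h3, h4⟩
        · exact absurd hfF h4
        · exact absurd (hF.inv_mem hfF) h4
      · rcases (h ⟨he, heF⟩).1 with ⟨-, h3, -⟩ | rfl | h3
        · exact h3 rfl
        · exact heF hfF
        · rw [h3] at heF
          exact heF (hF.inv_mem hfF)

end Weight

end FinGraph

end OuterSpace

namespace OuterSpace

open FinGraph

/-! ## Counting crossings -/

namespace FinGraph

variable {G : FinGraph}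

open Classical in
/-- The number of times that `l` crosses the edge of `d`. -/
noncomputable def crossings (d : G.D) (l : List G.D) : ℕ :=
  (l.map fun e => if e = d ∨ e = G.inv d then 1 else 0).sum

open Classical in
lemma crossings_inv (d : G.D) (l : List G.D) : crossings (G.inv d) l = crossings d l := by
  refine congrArg (fun f => (l.map f).sum) (funext fun e => if_congr ?_ rfl rfl)
  rw [G.inv_inv, or_comm]

lemma eq_inv_comm {d e : G.D} : d = G.inv e ↔ e = G.inv d :=
  ⟨fun h => by rw [h, G.inv_inv], fun h => by rw [h, G.inv_inv]⟩

open Classical in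
/-- Each edge of `l` that lies in `F` is counted for both of its orientations. -/
lemma finsum_crossings {F : Set G.D} (hF : ∀ d ∈ F, G.inv d ∈ F) (l : List G.D) :
    ∑ᶠ d ∈ F, crossings d l = 2 * l.countP (· ∈ F) := by
  have := G.finite_D
  induction l with
  | nil => simp [crossings]
  | cons e l ih =>
    have h1 : ∀ d, crossings d (e :: l) =
        (if e = d ∨ e = G.inv d then 1 else 0) + crossings d l := fun d => by simp [crossings]
    simp only [h1]
    rw [finsum_mem_add_distrib (Set.toFinite _), ih, List.countP_cons]
    have h2 : ∑ᶠ d ∈ F, (if e = d ∨ e = G.inv d then 1 else 0) = if e ∈ F then 2 else 0 := by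
      split_ifs with he
      · rw [show 2 = ∑ᶠ d ∈ ({e, G.inv e} : Set G.D), 1 by
            rw [finsum_mem_pair (G.inv_ne e).symm],
          ← finsum_mem_inter_support_eq' (f := fun d => if e = d ∨ e = G.inv d then 1 else 0)
            {e, G.inv e} F]
        · refine finsum_mem_congr rfl ?_
          rintro d (rfl | rfl) <;> simp [G.inv_inv]
        · intro d hd
          have hd' : e = d ∨ e = G.inv d := by
            by_contra hc
            exact hd (if_neg hc)
          rw [eq_inv_comm] at hd'
          constructor
          · rintro -
            rcases hd' with rfl | rfl
            · exact he
            · exact hF _ he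
          · rintro -
            rcases hd' with rfl | rfl <;> simp
      · refine finsum_mem_eq_zero_of_forall_eq_zero fun d hd => if_neg ?_
        rintro (rfl | rfl)
        · exact he hd
        · exact he (hF d hd)
    rw [h2]
    by_cases he : e ∈ F <;> simp [he]; omega

end FinGraph

namespace ForestCollapse

variable {G R : FinGraph} (c : ForestCollapse G R)

open Classical in
lemma length_path_add (l : List G.D) :
    (c.path l).length + l.countP (· ∈ c.forestSet) = l.length := by
  induction l with
  | nil => rfl
  | cons d l ih =>
    rcases c.mem_forestSet_or d with hd | ⟨h, hd⟩
    · rw [c.path_cons_of_mem hd, List.countP_cons_of_pos (by simpa using hd), List.length_cons]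
      omega
    · rw [c.path_cons hd, List.countP_cons_of_neg, List.length_cons, List.length_cons]
      · omega
      · simp [forestSet, hd]

open Classical in
lemma crossings_lift (h : R.D) (l : List G.D) :
    crossings (c.lift h) l = crossings h (c.path l) := by
  induction l with
  | nil => rfl
  | cons d l ih =>
    have h1 : ∀ k, d = c.lift k ↔ c.onD d = some k :=
      fun k => ⟨fun h => by rw [h, c.onD_lift], fun h => (c.lift_eq h).symm⟩
    have h2 : crossings (c.lift h) (d :: l) =
        (if c.onD d = some h ∨ c.onD d = some (R.inv h) then 1 else 0) +
          crossings (c.lift h) l := by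
      rw [crossings, List.map_cons, List.sum_cons]
      exact congrArg (· + _) (if_congr (by rw [← h1, ← h1, c.lift_inv]) rfl rfl)
    rw [h2, ih]
    rcases c.mem_forestSet_or d with hd | ⟨k, hd⟩
    · rw [c.path_cons_of_mem hd]
      have hd' : c.onD d = none := hd
      simp [hd']
    · rw [c.path_cons hd, hd]
      simp [crossings]

lemma exists_lift_path (hR : R.IsOneVertex) (w : List R.D) (u v : G.V) :
    ∃ l, G.IsWalk u l v ∧ c.path l = w := by
  induction w generalizing u with
  | nil =>
    obtain ⟨l, hw, hl⟩ := (c.isSpanningTree hR).connected u v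
    exact ⟨l, hw, c.path_eq_nil_iff.2 hl⟩
  | cons h w ih =>
    obtain ⟨l, hw, hl⟩ := (c.isSpanningTree hR).connected u (G.src (c.lift h))
    obtain ⟨m, hm, hm'⟩ := ih (G.tgt (c.lift h))
    refine ⟨l ++ c.lift h :: m, hw.append ⟨rfl, hm⟩, ?_⟩
    rw [c.path_append, c.path_eq_nil_iff.2 hl, c.path_cons (c.onD_lift h), hm', List.nil_append]

/-- A cyclically reduced word lifts to a cyclically reduced closed path that begins at the lift of
its first letter. -/
lemma exists_lift_cycReduced (hR : R.IsOneVertex) {h : R.D} {w : List R.D}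
    (hw : R.CycReduced (h :: w)) : ∃ l, G.IsWalk (G.src (c.lift h)) l (G.src (c.lift h)) ∧
      G.CycReduced l ∧ c.path l = h :: w := by
  obtain ⟨l', hl', hp'⟩ := c.exists_lift_path hR (h :: w) (G.src (c.lift h)) (G.src (c.lift h))
  obtain ⟨l, hl, hr, hh, -⟩ := exists_reduced hl'
  have hp : c.path l = h :: w := by
    rw [← hp']
    refine (c.path_reduced hl hr).eq_of_pathHomotopic ?_ (c.path_pathHomotopic hh).symm
    rw [hp']
    exact hw.reduced
  refine ⟨l, hl, reduced_append.2 ⟨hr, hr, ?_⟩, hp⟩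
  -- The collapsed initial part `t` ends at the start of the lift of `h`, where the path began, so
  -- it is a closed path in the forest and hence empty. A cancellation at the base point would then
  -- already occur in the cyclic word.
  obtain ⟨t, e, m, rfl, ht, he, hm⟩ := c.path_eq_cons hp
  obtain rfl := c.lift_eq he
  obtain ⟨v, hv, hv'⟩ := isWalk_append_iff.1 hl
  obtain rfl := c.isForest.eq_nil (hv'.1 ▸ hv) ht hr.append_left
  intro d hd e he' hed
  simp only [List.nil_append, List.head?_cons, Option.mem_def, Option.some.injEq] at he'
  subst he'
  obtain ⟨k, hk⟩ : ∃ k, [] ++ c.lift h :: m = k ++ [d] :=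
    ⟨_, (List.dropLast_append_getLast? d hd).symm⟩
  have hd' : c.onD d = some (R.inv h) := by
    rw [eq_inv_comm] at hed
    rw [hed, ← c.lift_inv, c.onD_lift]
  have h1 : h :: w = c.path k ++ [R.inv h] := by
    rw [← hp, hk, c.path_append, c.path_cons hd']; rfl
  refine (reduced_append.1 hw).2.2 (R.inv h) (by rw [h1]; simp) h (by simp) (R.inv_inv h).symm

end ForestCollapse

/-! ## Counting turns -/

open Classical in
/-- Whether two propositions disagree. -/
noncomputable def disagree (p q : Prop) : ℕ := if p ↔ q then 0 else 1

lemma disagree_not (p q : Prop) : disagree (¬ p) (¬ q) = disagree p q := by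
  by_cases hp : p <;> by_cases hq : q <;> simp [disagree, hp, hq]

/-- Submodularity of the cut function for a single turn; summed over all turns it gives
`turnCount_inter_add_union`. -/
lemma disagree_and_add_or (p q p' q' : Prop) :
    disagree (p ∧ p') (q ∧ q') + disagree (p ∨ p') (q ∨ q') ≤
      disagree p q + disagree p' q' := by
  by_cases hp : p <;> by_cases hq : q <;> by_cases hp' : p' <;> by_cases hq' : q' <;>
    simp [disagree, hp, hq, hp', hq']

variable {R : FinGraph}

/-- The number of turns of `w` between `A` and its complement, where `p` and `q` say whether the
ends of `w` are attached to `A`. -/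
noncomputable def turns (A : Set R.D) : Prop → List R.D → Prop → ℕ
  | p, [], q => disagree p q
  | p, h :: w, q => disagree p (h ∈ A) + turns A (R.inv h ∈ A) w q

/-- The number of turns of the cyclic word `w` between `A` and its complement. -/
noncomputable def turnCount (A : Set R.D) : List R.D → ℕ
  | [] => 0
  | h :: w => turns A (h ∈ A) (h :: w) (h ∈ A)

lemma turns_compl (A : Set R.D) (p q : Prop) (w : List R.D) :
    turns Aᶜ (¬ p) w (¬ q) = turns A p w q := by
  induction w generalizing p with
  | nil => exact disagree_not p q
  | cons h w ih => exact congrArg₂ _ (disagree_not _ _) (ih _)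

lemma turnCount_compl (A : Set R.D) (w : List R.D) : turnCount Aᶜ w = turnCount A w := by
  cases w with
  | nil => rfl
  | cons h w => exact turns_compl A _ _ _

lemma turns_inter_add_union (A B : Set R.D) (p q p' q' : Prop) (w : List R.D) :
    turns (A ∩ B) (p ∧ p') w (q ∧ q') + turns (A ∪ B) (p ∨ p') w (q ∨ q') ≤
      turns A p w q + turns B p' w q' := by
  induction w generalizing p p' with
  | nil => exact disagree_and_add_or p q p' q'
  | cons h w ih =>
    have h1 := disagree_and_add_or p (h ∈ A) p' (h ∈ B)
    have h2 := ih (R.inv h ∈ A) (R.inv h ∈ B)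
    change (disagree _ _ + turns (A ∩ B) _ w _) + (disagree _ _ + turns (A ∪ B) _ w _) ≤
      (disagree _ _ + turns A _ w _) + (disagree _ _ + turns B _ w _)
    simp only [Set.mem_inter_iff, Set.mem_union]
    omega

lemma turnCount_inter_add_union (A B : Set R.D) (w : List R.D) :
    turnCount (A ∩ B) w + turnCount (A ∪ B) w ≤ turnCount A w + turnCount B w := by
  cases w with
  | nil => exact le_rfl
  | cons h w => exact turns_inter_add_union A B _ _ _ _ _

-- A turn counts for `{m}` when exactly one of its two half-edges is `m`; both would be `m` only at
-- a backtrack. Each passage over the petal, in either direction, uses the half-edge `m` once. The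
-- hypotheses `hp`, `hq` and `h0` exclude double occurrences of `m` at the ends of the word.
open Classical in
lemma turns_singleton (m : R.D) {p q : Prop} {w : List R.D} (hw : R.Reduced w)
    (hp : p → w.head? ≠ some m) (hq : q → w.getLast? ≠ some (R.inv m)) (h0 : w = [] → ¬ (p ∧ q)) :
    turns {m} p w q = (if p then 1 else 0) + crossings m w + if q then 1 else 0 := by
  induction w generalizing p with
  | nil =>
    have := h0 rfl
    by_cases h1 : p <;> by_cases h2 : q <;> simp_all [turns, disagree, crossings]
  | cons h w ih =>
    obtain ⟨hh, hw⟩ := reduced_cons.1 hw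
    have h1 := ih (p := R.inv h = m) hw (fun h1 h2 => hh m h2 h1.symm) (fun h1 h2 => by
        refine hq h1 ?_
        rw [List.getLast?_cons, h2]; rfl) (by
        rintro rfl ⟨h1, h2⟩
        refine hq h2 ?_
        rw [← h1, R.inv_inv]; rfl)
    change disagree _ _ + turns {m} (R.inv h = m) w q = _
    rw [h1]
    have h2 : R.inv h = m ↔ h = R.inv m := by rw [eq_inv_comm, eq_comm]
    have h3 : disagree p (h ∈ ({m} : Set R.D)) =
        (if p then 1 else 0) + if h = m then 1 else 0 := by
      by_cases h3 : p
      · have := hp h3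
        simp only [List.head?_cons, ne_eq, Option.some.injEq] at this
        simp [disagree, h3, this]
      · by_cases h4 : h = m <;> simp [disagree, h3, h4]
    have h4 : crossings m (h :: w) =
        (if h = m then 1 else 0) + (if R.inv h = m then 1 else 0) + crossings m w := by
      simp only [crossings, List.map_cons, List.sum_cons, h2]
      congr 1
      by_cases h4 : h = m
      · have := R.inv_ne m
        simp [h4, this.symm]
      · simp [h4]
    rw [h3, h4]
    omega

lemma turnCount_singleton (m : R.D) {w : List R.D} (hw : R.CycReduced w) :
    turnCount {m} w = crossings m w := by
  classical
  cases w with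
  | nil => rfl
  | cons h w =>
    obtain ⟨hh, hw'⟩ := reduced_cons.1 hw.reduced
    have h1 := turns_singleton m (p := R.inv h = m) (q := h = m) hw'
      (fun h1 h2 => hh m h2 h1.symm) (fun h1 h2 => by
        refine (reduced_append.1 hw).2.2 (R.inv m) ?_ h (by simp) (by rw [R.inv_inv, h1])
        rw [List.getLast?_cons, h2]; rfl) (fun _ h1 => R.inv_ne h (h1.1.trans h1.2.symm))
    change disagree _ _ + turns {m} (R.inv h = m) w (h = m) = _
    have h2 : R.inv h = m ↔ h = R.inv m := by rw [eq_inv_comm, eq_comm]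
    rw [h1]
    simp only [crossings, List.map_cons, List.sum_cons, h2, disagree, iff_self, if_true]
    by_cases h4 : h = m
    · have := R.inv_ne m
      simp [h4, this.symm]; omega
    · simp [h4]

namespace ForestCollapse

variable {G : FinGraph} {c : ForestCollapse G R} (hR : R.IsOneVertex)

include hR

/-- Between consecutive petals the path runs through the tree without backtracking, so it crosses
`f` at most once there, and does so exactly when the two petal ends lie on different sides of `f`.
-/
lemma crossings_eq_turns {f : G.D} (hf : f ∈ c.forestSet) {u v : G.V} {l : List G.D}
    (hw : G.IsWalk u l v) (hr : G.Reduced l) : crossings f l =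
      turns (c.side f) (u ∈ branch c.forestSet f) (c.path l) (v ∈ branch c.forestSet f) := by
  classical
  have hT := c.isSpanningTree hR
  induction l generalizing u with
  | nil => cases hw; simp [crossings, path, turns, disagree]
  | cons d l ih =>
    obtain ⟨rfl, hw⟩ := hw
    have ih' := ih hw (reduced_cons.1 hr).2
    have h1 : crossings f (d :: l) = (if d = f ∨ d = G.inv f then 1 else 0) + crossings f l := by
      simp [crossings]
    rw [h1, ih']
    rcases c.mem_forestSet_or d with hd | ⟨h, hd⟩
    · rw [c.path_cons_of_mem hd]
      by_cases hdf : d = f ∨ d = G.inv f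
      · rw [if_pos hdf]
        -- After crossing `f` the reduced path stays on the far side until the next petal, so this
        -- turn receives no second crossing.
        have h2 : ∀ v ∈ branch c.forestSet d,
            (v ∈ branch c.forestSet f ↔ G.tgt d ∈ branch c.forestSet f) := by
          intro v hv
          have h3 := tgt_mem_branch c.forestSet d
          rcases hdf with rfl | rfl
          · exact iff_of_true hv h3
          · exact iff_of_false ((hT.mem_branch_inv hf).1 hv) ((hT.mem_branch_inv hf).1 h3)
        have h3 : ¬ (G.src d ∈ branch c.forestSet f ↔ G.tgt d ∈ branch c.forestSet f) := by
          rcases hdf with rfl | rfl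
          · exact hT.separates_self hf
          · exact separates_inv.2 (hT.separates_self hf)
        rcases h4 : c.path l with _ | ⟨h, w⟩
        · have h5 := h2 v (hT.mem_branch_of_reduced (fun e he => by
            rcases List.mem_cons.1 he with rfl | he
            · exact hd
            · exact c.path_eq_nil_iff.1 h4 e he) hr hw)
          simp only [turns, disagree, h5, iff_self, if_true, if_neg h3]
        · obtain ⟨t, e, m, rfl, ht, he, -⟩ := c.path_eq_cons h4
          obtain ⟨x, hx, hx'⟩ := isWalk_append_iff.1 hw
          have h5 := h2 x (hT.mem_branch_of_reduced (fun e he => by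
            rcases List.mem_cons.1 he with rfl | he
            · exact hd
            · exact ht e he) (by
              rw [← List.cons_append] at hr
              exact hr.append_left) hx)
          rw [← hx'.1, ← c.mem_side he] at h5
          simp only [turns, disagree, h5, iff_self, if_true, if_neg h3, zero_add]
      · rw [if_neg hdf, zero_add]
        push Not at hdf
        rw [hT.src_mem_branch_iff hd hdf.1 hdf.2]
    · rw [c.path_cons hd, if_neg, zero_add]
      · have h2 := c.mem_side (f := f) hd
        have h3 := c.mem_side (f := f) (d := G.inv d) (h := R.inv h) (by rw [c.inv, hd]; rfl)
        rw [src_inv] at h3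
        simp only [turns, disagree, h2, h3, iff_self, if_true, zero_add]
      · rintro (rfl | rfl)
        · have : c.onD d = none := hf
          rw [hd] at this; cases this
        · have : c.onD (G.inv f) = none := c.inv_mem_forestSet.2 hf
          rw [hd] at this; cases this

end ForestCollapse

end OuterSpace

namespace OuterSpace

open FinGraph

/-! ## The norm in terms of crossings -/

lemma FinGraph.isWalk_rose {n : ℕ} (l : List (FinGraph.rose n).D) :
    (FinGraph.rose n).IsWalk () l () := by
  induction l with
  | nil => rfl
  | cons d l ih => exact ⟨rfl, ih⟩

lemma ForestCollapse.freelyHomotopic_of_path {G R : FinGraph} (c : ForestCollapse G R) {u v : G.V}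
    {l l' : List G.D} (hw : G.IsWalk u l u) (hw' : G.IsWalk v l' v)
    (h : R.FreelyHomotopic (c.onV u) (c.path l) (c.onV v) (c.path l')) :
    G.FreelyHomotopic u l v l' := by
  obtain ⟨k, hk, -⟩ := c.isHomotopyEquiv
  have h1 := k.freelyHomotopic_onPath h
  rw [← c.onPath_eq, ← c.onPath_eq, ← PathMap.onPath_comp, ← PathMap.onPath_comp] at h1
  have h2 := hk.freelyHomotopic hw
  have h3 := hk.freelyHomotopic hw'
  rw [PathMap.onPath_id] at h2 h3
  exact h2.symm.trans (h1.trans h3)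

namespace MarkedGraph

variable {n : ℕ} (W : ClassList n)

/-- The image of a listed conjugacy class in a marked graph. -/
def loop (a : MarkedGraph n) (i : ℕ) : List a.G.D := a.g.onPath (W.w i).toWord

lemma loop_walk (a : MarkedGraph n) (i : ℕ) :
    a.G.IsWalk (a.g.onV ()) (a.loop W i) (a.g.onV ()) :=
  a.g.onPath_walk (isWalk_rose _)

lemma exists_loopWord (ρ : MarkedGraph n) (i : ℕ) : ∃ l v, ρ.G.IsWalk v l v ∧ ρ.G.CycReduced l ∧
    ρ.G.FreelyHomotopic (ρ.g.onV ()) (ρ.loop W i) v l := by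
  obtain ⟨v, l, h⟩ := exists_cycReduced (ρ.loop_walk W i)
  exact ⟨l, v, h⟩

/-- A cyclically reduced edge path that represents a listed conjugacy class. -/
noncomputable def loopWord (ρ : MarkedGraph n) (i : ℕ) : List ρ.G.D :=
  (ρ.exists_loopWord W i).choose

lemma cycReduced_loopWord (ρ : MarkedGraph n) (i : ℕ) : ρ.G.CycReduced (ρ.loopWord W i) :=
  (ρ.exists_loopWord W i).choose_spec.choose_spec.2.1

/-- A marked graph with a collapse to `ρ`, and closed paths that represent the listed conjugacy
classes. -/
structure Loops {ρ a : MarkedGraph n} (c : ForestCollapse a.G ρ.G) (γ : ℕ → List a.G.D) :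
    Prop where
  walk : ∀ i, ∃ v, a.G.IsWalk v (γ i) v ∧ a.G.FreelyHomotopic (a.g.onV ()) (a.loop W i) v (γ i)
  cycReduced : ∀ i, a.G.CycReduced (γ i)
  path_eq : ∀ i, c.path (γ i) = ρ.loopWord W i
  crossings_eq : ∀ f ∈ c.forestSet, ∀ i, crossings f (γ i) = turnCount (c.side f) (ρ.loopWord W i)

variable {W}

lemma freelyHomotopic_loop {a b : MarkedGraph n} {c : ForestCollapse a.G b.G}
    (hc : (c.toPathMap.comp a.g).Homotopic b.g) (i : ℕ) :
    b.G.FreelyHomotopic (b.g.onV ()) (b.loop W i) (c.onV (a.g.onV ())) (c.path (a.loop W i)) := by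
  have := hc.freelyHomotopic (isWalk_rose (W.w i).toWord)
  have h : (c.toPathMap.comp a.g).onPath (W.w i).toWord = c.path (a.loop W i) :=
    (PathMap.onPath_comp _ _ _).trans (c.onPath_eq _)
  exact Eq.mp (congrArg (b.G.FreelyHomotopic _ _ _) h) this.symm

lemma exists_loops {ρ a : MarkedGraph n} (hρ : ρ.IsRose) {c : ForestCollapse a.G ρ.G}
    (hc : (c.toPathMap.comp a.g).Homotopic ρ.g) : ∃ γ, Loops W c γ := by
  suffices H : ∀ i, ∃ l : List a.G.D,
      (∃ v, a.G.IsWalk v l v ∧ a.G.FreelyHomotopic (a.g.onV ()) (a.loop W i) v l) ∧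
      a.G.CycReduced l ∧ c.path l = ρ.loopWord W i ∧
      ∀ f ∈ c.forestSet, crossings f l = turnCount (c.side f) (ρ.loopWord W i) by
    choose γ h using H
    exact ⟨γ, fun i => (h i).1, fun i => (h i).2.1, fun i => (h i).2.2.1,
      fun f hf i => (h i).2.2.2 f hf⟩
  intro i
  have hR := hρ.isOneVertex
  have hcyc := ρ.cycReduced_loopWord W i
  obtain ⟨v, -, -, hv⟩ := (ρ.exists_loopWord W i).choose_spec
  change ρ.G.FreelyHomotopic _ _ v (ρ.loopWord W i) at hv
  have hv' := (freelyHomotopic_loop (W := W) hc i).symm.trans hv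
  rcases hw : ρ.loopWord W i with _ | ⟨h, w⟩
  -- An empty word has no first letter at whose lift a path could begin; the constant path is used
  -- instead.
  · rw [hw, hR v (c.onV (a.g.onV ()))] at hv'
    exact ⟨[], ⟨a.g.onV (), rfl, c.freelyHomotopic_of_path (a.loop_walk W i) rfl hv'⟩,
      List.IsChain.nil, rfl, fun f _ => rfl⟩
  · rw [hw] at hcyc
    obtain ⟨l, hl, hlc, hp⟩ := c.exists_lift_cycReduced hR hcyc
    refine ⟨l, ⟨_, hl, c.freelyHomotopic_of_path (a.loop_walk W i) hl ?_⟩, hlc, hp, ?_⟩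
    · rwa [hp, ← hw, hR (c.onV (a.G.src (c.lift h))) v]
    · intro f hf
      rw [ForestCollapse.crossings_eq_turns hR hf hl hlc.reduced, hp]
      rfl

/-- The numbers of crossings of the listed conjugacy classes with an edge. -/
noncomputable def edgeWeight {G : FinGraph} (γ : ℕ → List G.D) (d : G.D) : Lex (ℕ → ℤ) :=
  toLex fun i => (crossings d (γ i) : ℤ)

lemma edgeWeight_inv {G : FinGraph} (γ : ℕ → List G.D) (d : G.D) :
    edgeWeight γ (G.inv d) = edgeWeight γ d := by
  simp only [edgeWeight, crossings_inv]

lemma edgeWeight_nonneg {G : FinGraph} (γ : ℕ → List G.D) (d : G.D) : 0 ≤ edgeWeight γ d :=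
  Pi.toLex_monotone fun _ => Int.natCast_nonneg _

open Classical in
lemma weight_edgeWeight {G : FinGraph} (γ : ℕ → List G.D) {F : Set G.D}
    (hF : ∀ d ∈ F, G.inv d ∈ F) :
    weight (edgeWeight γ) F = toLex fun i => (2 * ((γ i).countP (· ∈ F) : ℤ)) := by
  have := G.finite_D
  funext i
  let ev : Lex (ℕ → ℤ) →+ ℤ := ⟨⟨fun f => ofLex f i, rfl⟩, fun _ _ => rfl⟩
  have h1 : ev (weight (edgeWeight γ) F) = ∑ᶠ d ∈ F, ev (edgeWeight γ d) :=
    ev.map_finsum_mem _ (Set.toFinite F)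
  have h2 := (Nat.castAddMonoidHom ℤ).map_finsum_mem (fun d => crossings d (γ i)) (Set.toFinite F)
  rw [finsum_crossings hF] at h2
  refine h1.trans (h2.symm.trans ?_)
  simp

/-- The image of `γ i` is cyclically reduced, so its length, that of `γ i` minus the number of
passages over the collapsed tree, is the loop length in `σ`. The factor two arises because `weight`
sums over both halves of each edge. -/
lemma Loops.two_nsmul_norm {ρ a σ : MarkedGraph n} {c : ForestCollapse a.G ρ.G}
    {γ : ℕ → List a.G.D} (h : Loops W c γ) {q : ForestCollapse a.G σ.G}
    (hq : (q.toPathMap.comp a.g).Homotopic σ.g) :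
    2 • σ.norm W + weight (edgeWeight γ) q.forestSet =
      toLex fun i => (2 * ((γ i).length : ℤ)) := by
  classical
  rw [weight_edgeWeight γ fun d => q.inv_mem_forestSet.2, two_nsmul]
  funext i
  obtain ⟨v, hv, hv'⟩ := h.walk i
  have h1 : σ.G.FreelyHomotopic (σ.g.onV ()) (σ.loop W i) (q.onV v) (q.path (γ i)) := by
    refine (freelyHomotopic_loop (W := W) hq i).trans ?_
    rw [← q.onPath_eq, ← q.onPath_eq]
    exact q.toPathMap.freelyHomotopic_onPath hv'
  have h2 : σ.G.loopLength (σ.g.onV ()) (σ.loop W i) = (q.path (γ i)).length :=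
    (q.path_cycReduced hv (h.cycReduced i)).loopLength_eq (q.path_walk hv) h1
  have h3 := q.length_path_add (γ i)
  have h4 : σ.norm W i = ((q.path (γ i)).length : ℤ) := congrArg Nat.cast h2
  change σ.norm W i + σ.norm W i + 2 * ((γ i).countP (· ∈ q.forestSet) : ℤ) =
    2 * ((γ i).length : ℤ)
  rw [h4, ← h3]
  push_cast
  ring

lemma Loops.two_nsmul_sub {ρ a σ : MarkedGraph n} {c : ForestCollapse a.G ρ.G}
    {γ : ℕ → List a.G.D} (h : Loops W c γ) (hc : (c.toPathMap.comp a.g).Homotopic ρ.g)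
    {q : ForestCollapse a.G σ.G} (hq : (q.toPathMap.comp a.g).Homotopic σ.g) :
    2 • (ρ.norm W - σ.norm W) =
      weight (edgeWeight γ) q.forestSet - weight (edgeWeight γ) c.forestSet := by
  have h1 := h.two_nsmul_norm hq
  rw [← h.two_nsmul_norm hc] at h1
  rw [nsmul_sub, sub_eq_sub_iff_add_eq_add, ← h1, add_comm]

end MarkedGraph

/-! ## Weights of half-edges and of sides -/

namespace MarkedGraph

variable {n : ℕ} (W : ClassList n) (ρ : MarkedGraph n)

/-- The numbers of passages of the listed conjugacy classes over a petal. -/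
noncomputable def petalWeight (h : ρ.G.D) : Lex (ℕ → ℤ) :=
  toLex fun i => (crossings h (ρ.loopWord W i) : ℤ)

/-- The numbers of turns of the listed conjugacy classes between a set of half-edges and its
complement. -/
noncomputable def sideWeight (A : Set ρ.G.D) : Lex (ℕ → ℤ) :=
  toLex fun i => (turnCount A (ρ.loopWord W i) : ℤ)

lemma petalWeight_inv (h : ρ.G.D) : ρ.petalWeight W (ρ.G.inv h) = ρ.petalWeight W h := by
  simp only [petalWeight, crossings_inv]

lemma sideWeight_compl (A : Set ρ.G.D) : ρ.sideWeight W Aᶜ = ρ.sideWeight W A := by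
  simp only [sideWeight, turnCount_compl]

lemma sideWeight_singleton (h : ρ.G.D) : ρ.sideWeight W {h} = ρ.petalWeight W h := by
  simp only [sideWeight, petalWeight, turnCount_singleton h (ρ.cycReduced_loopWord W _)]

lemma sideWeight_inter_add_union (A B : Set ρ.G.D) :
    ρ.sideWeight W (A ∩ B) + ρ.sideWeight W (A ∪ B) ≤ ρ.sideWeight W A + ρ.sideWeight W B :=
  Pi.toLex_monotone fun i => by
    have := turnCount_inter_add_union A B (ρ.loopWord W i)
    change (turnCount (A ∩ B) (ρ.loopWord W i) : ℤ) + turnCount (A ∪ B) (ρ.loopWord W i) ≤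
      turnCount A (ρ.loopWord W i) + turnCount B (ρ.loopWord W i)
    exact_mod_cast this

variable {W ρ} (hρ : ρ.IsRose) {S : Set (Set ρ.G.D)} (hS : IsSideSystem ρ.G S)

lemma mem_forestSet_ideal {d : (OuterSpace.blowUp hS).D} :
    d ∈ (ρ.ideal hρ hS).forestSet ↔ ∃ U : S, d = Sum.inr U := by
  rcases d with h | U
  · constructor
    · intro h1
      change some h = none at h1
      cases h1
    · rintro ⟨U, hU⟩
      cases hU
  · exact ⟨fun _ => ⟨U, rfl⟩, fun _ => rfl⟩

lemma onD_ideal_inl (h : ρ.G.D) : (ρ.ideal hρ hS).onD (Sum.inl h) = some h := rfl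

lemma lift_ideal (h : ρ.G.D) : (ρ.ideal hρ hS).lift h = Sum.inl h :=
  ForestCollapse.lift_eq _ rfl

lemma mem_branch_ideal (U : S) (v : (OuterSpace.blowUp hS).V) :
    v ∈ branch (ρ.ideal hρ hS).forestSet (Sum.inr U : (OuterSpace.blowUp hS).D) ↔ U.1 ∈ v.1 := by
  have hT := (ρ.ideal hρ hS).isSpanningTree hρ.isOneVertex
  have key : ∀ U : S, ∀ v ∈ branch (ρ.ideal hρ hS).forestSet
      (Sum.inr U : (OuterSpace.blowUp hS).D), U.1 ∈ v.1 := by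
    rintro U v ⟨l, hw, hl⟩
    suffices H : ∀ (l : List (OuterSpace.blowUp hS).D) (u : (OuterSpace.blowUp hS).V),
        (OuterSpace.blowUp hS).IsWalk u l v → (∀ d ∈ l, d ∈ (ρ.ideal hρ hS).forestSet ∧
          d ≠ Sum.inr U ∧ d ≠ (OuterSpace.blowUp hS).inv (Sum.inr U)) → U.1 ∈ u.1 →
        U.1 ∈ v.1 from H l _ hw hl (mem_tgt_inr hS U)
    intro l
    induction l with
    | nil => rintro u rfl - h; exact h
    | cons d l ih =>
      rintro u ⟨rfl, hw⟩ hl hu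
      obtain ⟨h1, h2, h3⟩ := hl d (by simp)
      obtain ⟨T, rfl⟩ := (mem_forestSet_ideal hρ hS).1 h1
      refine ih _ hw (fun d hd => hl d (List.mem_cons_of_mem _ hd)) ?_
      refine (mem_src_iff_mem_tgt hS ?_ ?_).1 hu
      · exact fun h => h2 (congrArg Sum.inr (Subtype.ext h))
      · refine fun h => h3 (congrArg Sum.inr (Subtype.ext ?_))
        change T.1 = U.1ᶜ
        rw [← h, compl_compl]
  refine ⟨key U v, fun h => by_contra fun h1 => ?_⟩
  have hU : (Sum.inr U : (OuterSpace.blowUp hS).D) ∈ (ρ.ideal hρ hS).forestSet := rfl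
  have h2 : U.1ᶜ ∈ v.1 :=
    key ⟨U.1ᶜ, hS.compl_mem _ U.2⟩ v ((hT.mem_branch_inv hU).2 h1)
  exact (compl_mem_vertex_iff hS v U.2).1 h2 h

lemma side_ideal (U : S) : (ρ.ideal hρ hS).side (Sum.inr U : (OuterSpace.blowUp hS).D) = U.1 := by
  ext x
  refine (ForestCollapse.mem_side _ (onD_ideal_inl hρ hS x)).trans
    ((mem_branch_ideal hρ hS U _).trans (and_iff_right U.2))

lemma edgeWeight_inl {γ : ℕ → List (ρ.blowUp hρ hS).G.D} (hγ : Loops W (ρ.ideal hρ hS) γ)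
    (h : ρ.G.D) : edgeWeight γ (Sum.inl h : (OuterSpace.blowUp hS).D) = ρ.petalWeight W h := by
  refine congrArg toLex (funext fun i => congrArg Nat.cast ?_)
  exact (congrArg (fun d => crossings d (γ i)) (lift_ideal hρ hS h)).symm.trans
    (((ρ.ideal hρ hS).crossings_lift h (γ i)).trans (congrArg (crossings h) (hγ.path_eq i)))

lemma edgeWeight_inr {γ : ℕ → List (ρ.blowUp hρ hS).G.D} (hγ : Loops W (ρ.ideal hρ hS) γ)
    (U : S) : edgeWeight γ (Sum.inr U : (OuterSpace.blowUp hS).D) = ρ.sideWeight W U.1 := by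
  refine congrArg toLex (funext fun i => congrArg Nat.cast ?_)
  exact (hγ.crossings_eq _ rfl i).trans
    (congrArg (fun A => turnCount A _) (side_ideal hρ hS U))

/-- A half-edge and a side such that one of the ends of the petal lies on the side. -/
def Splits (A : Set ρ.G.D) (h : ρ.G.D) : Prop := ¬ (h ∈ A ↔ ρ.G.inv h ∈ A)

lemma separates_inl {U : S} {h : ρ.G.D} :
    Separates (ρ.ideal hρ hS).forestSet (Sum.inr U : (OuterSpace.blowUp hS).D) (Sum.inl h) ↔
      Splits U.1 h := by
  refine not_congr (iff_congr ?_ ?_)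
  · exact (mem_branch_ideal hρ hS U _).trans (and_iff_right U.2)
  · exact (mem_branch_ideal hρ hS U _).trans (and_iff_right U.2)

/-- A rose of smaller norm comes from a tree heavier than the ideal tree. By
`IsSpanningTree.weight_le` the ideal tree then fails to be locally optimal, and the improving edge
must be a petal, since a tree edge crosses only its own cut. -/
lemma exists_reductive_side {σ : MarkedGraph n} (hσ : σ.IsRose)
    (h : (ρ.blowUp hρ hS).CollapsesTo σ) (hlt : σ.norm W < ρ.norm W) :
    ∃ A ∈ S, ∃ h, Splits A h ∧ ρ.sideWeight W A < ρ.petalWeight W h := by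
  obtain ⟨q, hq⟩ := h
  obtain ⟨γ, hγ⟩ := exists_loops (W := W) (a := ρ.blowUp hρ hS) hρ
    (ρ.ideal_comp_blowUp hρ hS)
  have h1 := hγ.two_nsmul_sub (ρ.ideal_comp_blowUp hρ hS) hq
  have h2 : weight (edgeWeight γ) (ρ.ideal hρ hS).forestSet <
      weight (edgeWeight γ) q.forestSet := by
    rw [two_nsmul] at h1
    exact sub_pos.1 (lt_of_lt_of_eq (add_pos (sub_pos.2 hlt) (sub_pos.2 hlt)) h1)
  by_contra! hc
  refine absurd (IsSpanningTree.weight_le (edgeWeight_inv γ) (edgeWeight_nonneg γ)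
    ((ρ.ideal hρ hS).isSpanningTree hρ.isOneVertex) ?_
    (q.isSpanningTree hσ.isOneVertex)) (not_le.2 h2)
  intro f hf e he
  obtain ⟨U, rfl⟩ := (mem_forestSet_ideal hρ hS).1 hf
  rcases e with e | e
  · have h3 := hc U.1 U.2 e ((separates_inl hρ hS).1 he)
    rw [← edgeWeight_inl hρ hS hγ, ← edgeWeight_inr hρ hS hγ] at h3
    exact not_lt.1 h3
  · have h3 := ((ρ.ideal hρ hS).isSpanningTree hρ.isOneVertex).eq_or_eq_of_separates
      ((mem_forestSet_ideal hρ hS).2 ⟨e, rfl⟩) he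
    rcases h3 with h3 | h3
    · exact (congrArg (edgeWeight γ) h3).le
    · exact ((congrArg (edgeWeight γ) h3).trans (edgeWeight_inv γ _)).le

end MarkedGraph

end OuterSpace

namespace OuterSpace

open FinGraph

/-! ## Quotients by maximal trees -/

namespace FinGraph.IsSpanningTree

variable {G : FinGraph} {F : Set G.D}

lemma eq_of_subset (hF : G.IsSpanningTree F) {F' : Set G.D} (hF' : G.IsSpanningTree F')
    (h : F ⊆ F') : F = F' := by
  refine subset_antisymm h fun d hd => by_contra fun hdF => ?_
  obtain ⟨l, hw, hl, hr⟩ := hF.exists_reduced (G.tgt d) (G.src d)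
  have := hF'.isForest.eq_nil (v := G.src d) (l := d :: l) ⟨rfl, hw⟩ (fun e he => by
    rcases List.mem_cons.1 he with rfl | he
    · exact hd
    · exact h (hl e he)) (reduced_cons.2 ⟨fun e he hed => hdF ?_, hr⟩)
  · cases this
  · rw [← hF.inv_mem_iff, ← hed]
    exact hl e (List.mem_of_mem_head? he)

/-- The rose obtained by shrinking a maximal tree. -/
def quotient (hF : G.IsSpanningTree F) : FinGraph where
  V := Unit
  D := (Fᶜ : Set G.D)
  src _ := ()
  inv d := ⟨G.inv d.1, fun h => d.2 (hF.inv_mem_iff.1 h)⟩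
  inv_inv _ := Subtype.ext (G.inv_inv _)
  inv_ne d h := G.inv_ne d.1 (congrArg Subtype.val h)
  finite_V := inferInstance
  finite_D := have := G.finite_D; inferInstance

open Classical in
/-- The collapse of a maximal tree. -/
noncomputable def collapse (hF : G.IsSpanningTree F) [Nonempty G.V] :
    ForestCollapse G hF.quotient where
  onV _ := ()
  onD d := if h : d ∈ F then none else some ⟨d, h⟩
  inv d := by
    by_cases h : d ∈ F
    · rw [dif_pos h, dif_pos (hF.inv_mem h)]; rfl
    · rw [dif_neg h, dif_neg fun h' => h (hF.inv_mem_iff.1 h')]; rfl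
  src _ _ _ := rfl
  forest := by
    convert hF.isForest using 1
    ext d
    by_cases h : d ∈ F <;> simp [h]
  onV_surjective _ := ⟨Classical.arbitrary _, rfl⟩
  onV_eq_iff u v := by
    refine iff_of_true rfl ?_
    obtain ⟨l, hw, hl⟩ := hF.connected u v
    exact ⟨l, hw, fun d hd => dif_pos (hl d hd)⟩
  onD_bijective d := by
    refine ⟨d.1, dif_neg d.2, fun e he => ?_⟩
    replace he : (if h : e ∈ F then none else some ⟨e, h⟩ : Option hF.quotient.D) = some d := he
    by_cases h : e ∈ F
    · rw [dif_pos h] at he; cases he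
    · rw [dif_neg h] at he
      exact congrArg Subtype.val (Option.some.inj he)

lemma forestSet_collapse (hF : G.IsSpanningTree F) [Nonempty G.V] :
    hF.collapse.forestSet = F := by
  ext d
  by_cases h : d ∈ F <;> simp [ForestCollapse.forestSet, collapse, h]

lemma exists_separates (hF : G.IsSpanningTree F) {F' : Set G.D} (hF' : G.IsSpanningTree F')
    {f : G.D} (hf : f ∈ F) : ∃ e ∈ F', Separates F f e := by
  obtain ⟨l, hw, hl⟩ := hF'.connected (G.src f) (G.tgt f)
  by_contra! hc
  exact hF.separates_self hf (mem_branch_iff_of_isWalk hw fun d hd => hc d (hl d hd))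

end FinGraph.IsSpanningTree

/-! ## Roses adjacent to an ideal edge -/

section Pair

variable {R : FinGraph} {A : Set R.D}

lemma isSideSystem_pair (hA : IsIdealSide R A) : IsSideSystem R {A, Aᶜ} where
  ideal := by
    rintro B (rfl | rfl)
    · exact hA
    · exact hA.compl
  compl_mem := by
    rintro B (rfl | rfl)
    · exact Or.inr rfl
    · exact Or.inl (compl_compl A)
  nested := by
    rintro B (rfl | rfl) C (rfl | rfl)
    · exact Or.inl subset_rfl
    · exact Or.inr (Or.inl (by rw [compl_compl]))
    · exact Or.inr (Or.inl subset_rfl)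
    · exact Or.inl subset_rfl

end Pair

namespace MarkedGraph

variable {n : ℕ} {W : ClassList n} {ρ : MarkedGraph n} (hρ : ρ.IsRose) {A : Set ρ.G.D}
  (hA : IsIdealSide ρ.G A)

/-- The ideal edge with side `A`, as a tree edge. -/
def treeEdge : (OuterSpace.blowUp (isSideSystem_pair hA)).D := Sum.inr ⟨A, Or.inl rfl⟩

lemma mem_forestSet_pair {d : (OuterSpace.blowUp (isSideSystem_pair hA)).D} :
    d ∈ (ρ.ideal hρ (isSideSystem_pair hA)).forestSet ↔
      d = treeEdge hA ∨ d = (OuterSpace.blowUp (isSideSystem_pair hA)).inv (treeEdge hA) := by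
  rw [mem_forestSet_ideal]
  constructor
  · rintro ⟨⟨U, hU⟩, rfl⟩
    rcases hU with rfl | rfl
    · exact Or.inl rfl
    · exact Or.inr rfl
  · rintro (rfl | rfl)
    · exact ⟨_, rfl⟩
    · exact ⟨_, rfl⟩

lemma exchange_pair (e : (OuterSpace.blowUp (isSideSystem_pair hA)).D) :
    exchange (ρ.ideal hρ (isSideSystem_pair hA)).forestSet (treeEdge hA) e =
      {e, (OuterSpace.blowUp (isSideSystem_pair hA)).inv e} := by
  ext d
  have h := mem_forestSet_pair hρ hA (d := d)
  change (d ∈ _ ∧ d ≠ treeEdge hA ∧ d ≠ (OuterSpace.blowUp _).inv (treeEdge hA) ∨ d = e ∨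
    d = (OuterSpace.blowUp _).inv e) ↔ (d = e ∨ d = (OuterSpace.blowUp _).inv e)
  rw [h]
  tauto

/-- The norm decreases by the difference of the weights of a petal and of a side when the
corresponding edges are exchanged. -/
lemma norm_sub_eq {σ : MarkedGraph n} {h : ρ.G.D}
    {q : ForestCollapse (ρ.blowUp hρ (isSideSystem_pair hA)).G σ.G}
    (hq : (q.toPathMap.comp (ρ.blowUp hρ (isSideSystem_pair hA)).g).Homotopic σ.g)
    (hF : q.forestSet = exchange (ρ.ideal hρ (isSideSystem_pair hA)).forestSet (treeEdge hA)
      (Sum.inl h)) :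
    ρ.norm W - σ.norm W = ρ.petalWeight W h - ρ.sideWeight W A := by
  have hS := isSideSystem_pair hA
  obtain ⟨γ, hγ⟩ := exists_loops (W := W) (a := ρ.blowUp hρ hS) hρ (ρ.ideal_comp_blowUp hρ hS)
  have h1 := hγ.two_nsmul_sub (ρ.ideal_comp_blowUp hρ hS) hq
  have h2 := weight_exchange (N := edgeWeight γ) (edgeWeight_inv γ)
    (F := (ρ.ideal hρ hS).forestSet) (e := treeEdge hA) (f := Sum.inl h)
    ((mem_forestSet_pair hρ hA).2 (Or.inl rfl)) ((mem_forestSet_pair hρ hA).2 (Or.inr rfl))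
    (fun h => by
      obtain ⟨U, hU⟩ := (mem_forestSet_ideal hρ hS).1 h
      cases hU) (fun h => by
      obtain ⟨U, hU⟩ := (mem_forestSet_ideal hρ hS).1 h
      cases hU)
  have h3 : edgeWeight γ (treeEdge hA) = ρ.sideWeight W A := edgeWeight_inr hρ hS hγ _
  have h4 := edgeWeight_inl hρ hS hγ h
  rw [h3] at h2
  have h5 : 2 • (ρ.norm W - σ.norm W) = 2 • (ρ.petalWeight W h - ρ.sideWeight W A) := by
    rw [h1, nsmul_sub, sub_eq_sub_iff_add_eq_add, add_comm (2 • _), ← h4]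
    exact (congrArg (fun F => weight (edgeWeight γ) F + _) hF).trans
      h2
  exact nsmul_right_injective (two_ne_zero) h5

/-- The maximal trees of a two-vertex graph are single edges, so `q` collapses either the ideal edge
itself, with zero gain, or one petal split by `A`. -/
lemma exists_petal {σ : MarkedGraph n} (hσ : σ.IsRose)
    (h : (ρ.blowUp hρ (isSideSystem_pair hA)).CollapsesTo σ) (h0 : 0 < ρ.norm W - σ.norm W) :
    ∃ h, Splits A h ∧ ρ.norm W - σ.norm W = ρ.petalWeight W h - ρ.sideWeight W A := by
  obtain ⟨q, hq⟩ := h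
  have hS := isSideSystem_pair hA
  have hT := (ρ.ideal hρ hS).isSpanningTree hρ.isOneVertex
  have hT' := q.isSpanningTree hσ.isOneVertex
  have hmem := (mem_forestSet_pair hρ hA).2 (Or.inl rfl)
  obtain ⟨e, he, hs⟩ := hT.exists_separates hT' hmem
  have hF : exchange (ρ.ideal hρ hS).forestSet (treeEdge hA) e = q.forestSet := by
    refine (hT.exchange hmem hs).eq_of_subset hT' ?_
    rw [exchange_pair]
    rintro d (rfl | rfl)
    · exact he
    · exact hT'.inv_mem he
  rcases e with x | U
  · exact ⟨x, (separates_inl hρ hS).1 hs, norm_sub_eq hρ hA hq hF.symm⟩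
  · exfalso
    have h1 : q.forestSet = (ρ.ideal hρ hS).forestSet := by
      refine ((hT.eq_of_subset hT' fun d hd => ?_)).symm
      rw [← hF]
      refine (Set.ext_iff.1 (exchange_pair hρ hA (Sum.inr U)) d).2 ?_
      have h2 := (mem_forestSet_pair hρ hA).1 hd
      rcases (mem_forestSet_pair hρ hA).1 ((mem_forestSet_ideal hρ hS).2 ⟨U, rfl⟩) with h3 | h3
      · exact h2.imp (fun h => h.trans h3.symm) fun h => h.trans (congrArg _ h3.symm)
      · exact h2.symm.imp (fun h => h.trans h3.symm) fun h =>
          h.trans (((OuterSpace.blowUp hS).inv_inv _).symm.trans (congrArg _ h3.symm))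
    obtain ⟨γ, hγ⟩ := exists_loops (W := W) (a := ρ.blowUp hρ hS) hρ (ρ.ideal_comp_blowUp hρ hS)
    have h2 := hγ.two_nsmul_sub (ρ.ideal_comp_blowUp hρ hS) hq
    have h3 : 2 • (ρ.norm W - σ.norm W) = 0 :=
      h2.trans (sub_eq_zero.2 (congrArg (weight (edgeWeight γ)) h1))
    rw [two_nsmul] at h3
    exact (add_pos h0 h0).ne' h3

lemma exists_rose {h : ρ.G.D} (hh : Splits A h) : ∃ σ : MarkedGraph n, σ.IsRose ∧
    (ρ.blowUp hρ (isSideSystem_pair hA)).CollapsesTo σ ∧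
    ρ.norm W - σ.norm W = ρ.petalWeight W h - ρ.sideWeight W A := by
  have hS := isSideSystem_pair hA
  have hT := (ρ.ideal hρ hS).isSpanningTree hρ.isOneVertex
  have hmem := (mem_forestSet_pair hρ hA).2 (Or.inl rfl)
  have hT' : (ρ.blowUp hρ hS).G.IsSpanningTree _ :=
    hT.exchange hmem ((separates_inl hρ hS (U := ⟨A, Or.inl rfl⟩)).2 hh)
  have : Nonempty (ρ.blowUp hρ hS).G.V := ⟨(ρ.blowUp hρ hS).g.onV ()⟩
  let q : ForestCollapse (ρ.blowUp hρ hS).G hT'.quotient := hT'.collapse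
  have hF : q.forestSet = _ := hT'.forestSet_collapse
  let σ : MarkedGraph n :=
    { G := hT'.quotient
      g := q.toPathMap.comp (ρ.blowUp hρ hS).g
      isHomotopyEquiv := q.isHomotopyEquiv.comp (ρ.blowUp hρ hS).isHomotopyEquiv
      three_le_valence := by
        intro v
        -- After the exchange the rose contains both halves of the ideal edge. A third half-edge
        -- comes from another petal: `A` has two elements and does not contain both ends of the
        -- petal of `h`.
        obtain ⟨x, hx, hx'⟩ : ∃ x, x ≠ h ∧ x ≠ ρ.G.inv h := by
          have key : ∀ B : Set ρ.G.D, B.Nontrivial → ∀ h, (h ∉ B ∨ ρ.G.inv h ∉ B) →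
              ∃ x, x ≠ h ∧ x ≠ ρ.G.inv h := by
            intro B hB h hh
            rcases hh with h1 | h1
            · obtain ⟨x, hx, hx'⟩ := hB.exists_ne (ρ.G.inv h)
              exact ⟨x, fun h => h1 (h ▸ hx), hx'⟩
            · obtain ⟨x, hx, hx'⟩ := hB.exists_ne h
              exact ⟨x, hx', fun h => h1 (h ▸ hx)⟩
          refine key A hA.nontrivial h ?_
          by_contra! hc
          exact hh (iff_of_true hc.1 hc.2)
        have hfin := hT'.quotient.finite_D
        suffices H : 2 < {d : hT'.quotient.D | hT'.quotient.src d = v}.ncard from H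
        have hout : ∀ d : (OuterSpace.blowUp hS).D, d ≠ Sum.inl h →
            d ≠ Sum.inl (ρ.G.inv h) → d ∉ exchange (ρ.ideal hρ hS).forestSet (treeEdge hA)
              (Sum.inl h) := by
          intro d h1 h2 h3
          rcases (Set.ext_iff.1 (exchange_pair hρ hA (Sum.inl h)) d).1 h3 with h3 | h3
          · exact h1 h3
          · exact h2 h3
        refine (Set.two_lt_ncard_iff (Set.toFinite _)).2
          ⟨⟨treeEdge hA, hout _ (by rintro ⟨⟩) (by rintro ⟨⟩)⟩,
            ⟨Sum.inr ⟨Aᶜ, Or.inr rfl⟩, hout _ (by rintro ⟨⟩) (by rintro ⟨⟩)⟩,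
            ⟨Sum.inl x, hout _ (fun h => hx (Sum.inl_injective h))
              (fun h => hx' (Sum.inl_injective h))⟩, rfl, rfl, rfl, ?_, ?_, ?_⟩
        · intro h1
          exact hA.ne_compl (congrArg Subtype.val (Sum.inr_injective (congrArg Subtype.val h1)))
        · intro h1
          cases congrArg Subtype.val h1
        · intro h1
          cases congrArg Subtype.val h1 }
  have hq : (q.toPathMap.comp (ρ.blowUp hρ hS).g).Homotopic σ.g := PathMap.Homotopic.refl _
  exact ⟨σ, (Nat.card_unique : Nat.card Unit = 1), ⟨q, hq⟩, norm_sub_eq hρ hA (σ := σ) (q := q) hq hF⟩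

end MarkedGraph

end OuterSpace

namespace OuterSpace

open FinGraph

/-! ## Dismantling posets of ideal trees -/

section Nested

variable {H : Type*} {A B C : Set H}

lemma Nested.symm (h : Nested A B) : Nested B A := by
  rcases h with h | h | h | h
  · exact Or.inr (Or.inr (Or.inr (Set.compl_subset_compl.2 h)))
  · exact Or.inr (Or.inl (Set.subset_compl_comm.1 h))
  · exact Or.inr (Or.inr (Or.inl (Set.compl_subset_comm.1 h)))
  · exact Or.inl (Set.compl_subset_compl.1 h)

lemma Nested.compl_left (h : Nested A B) : Nested Aᶜ B := by
  rw [Nested, compl_compl]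
  exact h.elim (fun h => Or.inr (Or.inr (Or.inl h))) fun h =>
    h.elim (fun h => Or.inr (Or.inr (Or.inr h))) fun h => h.imp_right Or.inl

lemma Nested.compl_right (h : Nested A B) : Nested A Bᶜ := h.symm.compl_left.symm

/-- If `A` or `B` lies on one side of `C`, so does the intersection. Otherwise both complements lie
on sides of `C`: on the same side, the other side of `C` is contained in `A ∩ B`; on opposite sides,
`A` and `B` would be nested. -/
lemma Nested.inter (hA : Nested C A) (hB : Nested C B) (h : ¬ Nested A B) :
    Nested C (A ∩ B) := by
  rcases hA.symm with h1 | h1 | h1 | h1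
  · exact Nested.symm (Or.inl (Set.inter_subset_left.trans h1))
  · exact Nested.symm (Or.inr (Or.inl (Set.inter_subset_left.trans h1)))
  · rcases hB.symm with h2 | h2 | h2 | h2
    · exact Nested.symm (Or.inl (Set.inter_subset_right.trans h2))
    · exact Nested.symm (Or.inr (Or.inl (Set.inter_subset_right.trans h2)))
    · exact Or.inr (Or.inr (Or.inl (Set.subset_inter (Set.compl_subset_comm.1 h1)
        (Set.compl_subset_comm.1 h2))))
    · exact absurd (Or.inr (Or.inr (Or.inl
        (h1.trans (Set.compl_subset_compl.1 h2))))) h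
  · rcases hB.symm with h2 | h2 | h2 | h2
    · exact Nested.symm (Or.inl (Set.inter_subset_right.trans h2))
    · exact Nested.symm (Or.inr (Or.inl (Set.inter_subset_right.trans h2)))
    · exact absurd (Or.inr (Or.inr (Or.inl (h1.trans (Set.compl_subset_comm.1 h2))))) h
    · exact Or.inl (Set.subset_inter (Set.compl_subset_compl.1 h1) (Set.compl_subset_compl.1 h2))

end Nested

section Dismantling

variable {R : FinGraph} {S : Set (Set R.D)}

lemma IsSideSystem.mono (hS : IsSideSystem R S) {T : Set (Set R.D)} (h : T ⊆ S)
    (hT : ∀ A ∈ T, Aᶜ ∈ T) : IsSideSystem R T :=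
  ⟨fun A hA => hS.ideal A (h hA), hT, fun A hA B hB => hS.nested A (h hA) B (h hB)⟩

lemma IsSideSystem.union_pair (hS : IsSideSystem R S) {A : Set R.D} (hA : IsIdealSide R A)
    (h : ∀ B ∈ S, Nested B A) : IsSideSystem R (S ∪ {A, Aᶜ}) where
  ideal := by
    rintro B (hB | hB)
    · exact hS.ideal B hB
    · exact (isSideSystem_pair hA).ideal B hB
  compl_mem := by
    rintro B (hB | hB)
    · exact Or.inl (hS.compl_mem B hB)
    · exact Or.inr ((isSideSystem_pair hA).compl_mem B hB)
  nested := by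
    have key : ∀ B ∈ S, ∀ C ∈ ({A, Aᶜ} : Set (Set R.D)), Nested B C := by
      rintro B hB C (rfl | rfl)
      · exact h B hB
      · exact (h B hB).compl_right
    rintro B (hB | hB) C (hC | hC)
    · exact hS.nested B hB C hC
    · exact key B hB C hC
    · exact (key C hC B hB).symm
    · exact (isSideSystem_pair hA).nested B hB C hC

lemma IsSideSystem.pair_subset (hS : IsSideSystem R S) {A : Set R.D} (hA : A ∈ S) :
    {A, Aᶜ} ⊆ S := by
  rintro B (rfl | rfl)
  · exact hA
  · exact hS.compl_mem A hA

variable (P : Set (Set R.D))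

/-- The ideal trees with a side in `P`. -/
def treesMeeting : Set (Set (Set R.D)) := {S | IsSideSystem R S ∧ (S ∩ P).Nonempty}

/-- The non-trivial ideal trees with all sides in `P`. -/
def treesIn : Set (Set (Set R.D)) := {S | IsSideSystem R S ∧ S.Nonempty ∧ S ⊆ P}

/-- The non-trivial ideal trees with all sides in `P` and compatible with `M`. -/
def treesAlong (M : Set R.D) : Set (Set (Set R.D)) := {S ∈ treesIn P | ∀ A ∈ S, Nested A M}

variable {P} (hP : ∀ A ∈ P, IsIdealSide R A) (hPc : ∀ A ∈ P, Aᶜ ∈ P)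

lemma finite_trees (V : Set (Set (Set R.D))) : V.Finite := by
  have := R.finite_D
  exact Set.toFinite V

/-- Removal of a side `A` from the trees in `U`, by way of adding `Z`. -/
lemma dismantles_avoiding {U : Set (Set (Set R.D))} {A Z : Set R.D} (hU : ∀ S ∈ U, IsSideSystem R S)
    (hUZ : ∀ S ∈ U, A ∈ S → S ∪ {Z, Zᶜ} ∈ U)
    (hUd : ∀ S ∈ U, A ∈ S → Z ∈ S → S \ {A, Aᶜ} ∈ U) :
    Dismantles Comparable U {S ∈ U | A ∉ S} := by
  classical
  let f : Set (Set R.D) → Set (Set R.D) := fun S => if A ∈ S then S ∪ {Z, Zᶜ} else S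
  have hf1 : ∀ S, A ∈ S → f S = S ∪ {Z, Zᶜ} := fun S h => if_pos h
  have hf2 : ∀ S, A ∉ S → f S = S := fun S h => if_neg h
  -- First `Z` is added to the trees containing `A`, which retracts onto the trees where `A` occurs
  -- only together with `Z`. On those, deleting `A` is a decreasing map that stays inside `U`.
  have h1 := dismantles_of_ge (finite_trees U) f
    (fun S hS => by
      by_cases hA : A ∈ S
      · rw [hf1 S hA]; exact hUZ S hS hA
      · rwa [hf2 S hA])
    (fun S _ => by
      by_cases hA : A ∈ S
      · rw [hf1 S hA]; exact Set.subset_union_left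
      · rw [hf2 S hA])
    (fun S _ T _ h => by
      by_cases hA : A ∈ S
      · rw [hf1 S hA, hf1 T (h hA)]; exact Set.union_subset_union_left _ h
      · rw [hf2 S hA]
        by_cases hA' : A ∈ T
        · rw [hf1 T hA']; exact h.trans Set.subset_union_left
        · rwa [hf2 T hA'])
    (fun S _ => by
      by_cases hA : A ∈ S
      · rw [hf1 S hA, hf1 _ (Or.inl hA), Set.union_assoc, Set.union_self]
      · rw [hf2 S hA, hf2 S hA])
  have hmem : ∀ S ∈ U, f S = S → A ∈ S → Z ∈ S := fun S _ h hA => by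
    rw [hf1 S hA] at h
    rw [← h]
    exact Or.inr (Or.inl rfl)
  refine h1.trans ?_
  have hd : ∀ S ∈ {S ∈ U | f S = S}, A ∉ S → S \ {A, Aᶜ} = S := fun S hS hA => by
    refine sdiff_eq_left.2 (Set.disjoint_right.2 ?_)
    rintro B (rfl | rfl) hB
    · exact hA hB
    · refine hA ?_
      have := (hU S hS.1).compl_mem _ hB
      rwa [compl_compl] at this
  have h2 := dismantles_of_le (finite_trees {S ∈ U | f S = S}) (fun S => S \ {A, Aᶜ})
    (fun S hS => by
      refine ⟨?_, hf2 _ fun h => h.2 (Or.inl rfl)⟩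
      by_cases hA : A ∈ S
      · exact hUd S hS.1 hA (hmem S hS.1 hS.2 hA)
      · rw [hd S hS hA]
        exact hS.1)
    (fun S _ => Set.sdiff_subset) (fun S _ T _ h => Set.sdiff_subset_sdiff_left h)
    (fun S _ => by rw [Set.sdiff_sdiff, Set.union_self])
  convert h2 using 1
  ext S
  constructor
  · rintro ⟨h3, h4⟩
    exact ⟨⟨h3, hf2 S h4⟩, hd S ⟨h3, hf2 S h4⟩ h4⟩
  · rintro ⟨⟨h3, -⟩, h4⟩
    refine ⟨h3, fun h5 => ?_⟩
    rw [← show S \ {A, Aᶜ} = S from h4] at h5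
    exact h5.2 (Or.inl rfl)

include hPc

lemma dismantles_treesIn : Dismantles Comparable (treesMeeting P) (treesIn P) := by
  have key : ∀ S ∈ treesMeeting P, S ∩ P ∈ treesIn P := fun S hS =>
    ⟨hS.1.mono Set.inter_subset_left fun A hA => ⟨hS.1.compl_mem A hA.1, hPc A hA.2⟩,
      hS.2, Set.inter_subset_right⟩
  have h := dismantles_of_le (finite_trees (treesMeeting P)) (fun S => S ∩ P)
    (fun S hS => ⟨(key S hS).1, by rw [Set.inter_assoc, Set.inter_self]; exact hS.2⟩)
    (fun S _ => Set.inter_subset_left) (fun S _ T _ h => Set.inter_subset_inter_left _ h)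
    (fun S _ => by rw [Set.inter_assoc, Set.inter_self])
  convert h using 1
  ext S
  constructor
  · rintro ⟨h1, h2, h3⟩
    have h4 : S ∩ P = S := Set.inter_eq_left.2 h3
    exact ⟨⟨h1, by rwa [h4]⟩, h4⟩
  · rintro ⟨h1, h2⟩
    exact (show S ∩ P = S from h2) ▸ key S h1

include hP

/-- Conical contraction: `S ≤ S ∪ {M, Mᶜ} ≥ {M, Mᶜ}`, which makes sense because every side of `S` is
nested with `M`. -/
lemma dismantles_pair {M : Set R.D} (hM : M ∈ P) :
    Dismantles Comparable (treesAlong P M) {{M, Mᶜ}} := by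
  have hpair := isSideSystem_pair (hP M hM)
  have hpairP : {M, Mᶜ} ⊆ P := by
    rintro A (rfl | rfl)
    · exact hM
    · exact hPc _ hM
  have hpairM : ∀ A ∈ ({M, Mᶜ} : Set (Set R.D)), Nested A M := fun A hA =>
    hpair.nested A hA M (Or.inl rfl)
  have h1 := dismantles_of_ge (finite_trees (treesAlong P M)) (fun S => S ∪ {M, Mᶜ})
    (fun S hS => ⟨⟨hS.1.1.union_pair (hP M hM) hS.2, hS.1.2.1.inl,
      Set.union_subset hS.1.2.2 hpairP⟩, fun A hA => hA.elim (hS.2 A) (hpairM A)⟩)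
    (fun S _ => Set.subset_union_left) (fun S _ T _ h => Set.union_subset_union_left _ h)
    (fun S _ => by rw [Set.union_assoc, Set.union_self])
  refine h1.trans ?_
  have h2 := dismantles_of_le (finite_trees {S ∈ treesAlong P M | S ∪ {M, Mᶜ} = S})
    (fun _ => {M, Mᶜ}) (fun S _ => ⟨⟨⟨hpair, ⟨M, Or.inl rfl⟩, hpairP⟩, hpairM⟩, Set.union_self _⟩)
    (fun S hS => Set.union_eq_left.1 hS.2) (fun S _ T _ _ => le_rfl) (fun S _ => rfl)
  convert h2 using 1
  ext S
  constructor
  · rintro rfl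
    exact ⟨⟨⟨⟨hpair, ⟨M, Or.inl rfl⟩, hpairP⟩, hpairM⟩, Set.union_self _⟩, rfl⟩
  · rintro ⟨-, rfl⟩
    rfl

/-- The sides crossing `M` are eliminated one complementary pair at a time, each in favour of a
corner with `M`, which no longer crosses `M`. -/
lemma dismantles_treesAlong {M : Set R.D}
    (hpush : ∀ A ∈ P, ¬ Nested A M → ∃ Z ∈ P, Z = A ∩ M ∨ Z = A ∩ Mᶜ) :
    Dismantles Comparable (treesIn P) (treesAlong P M) := by
  have := R.finite_D
  -- `C` holds the crossing sides not yet eliminated. It is closed under complements, so that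
  -- minimality in `C` can also be applied to the complement of a side.
  suffices H : ∀ k, ∀ C : Set (Set R.D), C.ncard = k →
      (∀ A ∈ C, A ∈ P ∧ ¬ Nested A M ∧ Aᶜ ∈ C) →
      Dismantles Comparable {S ∈ treesIn P | ∀ A ∈ S, A ∈ C ∨ Nested A M} (treesAlong P M) by
    have h := H _ {A ∈ P | ¬ Nested A M} rfl fun A hA => ⟨hA.1, hA.2, hPc A hA.1, fun h =>
      hA.2 (by simpa using h.compl_left)⟩
    convert h using 1
    ext S
    refine ⟨fun hS => ⟨hS, fun A hA => ?_⟩, fun hS => hS.1⟩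
    by_cases h : Nested A M
    · exact Or.inr h
    · exact Or.inl ⟨hS.2.2 hA, h⟩
  intro k
  induction k using Nat.strong_induction_on with
  | _ k ih =>
    intro C hk hC
    rcases C.eq_empty_or_nonempty with rfl | hne
    · convert Dismantles.refl (adj := Comparable) (treesAlong P M) using 1
      ext S
      simp [treesAlong]
    obtain ⟨A, hA⟩ := (Set.toFinite C).exists_minimal hne
    obtain ⟨hAP, hAM, hAc⟩ := hC A hA.prop
    obtain ⟨Z, hZP, hZ⟩ := hpush A hAP hAM
    have hZsub : Z ⊆ A := by
      rcases hZ with rfl | rfl <;> exact Set.inter_subset_left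
    have hZM : Nested Z M := by
      rcases hZ with rfl | rfl
      · exact Or.inl Set.inter_subset_right
      · exact Or.inr (Or.inl Set.inter_subset_right)
    have hAM' : ¬ Nested Aᶜ M := fun h => hAM (by simpa using h.compl_left)
    have hZA : Z ≠ A := fun h => hAM (h ▸ hZM)
    have hZA' : Z ≠ Aᶜ := fun h => hAM' (h ▸ hZM)
    -- Compatibility with `A` passes to the corner `Z`. For crossing sides this uses minimality of
    -- `A`: no side in `C` lies properly inside `A`. A side nested with `M` is nested with both `A`
    -- and `M`, hence with their corner.
    have hnest : ∀ B, B ∈ C ∨ Nested B M → Nested B A → Nested B Z := by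
      rintro B (hB | hB) hBA
      · rcases hBA.symm with h | h | h | h
        · exact Nested.symm (Or.inl (hZsub.trans h))
        · exact Nested.symm (Or.inr (Or.inl (hZsub.trans h)))
        · have h1 : Bᶜ ⊆ A := Set.compl_subset_comm.1 h
          exact Nested.symm (Or.inr (Or.inl (hZsub.trans (hA.le_of_le (hC B hB).2.2 h1))))
        · have h1 : B ⊆ A := Set.compl_subset_compl.1 h
          exact Nested.symm (Or.inl (hZsub.trans (hA.le_of_le hB h1)))
      · rcases hZ with rfl | rfl
        · exact hBA.inter hB hAM
        · exact hBA.inter hB.compl_right fun h => hAM (by simpa using h.compl_right)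
    have hstep := dismantles_avoiding (Z := Z) (U := {S ∈ treesIn P | ∀ A ∈ S, A ∈ C ∨ Nested A M})
      (fun S hS => hS.1.1)
      (fun S hS hAS => ⟨⟨hS.1.1.union_pair (hP Z hZP) fun B hB =>
        hnest B (hS.2 B hB) (hS.1.1.nested B hB A hAS), hS.1.2.1.inl, by
          rintro B (hB | rfl | rfl)
          · exact hS.1.2.2 hB
          · exact hZP
          · exact hPc _ hZP⟩, by
          rintro B (hB | rfl | rfl)
          · exact hS.2 B hB
          · exact Or.inr hZM
          · exact Or.inr hZM.compl_left⟩)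
      (fun S hS hAS hZS => ⟨⟨hS.1.1.mono Set.sdiff_subset (by
          rintro B ⟨hB, hB'⟩
          refine ⟨hS.1.1.compl_mem B hB, ?_⟩
          rintro (h | h)
          · exact hB' (Or.inr (by rw [← h, compl_compl]; rfl))
          · exact hB' (Or.inl (compl_injective h))),
          ⟨Z, hZS, by rintro (h | h); exacts [hZA h, hZA' h]⟩,
          Set.sdiff_subset.trans hS.1.2.2⟩, fun B hB => hS.2 B hB.1⟩)
    refine hstep.trans ?_
    have h := ih _ ?_ (C \ {A, Aᶜ}) rfl ?_
    · convert h using 1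
      ext S
      constructor
      · rintro ⟨⟨h1, h2⟩, h3⟩
        refine ⟨h1, fun B hB => (h2 B hB).imp_left fun h => ⟨h, ?_⟩⟩
        rintro (rfl | rfl)
        · exact h3 hB
        · refine h3 ?_
          have := h1.1.compl_mem _ hB
          rwa [compl_compl] at this
      · rintro ⟨h1, h2⟩
        refine ⟨⟨h1, fun B hB => (h2 B hB).imp_left fun h => h.1⟩, fun h3 => ?_⟩
        rcases h2 A h3 with h4 | h4
        · exact h4.2 (Or.inl rfl)
        · exact hAM h4
    · rw [← hk]
      exact Set.ncard_lt_ncard ⟨Set.sdiff_subset, fun h => (h hA.prop).2 (Or.inl rfl)⟩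
        (Set.toFinite _)
    · rintro B ⟨hB, hB'⟩
      refine ⟨(hC B hB).1, (hC B hB).2.1, (hC B hB).2.2, ?_⟩
      rintro (h | h)
      · exact hB' (Or.inr (by rw [← h, compl_compl]; rfl))
      · exact hB' (Or.inl (compl_injective h))

end Dismantling

end OuterSpace

namespace OuterSpace

open FinGraph

/-! ## Reductive sides -/

namespace MarkedGraph

variable {n : ℕ} (W : ClassList n) (ρ : MarkedGraph n)

/-- The sides of the reductive ideal edges. -/
def reductiveSides : Set (Set ρ.G.D) :=
  {A | IsIdealSide ρ.G A ∧ ∃ h, Splits A h ∧ ρ.sideWeight W A < ρ.petalWeight W h}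

/-- `M` is the side of an ideal edge for which the exchange with the petal `m` decreases the norm
as much as possible. -/
structure IsMaximalSide (M : Set ρ.G.D) (m : ρ.G.D) : Prop where
  ideal : IsIdealSide ρ.G M
  splits : Splits M m
  pos : 0 < ρ.petalWeight W m - ρ.sideWeight W M
  le : ∀ A h, IsIdealSide ρ.G A → Splits A h →
    ρ.petalWeight W h - ρ.sideWeight W A ≤ ρ.petalWeight W m - ρ.sideWeight W M

variable {W ρ}

lemma splits_inv {A : Set ρ.G.D} {h : ρ.G.D} : Splits A (ρ.G.inv h) ↔ Splits A h := by
  rw [Splits, Splits, ρ.G.inv_inv]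
  exact not_congr Iff.comm

lemma splits_compl {A : Set ρ.G.D} {h : ρ.G.D} : Splits Aᶜ h ↔ Splits A h :=
  not_congr not_iff_not

lemma Splits.isIdealSide {A : Set ρ.G.D} {h : ρ.G.D} (hh : Splits A h) (h1 : A.Nontrivial)
    (h2 : Aᶜ.Nontrivial) : IsIdealSide ρ.G A := by
  refine ⟨h1, h2, ?_⟩
  by_cases hA : h ∈ A
  · exact ⟨h, hA, fun h' => hh (iff_of_true hA h')⟩
  · have hA' : ρ.G.inv h ∈ A := by_contra fun h' => hh (iff_of_false hA h')
    exact ⟨_, hA', by rwa [ρ.G.inv_inv]⟩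

/-- This handles degenerate corners: a split side with one element is an end of the petal itself,
and the corresponding exchange has gain zero. -/
lemma Splits.nontrivial_or {A : Set ρ.G.D} {h : ρ.G.D} (hh : Splits A h) :
    A.Nontrivial ∨ ρ.sideWeight W A = ρ.petalWeight W h := by
  refine or_iff_not_imp_left.2 fun h1 => ?_
  rw [Set.not_nontrivial_iff] at h1
  by_cases hA : h ∈ A
  · rw [h1.eq_singleton_of_mem hA, sideWeight_singleton]
  · have hA' : ρ.G.inv h ∈ A := by_contra fun h' => hh (iff_of_false hA h')
    rw [h1.eq_singleton_of_mem hA', sideWeight_singleton, petalWeight_inv]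

lemma isIdealSide_of_mem_reductiveSides {A : Set ρ.G.D} (hA : A ∈ ρ.reductiveSides W) :
    IsIdealSide ρ.G A := hA.1

lemma compl_mem_reductiveSides {A : Set ρ.G.D} (hA : A ∈ ρ.reductiveSides W) :
    Aᶜ ∈ ρ.reductiveSides W := by
  obtain ⟨h1, h, h2, h3⟩ := hA
  exact ⟨h1.compl, h, splits_compl.2 h2, by rwa [sideWeight_compl]⟩

lemma exists_isMaximalSide (h : (ρ.reductiveSides W).Nonempty) :
    ∃ M m, ρ.IsMaximalSide W M m := by
  have := ρ.G.finite_D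
  obtain ⟨A, hA, h, hh, hlt⟩ := h
  obtain ⟨⟨M, m⟩, hM, hmax⟩ := Set.exists_max_image
    {p : Set ρ.G.D × ρ.G.D | IsIdealSide ρ.G p.1 ∧ Splits p.1 p.2}
    (fun p => ρ.petalWeight W p.2 - ρ.sideWeight W p.1) (Set.toFinite _) ⟨(A, h), hA, hh⟩
  exact ⟨M, m, hM.1, hM.2, (sub_pos.2 hlt).trans_le (hmax (A, h) ⟨hA, hh⟩),
    fun B k hB hk => hmax (B, k) ⟨hB, hk⟩⟩

namespace IsMaximalSide

variable {M : Set ρ.G.D} {m : ρ.G.D} (hM : ρ.IsMaximalSide W M m)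

include hM

lemma mem_reductiveSides : M ∈ ρ.reductiveSides W :=
  ⟨hM.ideal, m, hM.splits, sub_pos.1 hM.pos⟩

lemma inv : ρ.IsMaximalSide W M (ρ.G.inv m) where
  ideal := hM.ideal
  splits := splits_inv.2 hM.splits
  pos := by rw [petalWeight_inv]; exact hM.pos
  le := by rw [petalWeight_inv]; exact hM.le

lemma compl : ρ.IsMaximalSide W Mᶜ m where
  ideal := hM.ideal.compl
  splits := splits_compl.2 hM.splits
  pos := by rw [sideWeight_compl]; exact hM.pos
  le := by rw [sideWeight_compl]; exact hM.le

lemma le_of_splits {Z : Set ρ.G.D} {z : ρ.G.D} (h : Splits Z z) (hZ : Zᶜ.Nontrivial) :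
    ρ.petalWeight W z - ρ.sideWeight W Z ≤ ρ.petalWeight W m - ρ.sideWeight W M := by
  rcases h.nontrivial_or (W := W) with h1 | h1
  · exact hM.le Z z (h.isIdealSide h1 hZ) h
  · rw [h1, sub_self]
    exact hM.pos.le

/-- By `h1` and `h2` the gains of `(X, x)` and `(Y, y)` add up to at least those of `(A, a)` and
`(M, m)`. The gain of `(Y, y)` is at most the maximal gain of `(M, m)`, so that of `(X, x)` is at
least the positive gain of `(A, a)`. In particular `X` is not a singleton. -/
lemma mem_reductiveSides_of_le {A X Y : Set ρ.G.D} {a x y : ρ.G.D} (hX : Splits X x)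
    (hY : Splits Y y) (hXc : Xᶜ.Nontrivial) (hYc : Yᶜ.Nontrivial)
    (hA : ρ.sideWeight W A < ρ.petalWeight W a)
    (h1 : ρ.sideWeight W X + ρ.sideWeight W Y ≤ ρ.sideWeight W A + ρ.sideWeight W M)
    (h2 : ρ.petalWeight W a + ρ.petalWeight W m ≤ ρ.petalWeight W x + ρ.petalWeight W y) :
    X ∈ ρ.reductiveSides W := by
  have h3 := hM.le_of_splits hY hYc
  have h4 : ρ.sideWeight W X < ρ.petalWeight W x := by
    refine lt_of_not_ge fun h4 => hA.not_ge (le_of_add_le_add_right (a := ρ.petalWeight W m) ?_)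
    have h5 := (h2.trans (add_le_add h4 (sub_le_iff_le_add.1 h3))).trans_eq
      (show _ = ρ.sideWeight W X + ρ.sideWeight W Y + (ρ.petalWeight W m - ρ.sideWeight W M) by
        abel)
    refine (h5.trans (add_le_add_left h1 _)).trans_eq ?_
    abel
  refine ⟨hX.isIdealSide ((hX.nontrivial_or (W := W)).resolve_right h4.ne) hXc, x, hX, h4⟩

/-- The positions of the remaining ends of the petals `a` and `m` decide which opposite corners to
use. In most cases one of two opposite corners is split by `a` and the other by `m`. In the
remaining case one diagonal pair is split by `a` twice and the other by `m` twice, and the pair with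
the heavier petal works. -/
lemma exists_corner_of_mem {A : Set ρ.G.D} {a : ρ.G.D} (hA : IsIdealSide ρ.G A)
    (hlt : ρ.sideWeight W A < ρ.petalWeight W a) (ha : a ∈ A) (ha' : ρ.G.inv a ∉ A)
    (haM : a ∈ M) (hm : m ∈ M) (hm' : ρ.G.inv m ∉ M) :
    A ∩ M ∈ ρ.reductiveSides W ∨ A ∩ Mᶜ ∈ ρ.reductiveSides W := by
  have n1 : (A ∩ M)ᶜ.Nontrivial :=
    hA.nontrivial_compl.mono (Set.compl_subset_compl.2 Set.inter_subset_left)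
  have n2 : (A ∩ Mᶜ)ᶜ.Nontrivial :=
    hA.nontrivial_compl.mono (Set.compl_subset_compl.2 Set.inter_subset_left)
  have n3 : (Aᶜ ∩ Mᶜ)ᶜ.Nontrivial := hA.nontrivial.mono fun x hx h => h.1 hx
  have n4 : (Aᶜ ∩ M)ᶜ.Nontrivial := hA.nontrivial.mono fun x hx h => h.1 hx
  have w1 : ρ.sideWeight W (A ∩ M) + ρ.sideWeight W (Aᶜ ∩ Mᶜ) ≤
      ρ.sideWeight W A + ρ.sideWeight W M := by
    rw [← Set.compl_union, sideWeight_compl]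
    exact sideWeight_inter_add_union W ρ A M
  have w2 : ρ.sideWeight W (A ∩ Mᶜ) + ρ.sideWeight W (Aᶜ ∩ M) ≤
      ρ.sideWeight W A + ρ.sideWeight W M := by
    have h1 : Aᶜ ∩ M = (A ∪ Mᶜ)ᶜ := by rw [Set.compl_union, compl_compl]
    rw [h1, sideWeight_compl, ← sideWeight_compl W ρ M]
    exact sideWeight_inter_add_union W ρ A Mᶜ
  have s1 : Splits (A ∩ M) a := fun h => ha' (h.1 ⟨ha, haM⟩).1
  by_cases h1 : ρ.G.inv m ∈ A
  · have s2 : Splits (A ∩ Mᶜ) m := fun h => (h.2 ⟨h1, hm'⟩).2 hm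
    by_cases h2 : ρ.G.inv a ∈ M
    · exact Or.inr (hM.mem_reductiveSides_of_le s2 (fun h => (h.2 ⟨ha', h2⟩).1 ha) n2 n4 hlt w2
        (add_comm _ _).le)
    · have s3 : Splits (Aᶜ ∩ Mᶜ) a := fun h => (h.2 ⟨ha', h2⟩).1 ha
      by_cases h3 : m ∈ A
      · exact Or.inl (hM.mem_reductiveSides_of_le (x := m) (fun h => hm' (h.1 ⟨h3, hm⟩).2) s3 n1 n3
          hlt w1 (add_comm _ _).le)
      · rcases le_total (ρ.petalWeight W a) (ρ.petalWeight W m) with h4 | h4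
        · exact Or.inr (hM.mem_reductiveSides_of_le s2 (y := m)
            (fun h => hm' (h.1 ⟨h3, hm⟩).2) n2 n4 hlt w2 (add_le_add_left h4 _))
        · exact Or.inl (hM.mem_reductiveSides_of_le s1 s3 n1 n3 hlt w1 (add_le_add_right h4 _))
  · exact Or.inl (hM.mem_reductiveSides_of_le s1 (y := m) (fun h => (h.2 ⟨h1, hm'⟩).2 hm) n1 n3 hlt
      w1 le_rfl)

lemma exists_corner {A : Set ρ.G.D} (hA : A ∈ ρ.reductiveSides W) :
    ∃ Z ∈ ρ.reductiveSides W, Z = A ∩ M ∨ Z = A ∩ Mᶜ := by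
  suffices H : A ∩ M ∈ ρ.reductiveSides W ∨ A ∩ Mᶜ ∈ ρ.reductiveSides W by
    rcases H with H | H
    · exact ⟨_, H, Or.inl rfl⟩
    · exact ⟨_, H, Or.inr rfl⟩
  have orient : ∀ {B : Set ρ.G.D} {h : ρ.G.D}, Splits B h →
      (h ∈ B ∧ ρ.G.inv h ∉ B) ∨ (ρ.G.inv h ∈ B ∧ h ∉ B) := by
    intro B h hB
    rw [Splits] at hB
    tauto
  have key : ∀ {M : Set ρ.G.D} {m a : ρ.G.D}, ρ.IsMaximalSide W M m →
      ρ.sideWeight W A < ρ.petalWeight W a → a ∈ A → ρ.G.inv a ∉ A → a ∈ M →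
      A ∩ M ∈ ρ.reductiveSides W ∨ A ∩ Mᶜ ∈ ρ.reductiveSides W := by
    intro M m a hM hlt ha ha' haM
    rcases orient hM.splits with ⟨h1, h2⟩ | ⟨h1, h2⟩
    · exact hM.exists_corner_of_mem hA.1 hlt ha ha' haM h1 h2
    · exact hM.inv.exists_corner_of_mem hA.1 hlt ha ha' haM h1 (by rwa [ρ.G.inv_inv])
  have key' : ∀ {a : ρ.G.D}, ρ.sideWeight W A < ρ.petalWeight W a → a ∈ A → ρ.G.inv a ∉ A →
      A ∩ M ∈ ρ.reductiveSides W ∨ A ∩ Mᶜ ∈ ρ.reductiveSides W := by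
    intro a hlt ha ha'
    by_cases haM : a ∈ M
    · exact key hM hlt ha ha' haM
    · have := key hM.compl hlt ha ha' haM
      rw [compl_compl] at this
      exact this.symm
  obtain ⟨a, hs, hlt⟩ := hA.2
  rcases orient hs with ⟨h1, h2⟩ | ⟨h1, h2⟩
  · exact key' hlt h1 h2
  · exact key' (by rwa [petalWeight_inv]) h1 (by rwa [ρ.G.inv_inv])

end IsMaximalSide

end MarkedGraph

end OuterSpace

namespace OuterSpace

open FinGraph

/-! ## Stars of roses -/

/-- A forest collapse of a rose is an isomorphism. -/
lemma ForestCollapse.exists_graphIso {G G' : FinGraph} (c : ForestCollapse G G')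
    (hG : G.IsOneVertex) : ∃ h : GraphIso G G', h.toPathMap = c.toPathMap := by
  have h0 : ∀ d, ∃ d', c.onD d = some d' := by
    intro d
    refine (c.mem_forestSet_or d).resolve_left fun hd => ?_
    have := c.isForest.eq_nil (v := G.src d) (l := [d]) ⟨rfl, hG _ _⟩
      (fun e he => List.mem_singleton.1 he ▸ hd) (reduced_singleton d)
    cases this
  choose k hk using h0
  have hk' : Function.Bijective k := by
    refine ⟨fun d e h => c.onD_injective (hk d) (h ▸ hk e), fun d' => ⟨c.lift d', ?_⟩⟩
    have := (hk (c.lift d')).symm.trans (c.onD_lift d')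
    exact Option.some_injective _ this
  let h : GraphIso G G' :=
    { onV := Equiv.ofBijective c.onV ⟨fun u v _ => hG u v, c.onV_surjective⟩
      onD := Equiv.ofBijective k hk'
      src := fun d => c.src d _ (hk d)
      inv := fun d => by
        have := (hk (G.inv d)).symm.trans ((c.inv d).trans (congrArg (Option.map _) (hk d)))
        exact Option.some_injective _ this }
  refine ⟨h, ?_⟩
  rw [← h.toForestCollapse_toPathMap]
  exact congrArg toPathMap (ForestCollapse.eq_of_eq rfl (funext fun d => (hk d).symm))

namespace MarkedGraph

variable {n : ℕ}

lemma IsRose.cls_le_of_le {σ : MarkedGraph n} (hσ : σ.IsRose) {x : SpineVertex n}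
    (h : x ≤ σ.cls) : σ.cls ≤ x := by
  obtain ⟨b, rfl⟩ := Quotient.exists_rep x
  obtain ⟨c, hc⟩ := cls_le_iff.1 h
  obtain ⟨i, hi⟩ := c.exists_graphIso hσ.isOneVertex
  rw [← hi] at hc
  exact cls_le_iff.2 (Equivalent.symm ⟨i, hc⟩).collapsesTo

lemma IsRose.nonseparating {σ : MarkedGraph n} (hσ : σ.IsRose) : σ.cls.Nonseparating :=
  ⟨σ, rfl, fun _ => ⟨[], hσ.isOneVertex _ _, by simp, by simp⟩⟩

/-- A rose has no proper forest collapse, so anything comparable with it lies above it. -/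
lemma IsRose.mem_st_iff {σ : MarkedGraph n} (hσ : σ.IsRose) {s : Finset (SpineVertex n)} :
    s ∈ (st σ).faces ↔ s ∈ (complexL n).faces ∧ ∀ x ∈ s, σ.cls ≤ x := by
  classical
  constructor
  · rintro ⟨hs, t, ht, hσt, hst⟩
    refine ⟨hs, fun x hx => ?_⟩
    rcases ht.2.1 _ hσt _ (hst hx) with h | h
    · exact h
    · exact hσ.cls_le_of_le h
  · rintro ⟨hs, h⟩
    refine ⟨hs, insert σ.cls s, ⟨Finset.insert_nonempty _ _, ?_, ?_⟩, Finset.mem_insert_self _ _,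
      Finset.subset_insert _ _⟩
    · intro x hx y hy
      rcases Finset.mem_insert.1 hx with rfl | hx <;> rcases Finset.mem_insert.1 hy with rfl | hy
      · exact Or.inl (SpineVertex.le_refl' _)
      · exact Or.inl (h y hy)
      · exact Or.inr (h x hx)
      · exact hs.2.1 x hx y hy
    · intro x hx
      rcases Finset.mem_insert.1 hx with rfl | hx
      · exact hσ.nonseparating
      · exact hs.2.2 x hx

end MarkedGraph

lemma SpineVertex.exists_min {n : ℕ} {s : Finset (SpineVertex n)} (hs : s.Nonempty)
    (h : ∀ x ∈ s, ∀ y ∈ s, x ≤ y ∨ y ≤ x) : ∃ x ∈ s, ∀ y ∈ s, x ≤ y := by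
  induction hs using Finset.Nonempty.cons_induction with
  | singleton a => exact ⟨a, by simp, by simpa using SpineVertex.le_refl' a⟩
  | cons a s ha hs ih =>
    obtain ⟨x, hx, hx'⟩ := ih fun x hx y hy =>
      h x (Finset.mem_cons_of_mem hx) y (Finset.mem_cons_of_mem hy)
    rcases h a (Finset.mem_cons_self a s) x (Finset.mem_cons_of_mem hx) with h1 | h1
    · refine ⟨a, Finset.mem_cons_self a s, fun y hy => ?_⟩
      rcases Finset.mem_cons.1 hy with rfl | hy
      · exact SpineVertex.le_refl' _
      · exact SpineVertex.le_trans' h1 (hx' y hy)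
    · refine ⟨x, Finset.mem_cons_of_mem hx, fun y hy => ?_⟩
      rcases Finset.mem_cons.1 hy with rfl | hy
      · exact h1
      · exact hx' y hy

/-! ## Ideal trees as vertices of the star -/

namespace MarkedGraph

variable {n : ℕ} {W : ClassList n} {ρ : MarkedGraph n} (hρ : ρ.IsRose)

open Classical in
/-- The vertex of the spine given by an ideal tree. -/
noncomputable def treeVertex (S : Set (Set ρ.G.D)) : SpineVertex n :=
  if hS : IsSideSystem ρ.G S then (ρ.blowUp hρ hS).cls else ρ.cls

variable {S S' : Set (Set ρ.G.D)} (hS : IsSideSystem ρ.G S) (hS' : IsSideSystem ρ.G S')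

include hS

lemma treeVertex_eq : treeVertex hρ S = (ρ.blowUp hρ hS).cls := dif_pos hS

lemma cls_le_treeVertex : ρ.cls ≤ treeVertex hρ S := by
  rw [treeVertex_eq hρ hS]
  exact cls_le_iff.2 (ρ.blowUp_collapsesTo hρ hS)

lemma nonseparating_treeVertex : (treeVertex hρ S).Nonseparating := by
  rw [treeVertex_eq hρ hS]
  exact ⟨_, rfl, noSeparatingEdge_blowUp hS⟩

include hS'

lemma treeVertex_le_iff : treeVertex hρ S ≤ treeVertex hρ S' ↔ S ⊆ S' := by
  rw [treeVertex_eq hρ hS, treeVertex_eq hρ hS', cls_le_iff]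
  exact ⟨subset_of_collapsesTo hρ hS hS', ρ.blowUp_collapsesTo_blowUp hρ hS hS'⟩

lemma treeVertex_inj (h : treeVertex hρ S = treeVertex hρ S') : S = S' :=
  subset_antisymm ((treeVertex_le_iff hρ hS hS').1 (h ▸ SpineVertex.le_refl' _))
    ((treeVertex_le_iff hρ hS' hS).1 (h ▸ SpineVertex.le_refl' _))

omit hS hS'

lemma exists_treeVertex {x : SpineVertex n} (h : ρ.cls ≤ x) (hx : x.Nonseparating) :
    ∃ S, IsSideSystem ρ.G S ∧ x = treeVertex hρ S := by
  obtain ⟨b, rfl, hb⟩ := hx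
  obtain ⟨c, hc⟩ := cls_le_iff.1 h
  have hS := c.isSideSystem_sides hρ.isOneVertex b.three_le_valence hb
  refine ⟨_, hS, ?_⟩
  rw [treeVertex_eq hρ hS]
  exact (cls_eq_iff.2 (equivalent_blowUp hρ c hc hS)).symm

lemma singleton_mem_st_iff {x : SpineVertex n} : {x} ∈ (st ρ).faces ↔
    ∃ S, IsSideSystem ρ.G S ∧ x = treeVertex hρ S := by
  rw [hρ.mem_st_iff]
  constructor
  · rintro ⟨⟨-, -, h1⟩, h2⟩
    exact exists_treeVertex hρ (h2 x (by simp)) (h1 x (by simp))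
  · rintro ⟨S, hS, rfl⟩
    refine ⟨⟨by simp, by simpa using SpineVertex.le_refl' _, ?_⟩, ?_⟩
    · simpa using nonseparating_treeVertex hρ hS
    · simpa using cls_le_treeVertex hρ hS

/-- A smaller rose yields a reductive side by the exchange argument. Conversely, a reductive side
yields a smaller rose below its own ideal edge, hence below every tree containing it. -/
lemma exists_smaller_rose_iff (hS : IsSideSystem ρ.G S) :
    (∃ σ : MarkedGraph n, σ.IsRose ∧ σ.norm W < ρ.norm W ∧ σ.cls ≤ treeVertex hρ S) ↔
      (S ∩ ρ.reductiveSides W).Nonempty := by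
  constructor
  · rintro ⟨σ, hσ, hlt, hle⟩
    rw [treeVertex_eq hρ hS, cls_le_iff] at hle
    obtain ⟨A, hA, h⟩ := exists_reductive_side hρ hS hσ hle hlt
    exact ⟨A, hA, hS.ideal A hA, h⟩
  · rintro ⟨A, hAS, hA, h, hh, hlt⟩
    obtain ⟨σ, hσ, hc, hn⟩ := exists_rose (W := W) hρ hA hh
    refine ⟨σ, hσ, ?_, ?_⟩
    · rw [← sub_pos, hn]
      exact sub_pos.2 hlt
    · rw [treeVertex_eq hρ hS, cls_le_iff]
      exact (ρ.blowUp_collapsesTo_blowUp hρ (isSideSystem_pair hA) hS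
        (hS.pair_subset hAS)).trans hc

lemma mem_reductiveComplex_iff {s : Finset (SpineVertex n)} :
    s ∈ (reductiveComplex W ρ).faces ↔ s ∈ (st ρ).faces ∧
      ∃ σ : MarkedGraph n, (σ.IsRose ∧ σ.norm W < ρ.norm W) ∧ s ∈ (st σ).faces := by
  refine and_congr Iff.rfl ?_
  change s ∈ ⋃ K ∈ Set.range fun σ : {σ : MarkedGraph n // σ.IsRose ∧ σ.norm W < ρ.norm W} =>
    st σ.1, K.faces ↔ _
  simp only [Set.mem_iUnion, Set.mem_range, exists_prop]
  constructor
  · rintro ⟨_, ⟨σ, rfl⟩, hs⟩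
    exact ⟨σ.1, σ.2, hs⟩
  · rintro ⟨σ, hσ, hs⟩
    exact ⟨_, ⟨⟨σ, hσ⟩, rfl⟩, hs⟩

/-- Comparability in the spine. -/
def SpineComparable (x y : SpineVertex n) : Prop := x ≤ y ∨ y ≤ x

lemma SpineComparable.refl (x : SpineVertex n) : SpineComparable x x :=
  Or.inl (SpineVertex.le_refl' x)

lemma SpineComparable.symm (x y : SpineVertex n) (h : SpineComparable x y) :
    SpineComparable y x := Or.symm h

/-- A chain lies in the star of a smaller rose as soon as its least element lies above that rose.
Hence the intersection is a full subcomplex, determined by its vertices. -/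
lemma reductiveComplex_eq : reductiveComplex W ρ =
    cliqueComplex SpineComparable (treeVertex hρ '' treesMeeting (ρ.reductiveSides W)) := by
  refine SetLike.ext fun s => ?_
  change s ∈ (reductiveComplex W ρ).faces ↔ _
  rw [mem_reductiveComplex_iff, hρ.mem_st_iff]
  constructor
  · rintro ⟨⟨⟨h1, h2, h3⟩, h4⟩, σ, ⟨hσ, hlt⟩, h5⟩
    refine ⟨h1, h2, fun x hx => ?_⟩
    obtain ⟨S, hS, rfl⟩ := exists_treeVertex hρ (h4 x hx) (h3 x hx)
    refine ⟨S, ⟨hS, (exists_smaller_rose_iff hρ hS).1 ⟨σ, hσ, hlt, ?_⟩⟩, rfl⟩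
    exact (hσ.mem_st_iff.1 h5).2 _ hx
  · rintro ⟨h1, h2, h3⟩
    have hL : s ∈ (complexL n).faces := ⟨h1, h2, fun x hx => by
      obtain ⟨S, hS, rfl⟩ := h3 x hx
      exact nonseparating_treeVertex hρ hS.1⟩
    refine ⟨⟨hL, fun x hx => ?_⟩, ?_⟩
    · obtain ⟨S, hS, rfl⟩ := h3 x hx
      exact cls_le_treeVertex hρ hS.1
    · obtain ⟨x, hx, hmin⟩ := SpineVertex.exists_min h1 h2
      obtain ⟨S, hS, rfl⟩ := h3 x hx
      obtain ⟨σ, hσ, hlt, hle⟩ := (exists_smaller_rose_iff hρ hS.1).2 hS.2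
      exact ⟨σ, ⟨hσ, hlt⟩, hσ.mem_st_iff.2
        ⟨hL, fun y hy => SpineVertex.le_trans' hle (hmin y hy)⟩⟩

lemma isReductive_treeVertex_iff (hS : IsSideSystem ρ.G S) :
    IsReductive W ρ (treeVertex hρ S) ↔ (S ∩ ρ.reductiveSides W).Nonempty := by
  rw [IsReductive, reductiveComplex_eq hρ]
  constructor
  · rintro ⟨-, -, h⟩
    obtain ⟨T, hT, h⟩ := h _ (Finset.mem_singleton_self _)
    rw [← treeVertex_inj hρ hT.1 hS h]
    exact hT.2
  · intro h
    refine ⟨by simp, fun x hx y hy => ?_, fun x hx => ?_⟩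
    · rw [Finset.mem_singleton.1 hx, Finset.mem_singleton.1 hy]
      exact Or.inl (SpineVertex.le_refl' _)
    · exact ⟨S, ⟨hS, h⟩, (Finset.mem_singleton.1 hx).symm⟩

end MarkedGraph

/-! ## Ideal edges -/

section TwoVertices

variable {R : FinGraph} {S : Set (Set R.D)} (hS : IsSideSystem R S)

include hS

/-- Every tree edge `U` has distinct ends. With only two vertices, a further side `B` would not
separate these ends, yet its own edge needs ends that `B` separates. -/
lemma card_blowUp_eq_two_iff :
    Nat.card (blowUp hS).V = 2 ↔ ∃ A, IsIdealSide R A ∧ S = {A, Aᶜ} := by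
  have hne : ∀ U : S, (blowUp hS).src (Sum.inr U) ≠ (blowUp hS).tgt (Sum.inr U) := fun U h =>
    notMem_src_inr hS U (h ▸ mem_tgt_inr hS U)
  rw [Nat.card_eq_two_iff]
  constructor
  · rintro ⟨x, y, hxy, hu⟩
    obtain ⟨U, -, -⟩ := exists_src_eq hS hxy
    refine ⟨U.1, hS.ideal _ U.2, subset_antisymm (fun B hB => ?_) (hS.pair_subset U.2)⟩
    by_contra hc
    have h1 : U.1 ≠ B := fun h => hc (Or.inl h.symm)
    have h2 : U.1ᶜ ≠ B := fun h => hc (Or.inr h.symm)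
    have h3 := mem_src_iff_mem_tgt hS (U := U) h1 h2
    have h4 : ∀ v : (blowUp hS).V, v = (blowUp hS).src (Sum.inr U) ∨
        v = (blowUp hS).tgt (Sum.inr U) := by
      have h5 : ∀ v : (blowUp hS).V, v = x ∨ v = y := fun v => by
        have : v ∈ ({x, y} : Set (blowUp hS).V) := hu ▸ Set.mem_univ v
        exact this
      intro v
      have h6 := hne U
      rcases h5 v with rfl | rfl <;> rcases h5 ((blowUp hS).src (Sum.inr U)) with h7 | h7 <;>
        rcases h5 ((blowUp hS).tgt (Sum.inr U)) with h8 | h8 <;> simp_all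
    have h5 : ∀ v : (blowUp hS).V, B ∈ v.1 ↔ B ∈ ((blowUp hS).src (Sum.inr U)).1 := by
      intro v
      rcases h4 v with h | h
      · rw [h]
      · rw [h, h3]
    exact notMem_src_inr hS ⟨B, hB⟩ ((h5 _).2 ((h5 _).1 (mem_tgt_inr hS ⟨B, hB⟩)))
  · rintro ⟨A, hA, rfl⟩
    let U : ({A, Aᶜ} : Set (Set R.D)) := ⟨A, Or.inl rfl⟩
    have key : ∀ v w : (blowUp hS).V, (A ∈ v.1 ↔ A ∈ w.1) → v = w := by
      intro v w h
      by_contra hc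
      obtain ⟨T, hT, hT'⟩ := exists_mem_diff hS hc
      rcases mem_of_mem_vertex hS hT with rfl | rfl
      · exact hT' (h.2 hT)
      · have hA' : A ∈ ({A, Aᶜ} : Set (Set R.D)) := Or.inl rfl
        rw [compl_mem_vertex_iff hS _ hA'] at hT hT'
        exact hT' fun h1 => hT (h.1 h1)
    refine ⟨_, _, hne U, Set.eq_univ_of_forall fun v => ?_⟩
    by_cases hv : A ∈ v.1
    · exact Or.inr (key _ _ (iff_of_true hv (mem_tgt_inr hS U)))
    · exact Or.inl (key _ _ (iff_of_false hv (notMem_src_inr hS U)))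

end TwoVertices

namespace MarkedGraph

variable {n : ℕ} {W : ClassList n} {ρ : MarkedGraph n} (hρ : ρ.IsRose)

lemma isIdealEdge_iff {α : SpineVertex n} : IsIdealEdge ρ α ↔
    ∃ A, IsIdealSide ρ.G A ∧ α = treeVertex hρ {A, Aᶜ} := by
  rw [IsIdealEdge, singleton_mem_st_iff hρ]
  constructor
  · rintro ⟨⟨a, ha, h2⟩, S, hS, rfl⟩
    rw [treeVertex_eq hρ hS, cls_eq_iff] at ha
    obtain ⟨i, -⟩ := ha
    rw [Nat.card_congr i.onV] at h2
    obtain ⟨A, hA, rfl⟩ := (card_blowUp_eq_two_iff hS).1 h2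
    exact ⟨A, hA, rfl⟩
  · rintro ⟨A, hA, rfl⟩
    have hS := isSideSystem_pair hA
    exact ⟨⟨_, (treeVertex_eq hρ hS).symm, (card_blowUp_eq_two_iff hS).2 ⟨A, hA, rfl⟩⟩, _, hS, rfl⟩

lemma compatible_iff {A B : Set ρ.G.D} (hA : IsIdealSide ρ.G A) (hB : IsIdealSide ρ.G B) :
    Compatible ρ (treeVertex hρ {A, Aᶜ}) (treeVertex hρ {B, Bᶜ}) ↔ Nested A B := by
  constructor
  · rintro ⟨z, hz, h1, h2⟩
    obtain ⟨S, hS, rfl⟩ := (singleton_mem_st_iff hρ).1 hz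
    rw [treeVertex_le_iff hρ (isSideSystem_pair hA) hS] at h1
    rw [treeVertex_le_iff hρ (isSideSystem_pair hB) hS] at h2
    exact hS.nested A (h1 (Or.inl rfl)) B (h2 (Or.inl rfl))
  · intro h
    have hS := (isSideSystem_pair hA).union_pair hB (by
      rintro C (rfl | rfl)
      · exact h
      · exact h.compl_left)
    refine ⟨treeVertex hρ _, (singleton_mem_st_iff hρ).2 ⟨_, hS, rfl⟩, ?_, ?_⟩
    · exact (treeVertex_le_iff hρ (isSideSystem_pair hA) hS).2 Set.subset_union_left
    · exact (treeVertex_le_iff hρ (isSideSystem_pair hB) hS).2 Set.subset_union_right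

lemma forall_idealEdge_iff {S : Set (Set ρ.G.D)} (hS : IsSideSystem ρ.G S)
    {p : SpineVertex n → Prop} : (∀ α, IsIdealEdge ρ α → α ≤ treeVertex hρ S → p α) ↔
      ∀ A ∈ S, p (treeVertex hρ {A, Aᶜ}) := by
  constructor
  · intro h A hA
    exact h _ ((isIdealEdge_iff hρ).2 ⟨A, hS.ideal A hA, rfl⟩)
      ((treeVertex_le_iff hρ (isSideSystem_pair (hS.ideal A hA)) hS).2 (hS.pair_subset hA))
  · rintro h α hα hle
    obtain ⟨A, hA, rfl⟩ := (isIdealEdge_iff hρ).1 hα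
    exact h A ((treeVertex_le_iff hρ (isSideSystem_pair hA) hS).1 hle (Or.inl rfl))

lemma edgesReductive_iff {S : Set (Set ρ.G.D)} (hS : IsSideSystem ρ.G S) :
    EdgesReductive W ρ (treeVertex hρ S) ↔ S ⊆ ρ.reductiveSides W := by
  rw [EdgesReductive, forall_idealEdge_iff hρ hS]
  refine forall₂_congr fun A hA => ?_
  rw [isReductive_treeVertex_iff hρ (isSideSystem_pair (hS.ideal A hA))]
  constructor
  · rintro ⟨B, rfl | rfl, hB⟩
    · exact hB
    · rw [← compl_compl A]
      exact compl_mem_reductiveSides hB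
  · exact fun h => ⟨A, Or.inl rfl, h⟩

lemma fullSubcomplex_cliqueComplex {ι : Type*} (adj : ι → ι → Prop) (V U : Set ι) :
    fullSubcomplex (cliqueComplex adj V) U = cliqueComplex adj (V ∩ U) := by
  refine SetLike.ext fun s => ?_
  constructor
  · rintro ⟨⟨h1, h2, h3⟩, h4⟩
    exact ⟨h1, h2, fun x hx => ⟨h3 x hx, h4 x hx⟩⟩
  · rintro ⟨h1, h2, h3⟩
    exact ⟨⟨h1, h2, fun x hx => (h3 x hx).1⟩, fun x hx => (h3 x hx).2⟩

lemma strictComplex_eq : strictComplex W ρ =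
    cliqueComplex SpineComparable (treeVertex hρ '' treesIn (ρ.reductiveSides W)) := by
  rw [strictComplex, reductiveComplex_eq hρ, fullSubcomplex_cliqueComplex]
  congr 1
  ext x
  constructor
  · rintro ⟨⟨S, hS, rfl⟩, h⟩
    exact ⟨S, ⟨hS.1, hS.2.left, (edgesReductive_iff hρ hS.1).1 h⟩, rfl⟩
  · rintro ⟨S, ⟨hS, ⟨A, hA⟩, h⟩, rfl⟩
    exact ⟨⟨S, ⟨hS, A, hA, h hA⟩, rfl⟩, (edgesReductive_iff hρ hS).2 h⟩

lemma strictComplexAlong_eq {M : Set ρ.G.D} (hM : IsIdealSide ρ.G M) :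
    strictComplexAlong W ρ (treeVertex hρ {M, Mᶜ}) =
      cliqueComplex SpineComparable (treeVertex hρ '' treesAlong (ρ.reductiveSides W) M) := by
  rw [strictComplexAlong, strictComplex_eq hρ, fullSubcomplex_cliqueComplex]
  congr 1
  have key : ∀ S, IsSideSystem ρ.G S → ((∀ α, IsIdealEdge ρ α → α ≤ treeVertex hρ S →
      Compatible ρ α (treeVertex hρ {M, Mᶜ})) ↔ ∀ A ∈ S, Nested A M) := fun S hS => by
    rw [forall_idealEdge_iff hρ hS]
    exact forall₂_congr fun A hA => compatible_iff hρ (hS.ideal A hA) hM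
  ext x
  constructor
  · rintro ⟨⟨S, hS, rfl⟩, h⟩
    exact ⟨S, ⟨hS, (key S hS.1).1 h⟩, rfl⟩
  · rintro ⟨S, ⟨hS, h⟩, rfl⟩
    exact ⟨⟨S, hS, rfl⟩, (key S hS.1).2 h⟩

/-- The positive norm decreases to roses below an ideal edge are exactly the positive differences of
a petal weight and a side weight. Non-positive decreases do not affect a positive maximum. -/
lemma isMaximallyReductive_iff {μ : SpineVertex n} : IsMaximallyReductive W ρ μ ↔
    ∃ M m, ρ.IsMaximalSide W M m ∧ μ = treeVertex hρ {M, Mᶜ} := by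
  have hrose : ∀ {A : Set ρ.G.D} {h : ρ.G.D} (hA : IsIdealSide ρ.G A), Splits A h →
      ∃ σ : MarkedGraph n, σ.IsRose ∧ σ.cls ≤ treeVertex hρ {A, Aᶜ} ∧
        ρ.norm W - σ.norm W = ρ.petalWeight W h - ρ.sideWeight W A := by
    intro A h hA hh
    rw [treeVertex_eq hρ (isSideSystem_pair hA)]
    simp only [cls_le_iff]
    exact exists_rose hρ hA hh
  have hpetal : ∀ {A : Set ρ.G.D} {σ : MarkedGraph n} (hA : IsIdealSide ρ.G A), σ.IsRose →
      σ.cls ≤ treeVertex hρ {A, Aᶜ} → 0 < ρ.norm W - σ.norm W →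
      ∃ h, Splits A h ∧ ρ.norm W - σ.norm W = ρ.petalWeight W h - ρ.sideWeight W A := by
    intro A σ hA hσ hle h0
    rw [treeVertex_eq hρ (isSideSystem_pair hA), cls_le_iff] at hle
    exact exists_petal hρ hA hσ hle h0
  constructor
  · rintro ⟨hμ, ρ', hρ', hle, h0, hmax⟩
    obtain ⟨M, hM, rfl⟩ := (isIdealEdge_iff hρ).1 hμ
    obtain ⟨m, hm, hn⟩ := hpetal hM hρ' hle h0
    refine ⟨M, m, ⟨hM, hm, hn ▸ h0, fun A h hA hh => ?_⟩, rfl⟩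
    obtain ⟨σ, hσ, hle', hn'⟩ := hrose hA hh
    rw [← hn', ← hn]
    exact hmax _ σ ((isIdealEdge_iff hρ).2 ⟨A, hA, rfl⟩) hσ hle'
  · rintro ⟨M, m, hM, rfl⟩
    obtain ⟨ρ', hρ', hle, hn⟩ := hrose hM.ideal hM.splits
    refine ⟨(isIdealEdge_iff hρ).2 ⟨M, hM.ideal, rfl⟩, ρ', hρ', hle, hn ▸ hM.pos, ?_⟩
    intro α σ hα hσ hle'
    obtain ⟨A, hA, rfl⟩ := (isIdealEdge_iff hρ).1 hα
    rcases lt_or_ge 0 (ρ.norm W - σ.norm W) with h0 | h0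
    · obtain ⟨h, hh, hn'⟩ := hpetal hA hσ hle' h0
      rw [hn', hn]
      exact hM.le A h hA hh
    · exact h0.trans (hn ▸ hM.pos.le)

lemma dismantles_image {V V' : Set (Set (Set ρ.G.D))} (hV : ∀ S ∈ V, IsSideSystem ρ.G S)
    (h : Dismantles Comparable V V') :
    Dismantles SpineComparable (treeVertex hρ '' V) (treeVertex hρ '' V') :=
  h.image _ (fun _ hS _ hT => treeVertex_inj hρ (hV _ hS) (hV _ hT)) fun S hS T hT =>
    or_congr (treeVertex_le_iff hρ (hV S hS) (hV T hT)) (treeVertex_le_iff hρ (hV T hT) (hV S hS))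

end MarkedGraph

end OuterSpace

theorem mainTheorem2 {n : ℕ} (W : OuterSpace.ClassList n) (ρ : OuterSpace.MarkedGraph n)
    (hρ : ρ.IsRose) (hne : (OuterSpace.reductiveComplex W ρ).faces.Nonempty) :
    ContractibleSpace (OuterSpace.Realization (OuterSpace.reductiveComplex W ρ)) ∧
    OuterSpace.DeformationRetractsTo (OuterSpace.reductiveComplex W ρ)
      (OuterSpace.strictComplex W ρ) ∧
    (∃ μ, OuterSpace.IsMaximallyReductive W ρ μ) ∧
    ∀ μ, OuterSpace.IsMaximallyReductive W ρ μ →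
      OuterSpace.DeformationRetractsTo (OuterSpace.strictComplex W ρ)
        (OuterSpace.strictComplexAlong W ρ μ) ∧
      OuterSpace.DeformationRetractsTo (OuterSpace.strictComplexAlong W ρ μ)
        (OuterSpace.fullSubcomplex (OuterSpace.strictComplexAlong W ρ μ) {μ}) := by
  open OuterSpace OuterSpace.MarkedGraph in
  have hP : ∀ A ∈ ρ.reductiveSides W, IsIdealSide ρ.G A :=
    fun A hA => isIdealSide_of_mem_reductiveSides hA
  have hPc : ∀ A ∈ ρ.reductiveSides W, Aᶜ ∈ ρ.reductiveSides W :=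
    fun A hA => compl_mem_reductiveSides hA
  have d1 := dismantles_image hρ (fun S hS => hS.1) (dismantles_treesIn hPc)
  have d2 : ∀ {M m}, ρ.IsMaximalSide W M m → Dismantles SpineComparable _ _ := fun hM =>
    dismantles_image hρ (fun S hS => hS.1)
      (dismantles_treesAlong hP hPc fun A hA _ => hM.exists_corner hA)
  have d3 : ∀ {M m}, ρ.IsMaximalSide W M m → Dismantles SpineComparable _ _ := fun hM =>
    dismantles_image hρ (fun S hS => hS.1.1) (dismantles_pair hP hPc hM.mem_reductiveSides)
  -- A vertex of the non-empty complex is a tree with a reductive side, so the finite set of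
  -- possible exchanges has a positive maximal gain.
  have hmax : ∃ M m, ρ.IsMaximalSide W M m := by
    refine exists_isMaximalSide ?_
    obtain ⟨s, hs⟩ := hne
    rw [reductiveComplex_eq hρ] at hs
    obtain ⟨x, hx⟩ := hs.1
    obtain ⟨S, hS, -⟩ := hs.2.2 x hx
    exact hS.2.mono Set.inter_subset_right
  have hfin : ∀ V : Set (Set (Set ρ.G.D)), (treeVertex hρ '' V).Finite := fun V =>
    (finite_trees V).image _
  refine ⟨?_, ?_, ?_, ?_⟩
  · obtain ⟨M, m, hM⟩ := hmax
    have h := (d1.trans (d2 hM)).trans (d3 hM)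
    rw [Set.image_singleton] at h
    rw [reductiveComplex_eq hρ]
    exact h.contractibleSpace SpineComparable.refl SpineComparable.symm (hfin _)
  · rw [reductiveComplex_eq hρ, strictComplex_eq hρ]
    exact d1.deformationRetractsTo SpineComparable.refl SpineComparable.symm (hfin _)
  · obtain ⟨M, m, hM⟩ := hmax
    exact ⟨_, (isMaximallyReductive_iff hρ).2 ⟨M, m, hM, rfl⟩⟩
  · intro μ hμ
    obtain ⟨M, m, hM, rfl⟩ := (isMaximallyReductive_iff hρ).1 hμ
    rw [strictComplexAlong_eq hρ hM.ideal, strictComplex_eq hρ, fullSubcomplex_cliqueComplex]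
    refine ⟨(d2 hM).deformationRetractsTo SpineComparable.refl SpineComparable.symm (hfin _), ?_⟩
    have h := d3 hM
    -- Dismantling only removes vertices, so `μ` itself is a vertex of `Q_μ`.
    have hsub := h.subset
    rw [Set.image_singleton] at h hsub
    rw [Set.inter_eq_right.2 hsub]
    exact h.deformationRetractsTo SpineComparable.refl SpineComparable.symm (hfin _)
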